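/- For \(a\ge 0\) put \[ \varrho(a)=\int_a^\infty \frac{\sinh(2a)}{\cosh t\,\sqrt{\sinh^2(2t)-\sinh^2(2a)}}\,dt , \] where the integral converges for every \(a>0\) and \(\varrho(0)=0\). There is a constant \(a_c>0\) with \(a_c\approx 0.49577\) and \(2\varrho(a_c)\approx 1.00229\) (both correct to within \(5\cdot 10^{-6}\)) such that the following hold. (1) \(\varrho(a)\to 0\) as \(a\to 0^+\), \(\varrho\) is strictly increasing on \([0,a_c]\) and strictly decreasing on \([a_c,\infty)\), and \(\varrho(a)\to 0\) as \(a\to\infty\); in particular \(\varrho\) attains its maximum over \([0,\infty)\) at \(a_c\) and only there. (2) Let \(\mathbb B^3\) be the open unit ball of \(\mathbb R^3\) with the hyperbolic metric \(4(du^2+dv^2+dw^2)/(1-r^2)^2\), and let \(S^2_\infty\) be its boundary sphere. For a set \(X\subset\mathbb B^3\) let \(\partial_\infty X=\overline X\cap S^2_\infty\), where \(\overline X\) is the Euclidean closure; \(X\) is called asymptotic to \(\partial_\infty X\). Let \(C_1,C_2\subset S^2_\infty\) be disjoint round circles (of positive radius), and let \(d_L(C_1,C_2)\) be the hyperbolic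 distance between the two totally geodesic planes asymptotic to \(C_1\) and to \(C_2\). If \[ d_L(C_1,C_2)\le 2\varrho(a_c), \] then there is a spherical minimal catenoid \(\mathcal C\subset\mathbb B^3\) with \(\partial_\infty\mathcal C=C_1\cup C_2\). Here a spherical minimal catenoid is the image, under an isometry of \(\mathbb B^3\), of a surface \(\mathcal C_a\) with \(a>0\), and it is a smoothly immersed surface of zero mean curvature that is invariant under all isometries fixing the image of the axis \(\gamma_0=\{(u,0,0):-1<u<1\}\) pointwise. The surface \(\mathcal C_a\) is obtained by rotating about \(\gamma_0\) the curve \(s\mapsto(x(a,s),y(a,s))\), \(s\in\mathbb R\), where \(x\) is the signed hyperbolic position along \(\gamma_0\), measured from the origin, of the foot of the perpendicular to \(\gamma_0\), \(y\) is the hyperbolic distance to \(\gamma_0\), and \[ x(a,s)=\sqrt2\,\sinh(2a)\int_0^s\frac{\sqrt{\cosh(2a)\cosh(2t)-1}}{\cosh^2(2a)\cosh^2(2t)-1}\,dt,\qquad \cosh\bigl(2y(a,s)\bigr)=\cosh(2a)\cosh(2s),\quad y>0 . \] That these surfaces have zero mean curvature and this rotational symmetry is part of the claim. -/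

import Mathlib

open Set Filter Topology MeasureTheory
open scoped ContDiff

noncomputable section

namespace HypCatenoid

/-! ### The Gomes function -/

/-- The integrand `sinh (2a) / (cosh t * √(sinh² (2t) - sinh² (2a)))`. -/
def gomesIntegrand (a t : ℝ) : ℝ :=
  Real.sinh (2 * a) / (Real.cosh t * √(Real.sinh (2 * t) ^ 2 - Real.sinh (2 * a) ^ 2))

/-- The function `ϱ(a) = ∫_a^∞ sinh (2a) / (cosh t * √(sinh² (2t) - sinh² (2a))) dt`. -/
def gomes (a : ℝ) : ℝ := ∫ t in Ioi a, gomesIntegrand a t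

/-! ### The Poincaré ball model of hyperbolic 3-space -/

/-- The ambient Euclidean space `ℝ³`. -/
abbrev E3 := EuclideanSpace ℝ (Fin 3)

/-- The open unit ball. -/
def ball3 : Set E3 := Metric.ball 0 1

/-- The sphere at infinity. -/
def sphereInf : Set E3 := Metric.sphere 0 1

/-- The hyperbolic metric `4 (du² + dv² + dw²) / (1 - r²)²` at the point `x`, as a bilinear form
on tangent vectors. -/
def hypMetric (x v w : E3) : ℝ := 4 / (1 - ‖x‖ ^ 2) ^ 2 * inner ℝ v w

/-- The hyperbolic distance on the ball:
`cosh d(x, y) = 1 + 2 |x - y|² / ((1 - |x|²) (1 - |y|²))`. -/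
def hypDist (x y : E3) : ℝ :=
  Real.arcosh (1 + 2 * ‖x - y‖ ^ 2 / ((1 - ‖x‖ ^ 2) * (1 - ‖y‖ ^ 2)))

/-- `φ` restricts to an isometry of the ball onto itself (its values outside the open ball play
no role). -/
def IsHypIsometry (φ : E3 → E3) : Prop :=
  BijOn φ ball3 ball3 ∧ ∀ x ∈ ball3, ∀ y ∈ ball3, hypDist (φ x) (φ y) = hypDist x y

/-- The asymptotic boundary of a subset of the ball. -/
def asymptoticBoundary (X : Set E3) : Set E3 := closure X ∩ sphereInf

/-- Geodesic planes: the traces on the ball of the Euclidean planes and spheres that are orthogonal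
to the unit sphere. -/
def IsGeodesicPlane (P : Set E3) : Prop :=
  (∃ n : E3, n ≠ 0 ∧ P = {x | x ∈ ball3 ∧ inner ℝ n x = 0}) ∨
  (∃ (c : E3) (r : ℝ), 0 < r ∧ ‖c‖ ^ 2 = 1 + r ^ 2 ∧ P = {x | x ∈ ball3 ∧ ‖x - c‖ = r})

/-- Euclidean circles (of positive radius) on the sphere at infinity: its sections by the
planes that cut the open ball. -/
def IsCircleAtInfinity (C : Set E3) : Prop :=
  ∃ (n : E3) (h : ℝ), ‖n‖ = 1 ∧ |h| < 1 ∧ C = {x | x ∈ sphereInf ∧ inner ℝ n x = h}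

/-- `d_L(C₁, C₂)`: the hyperbolic distance between the geodesic planes asymptotic to `C₁` and `C₂`,
that is, the infimum of the distances between their points. -/
def circleDist (C₁ C₂ : Set E3) : ℝ :=
  sInf {d : ℝ | ∃ P₁ P₂ : Set E3,
    IsGeodesicPlane P₁ ∧ asymptoticBoundary P₁ = C₁ ∧
    IsGeodesicPlane P₂ ∧ asymptoticBoundary P₂ = C₂ ∧
    ∃ p ∈ P₁, ∃ q ∈ P₂, d = hypDist p q}

/-! ### Minimal immersions into the ball -/

/-- The derivative of a map of the parameter plane in the direction `v`. -/
def dirDeriv (X : ℝ × ℝ → E3) (v p : ℝ × ℝ) : E3 := fderiv ℝ X p v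

/-- `⟨∇_u v, w⟩` at `x`, for constant vector fields `u`, `v`, `w` on the ball and the Levi-Civita
connection `∇` of the hyperbolic metric (Koszul formula; constant fields commute). -/
def christoffel (x u v w : E3) : ℝ :=
  (fderiv ℝ (fun z => hypMetric z v w) x u + fderiv ℝ (fun z => hypMetric z u w) x v
    - fderiv ℝ (fun z => hypMetric z u v) x w) / 2

/-- The first fundamental form of `X`. -/
def firstForm (X : ℝ × ℝ → E3) (p v w : ℝ × ℝ) : ℝ :=
  hypMetric (X p) (dirDeriv X v p) (dirDeriv X w p)

/-- The second fundamental form of `X` with respect to the normal `ν`,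
`h(v, w) = ⟨∇_v ν, ∂_w X⟩ = - ⟨∇_v ∂_w X, ν⟩`. -/
def secondForm (X : ℝ × ℝ → E3) (ν : E3) (p v w : ℝ × ℝ) : ℝ :=
  -(hypMetric (X p) (dirDeriv (dirDeriv X w) v p) ν
    + christoffel (X p) (dirDeriv X v p) (dirDeriv X w p) ν)

/-- The mean curvature `H` of `X` with respect to the unit normal `ν`: the trace of the second
fundamental form with respect to the first one. -/
def meanCurvature (X : ℝ × ℝ → E3) (ν : E3) (p : ℝ × ℝ) : ℝ :=
  (firstForm X p (0, 1) (0, 1) * secondForm X ν p (1, 0) (1, 0)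
    - 2 * firstForm X p (1, 0) (0, 1) * secondForm X ν p (1, 0) (0, 1)
    + firstForm X p (1, 0) (1, 0) * secondForm X ν p (0, 1) (0, 1)) /
  (firstForm X p (1, 0) (1, 0) * firstForm X p (0, 1) (0, 1)
    - firstForm X p (1, 0) (0, 1) ^ 2)

/-- `X` is a smooth immersion of the plane into the ball whose mean curvature for the
hyperbolic metric vanishes identically. -/
structure IsMinimalImmersion (X : ℝ × ℝ → E3) : Prop where
  smooth : ContDiff ℝ ∞ X
  mem_ball : ∀ p, X p ∈ ball3
  immersion : ∀ p, Function.Injective (fderiv ℝ X p)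
  minimal : ∀ (p : ℝ × ℝ) (ν : E3), (∀ v, hypMetric (X p) (dirDeriv X v p) ν = 0) →
    hypMetric (X p) ν ν = 1 → meanCurvature X ν p = 0

/-! ### Spherical catenoids -/

/-- The geodesic `{(u, 0, 0) : -1 < u < 1}`. -/
def axis0 : Set E3 := {x | x ∈ ball3 ∧ x 1 = 0 ∧ x 2 = 0}

/-- `S` is a surface of revolution about the geodesic `γ`: it is invariant under the isometries
that fix `γ` pointwise. -/
def IsSurfaceOfRevolution (γ S : Set E3) : Prop :=
  ∀ ψ : E3 → E3, IsHypIsometry ψ → (∀ x ∈ γ, ψ x = x) → ψ '' S = S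

/-- First coordinate of the catenary `σ_a` in arc length: the position along the axis. -/
def catX (a s : ℝ) : ℝ :=
  √2 * Real.sinh (2 * a) *
    ∫ t in (0 : ℝ)..s, √(Real.cosh (2 * a) * Real.cosh (2 * t) - 1) /
      (Real.cosh (2 * a) ^ 2 * Real.cosh (2 * t) ^ 2 - 1)

/-- Second coordinate of the catenary `σ_a` in arc length: the distance to the axis, so that
`cosh (2 y) = cosh (2 a) cosh (2 s)`. -/
def catY (a s : ℝ) : ℝ := Real.arcosh (Real.cosh (2 * a) * Real.cosh (2 * s)) / 2

/-- The point of the ball with signed position `x` along the axis, distance `y` to the axis and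
rotation angle `θ`. -/
def ballPoint (x y θ : ℝ) : E3 :=
  !₂[Real.sinh x * Real.cosh y / (1 + Real.cosh x * Real.cosh y),
     Real.sinh y / (1 + Real.cosh x * Real.cosh y) * Real.cos θ,
     Real.sinh y / (1 + Real.cosh x * Real.cosh y) * Real.sin θ]

/-- The parametrization `(s, θ) ↦ Y(a, s, θ)` of the catenoid `𝒞_a`, obtained by rotating the
catenary `σ_a` about the axis. -/
def catenoidParam (a : ℝ) (p : ℝ × ℝ) : E3 := ballPoint (catX a p.1) (catY a p.1) p.2

/-- `S` is a spherical minimal catenoid: the image of some `𝒞_a`, `a > 0`, under an isometry of the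
ball, which is a minimal surface and a surface of revolution about the image of the axis. -/
def IsSphericalMinimalCatenoid (S : Set E3) : Prop :=
  ∃ (a : ℝ) (φ : E3 → E3), 0 < a ∧ IsHypIsometry φ ∧
    S = range (fun p => φ (catenoidParam a p)) ∧
    IsMinimalImmersion (fun p => φ (catenoidParam a p)) ∧
    IsSurfaceOfRevolution (φ '' axis0) S

end HypCatenoid

end

open Set Filter Topology MeasureTheory
open scoped ContDiff

noncomputable section

namespace HypCatenoid

/-! The geometric half takes place in the hyperboloid model, where isometries are linear. A geodesic
plane is the section by the hyperplane orthogonal to a spacelike vector, and a circle at infinity is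
the set of null directions orthogonal to that vector. Disjoint circles have unit normals with
product `cosh (2ρ) > 1` for some `ρ > 0`. A Lorentz transformation brings them to the normals of the
two planes orthogonal to the axis at positions `±ρ` (`exists_normals`, `exists_lorentzIso`), and
those planes are at distance at least `2ρ`. This inequality is all that is needed from `circleDist`.

A surface `Y` in the hyperboloid is minimal when `G Y_ss - 2F Y_sθ + E Y_θθ - 2(EG - F²) Y` is
tangent. For the catenoid this reduces to the equations of the catenary. In the variable `t = y(a,
s)` the integral `ϱ(a)` becomes the total axial displacement `∫₀^∞ x'(s) ds`, so `x(a, s) → ±ϱ(a)`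
at the two ends and the boundary of `𝒞_a` consists of the circles at `±ϱ(a)`
(`asymptoticBoundary_catenoid`, `tendsto_catX`). What remains is to solve `ϱ(a) = ρ`. As `2ρ ≤ d_L ≤
2ϱ(a_c)`, `ϱ(0) = 0` and `ϱ` is continuous, the intermediate value theorem gives `a`.

The analytic half uses `k = 1 / cosh (2a)`. The substitution `cosh (2t) = cosh (2a) cosh u` turns
`ϱ` into an integral over a fixed half-line, continuous on `[0, 1]` and zero at both ends. Its
`k`-derivative has no evident sign, but subtracting an exact `u`-derivative leaves a negative
multiple of the integral of `cosh u / √(cosh u - k) - √(cosh u) - cosh^(-3/2) u`, which is strictly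
increasing in `k` (`integral_slope_identity`, `strictMonoOn_gomesSlope`). So one change of sign
proves unimodality, and numerical signs at two nearby points locate the maximum.

For the numerics, the integrands are expanded in powers of `k / cosh u` with explicit remainders.
The integrals become combinations of the moments `M(p) = ∫ cosh^(-p)`, which the recurrence `(p + 1)
M(p + 2) = p M(p)` reduces to `M(1/2)` and `M(3/2)`. These two are bounded by applying the
recurrence twenty times and comparing the result with `π`. -/

/-! ### Minkowski space and Lorentz transformations -/

/-- The Minkowski form on `ℝ³ × ℝ`. -/
def mink (v w : E3 × ℝ) : ℝ := inner ℝ v.1 w.1 - v.2 * w.2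

lemma mink_comm (v w : E3 × ℝ) : mink v w = mink w v := by
  simp only [mink, real_inner_comm, mul_comm]

lemma mink_add_left (u v w : E3 × ℝ) : mink (u + v) w = mink u w + mink v w := by
  simp only [mink, Prod.fst_add, Prod.snd_add, inner_add_left]; ring

lemma mink_smul_left (c : ℝ) (v w : E3 × ℝ) : mink (c • v) w = c * mink v w := by
  simp only [mink, Prod.smul_fst, Prod.smul_snd, real_inner_smul_left, smul_eq_mul]; ring

lemma mink_sub_left (u v w : E3 × ℝ) : mink (u - v) w = mink u w - mink v w := by
  simp only [mink, Prod.fst_sub, Prod.snd_sub, inner_sub_left]; ring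

lemma mink_neg_left (v w : E3 × ℝ) : mink (-v) w = -mink v w := by
  simp only [mink, Prod.fst_neg, Prod.snd_neg, inner_neg_left]; ring

lemma mink_add_right (u v w : E3 × ℝ) : mink u (v + w) = mink u v + mink u w := by
  rw [mink_comm, mink_add_left, mink_comm v, mink_comm w]

lemma mink_smul_right (c : ℝ) (v w : E3 × ℝ) : mink v (c • w) = c * mink v w := by
  rw [mink_comm, mink_smul_left, mink_comm]

lemma mink_sub_right (u v w : E3 × ℝ) : mink u (v - w) = mink u v - mink u w := by
  rw [mink_comm, mink_sub_left, mink_comm v, mink_comm w]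

lemma mink_neg_right (v w : E3 × ℝ) : mink v (-w) = -mink v w := by
  rw [mink_comm, mink_neg_left, mink_comm]

lemma mink_self (v : E3 × ℝ) : mink v v = ‖v.1‖ ^ 2 - v.2 ^ 2 := by
  simp only [mink, real_inner_self_eq_norm_sq]; ring

/-- Two future causal vectors, one of them timelike, have negative product. -/
lemma mink_neg_of_future {v w : E3 × ℝ} (hv : mink v v ≤ 0) (hv' : 0 < v.2)
    (hw : mink w w < 0) (hw' : 0 < w.2) : mink v w < 0 := by
  rw [mink_self] at hv hw
  have h1 : ‖v.1‖ ≤ v.2 := by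
    apply le_of_sq_le_sq _ hv'.le
    linarith
  have h2 : ‖w.1‖ < w.2 := by
    apply lt_of_pow_lt_pow_left₀ 2 hw'.le
    linarith
  have h3 := real_inner_le_norm v.1 w.1
  have h4 : ‖v.1‖ * ‖w.1‖ ≤ v.2 * ‖w.1‖ := by gcongr
  have h5 : v.2 * ‖w.1‖ < v.2 * w.2 := by gcongr
  simp only [mink]
  linarith

/-- The linear isomorphisms of Minkowski space that preserve the form and the future. -/
structure LorentzIso where
  /-- The underlying linear isomorphism. -/
  toEquiv : (E3 × ℝ) ≃L[ℝ] (E3 × ℝ)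
  mink_map : ∀ v w, mink (toEquiv v) (toEquiv w) = mink v w
  future : ∀ v, mink v v ≤ 0 → 0 < v.2 → 0 < (toEquiv v).2

/-- The inverse Lorentz transformation. -/
def LorentzIso.symm (L : LorentzIso) : LorentzIso where
  toEquiv := L.toEquiv.symm
  mink_map v w := by
    rw [← L.mink_map, L.toEquiv.apply_symm_apply, L.toEquiv.apply_symm_apply]
  future v hv hv' := by
    have hm : mink (L.toEquiv.symm v) (L.toEquiv.symm v) ≤ 0 := by
      rwa [← L.mink_map, L.toEquiv.apply_symm_apply]
    -- The preimage is causal. Time component zero would make it the zero vector, and a negative one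
    -- would make its opposite a future vector with image `-v`.
    rcases lt_trichotomy 0 (L.toEquiv.symm v).2 with h | h | h
    · exact h
    · rw [mink_self, ← h] at hm
      have h1 : (L.toEquiv.symm v).1 = 0 := by
        have : ‖(L.toEquiv.symm v).1‖ ^ 2 ≤ 0 := by linarith
        simpa using this
      have h2 : L.toEquiv.symm v = 0 := Prod.ext h1 h.symm
      have h3 : v = 0 := by simpa using h2
      simp [h3] at hv'
    · have h1 := L.future (-(L.toEquiv.symm v))
        (by rwa [mink_neg_left, mink_neg_right, neg_neg]) (by simpa using h)
      rw [map_neg, L.toEquiv.apply_symm_apply] at h1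
      simp only [Prod.snd_neg] at h1
      linarith

/-- The composition of two Lorentz transformations. -/
def LorentzIso.comp (L M : LorentzIso) : LorentzIso where
  toEquiv := M.toEquiv.trans L.toEquiv
  mink_map v w := by simp [L.mink_map, M.mink_map]
  future v hv hv' := by
    simpa using L.future _ (by rwa [M.mink_map]) (M.future v hv hv')

/-- The map `v ↦ v - 2 ⟨v, w⟩ / ⟨w, w⟩ w` (the identity for `w = 0`). -/
def minkReflection (w : E3 × ℝ) : (E3 × ℝ) →ₗ[ℝ] (E3 × ℝ) where
  toFun v := v - (2 * mink v w / mink w w) • w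
  map_add' u v := by rw [mink_add_left, mul_add, add_div, add_smul]; abel
  map_smul' c v := by
    rw [mink_smul_left, RingHom.id_apply, smul_sub, smul_smul]; ring_nf

lemma minkReflection_apply (w v : E3 × ℝ) :
    minkReflection w v = v - (2 * mink v w / mink w w) • w := rfl

lemma minkReflection_involutive {w : E3 × ℝ} (hw : w = 0 ∨ 0 < mink w w) :
    Function.Involutive (minkReflection w) := by
  intro v
  rcases hw with rfl | hw
  · simp [minkReflection_apply]
  · simp only [minkReflection_apply, mink_sub_left, mink_smul_left]
    have : 2 * (mink v w - 2 * mink v w / mink w w * mink w w) / mink w w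
        = -(2 * mink v w / mink w w) := by field_simp; ring
    rw [this, neg_smul]; abel

lemma mink_minkReflection {w : E3 × ℝ} (hw : w = 0 ∨ 0 < mink w w) (u v : E3 × ℝ) :
    mink (minkReflection w u) (minkReflection w v) = mink u v := by
  rcases hw with rfl | hw
  · simp [minkReflection_apply]
  · simp only [minkReflection_apply, mink_sub_left, mink_smul_left, mink_sub_right,
      mink_smul_right, mink_comm w v]
    field_simp; ring

/-- The Lorentz reflection in the hyperplane orthogonal to a spacelike vector. -/
def LorentzIso.reflection (w : E3 × ℝ) (hw : w = 0 ∨ 0 < mink w w) : LorentzIso where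
  toEquiv := (LinearEquiv.ofInvolutive (minkReflection w)
    (minkReflection_involutive hw)).toContinuousLinearEquiv
  mink_map u v := mink_minkReflection hw u v
  future v hv hv' := by
    change 0 < (minkReflection w v).2
    -- The time component of the image of `v` is minus its product with `(0, 1)`. Since the
    -- reflection is an isometric involution, this is minus the product of `v` with the image of
    -- `(0, 1)`, a future timelike vector.
    have h0 : ∀ u : E3 × ℝ, mink u (0, 1) = -u.2 := by simp [mink]
    have h1 : 0 < (minkReflection w (0, 1)).2 := by
      rw [minkReflection_apply, mink_comm, h0]
      simp only [Prod.snd_sub, Prod.smul_snd, smul_eq_mul]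
      rcases hw with rfl | hw
      · simp
      · have : 0 ≤ w.2 * w.2 / mink w w := div_nonneg (mul_self_nonneg _) hw.le
        have h2 : 2 * -w.2 / mink w w * w.2 = - (2 * (w.2 * w.2 / mink w w)) := by ring
        rw [h2]; linarith
    have h2 := mink_minkReflection hw v (minkReflection w (0, 1))
    rw [minkReflection_involutive hw, h0] at h2
    have h3 := mink_neg_of_future hv hv' (w := minkReflection w (0, 1))
      (by rw [mink_minkReflection hw]; simp [mink]) h1
    linarith

lemma LorentzIso.reflection_apply {w : E3 × ℝ} (hw : w = 0 ∨ 0 < mink w w) (v : E3 × ℝ) :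
    (LorentzIso.reflection w hw).toEquiv v = v - (2 * mink v w / mink w w) • w := rfl

/-- For vectors of equal norm, `2⟨u, u - v⟩ = ⟨u - v, u - v⟩`, so the reflection along the
difference exchanges them. The degenerate case `w = 0` is admitted to cover `u = v`. -/
lemma LorentzIso.reflection_sub {u v : E3 × ℝ} (hw : u - v = 0 ∨ 0 < mink (u - v) (u - v))
    (huv : mink u u = mink v v) : (LorentzIso.reflection (u - v) hw).toEquiv u = v := by
  rw [LorentzIso.reflection_apply]
  rcases hw with h | h
  · rw [h]; simpa using sub_eq_zero.1 h
  · have h1 : 2 * mink u (u - v) = mink (u - v) (u - v) := by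
      simp only [mink_sub_left, mink_sub_right, huv, mink_comm v u]; ring
    rw [h1, div_self h.ne', one_smul]; abel

/-! ### The action on the ball -/

/-- The point of Minkowski space over a point of the ball, in homogeneous form. -/
def homLift (x : E3) : E3 × ℝ := ((2 : ℝ) • x, 1 + ‖x‖ ^ 2)

/-- Without the normalising factor `1 / (1 - ‖x‖²)` the lift still makes sense on the unit sphere,
where it is a null vector, so interior and boundary points are treated alike. -/
lemma mink_homLift (x y : E3) : mink (homLift x) (homLift y)
    = -((1 - ‖x‖ ^ 2) * (1 - ‖y‖ ^ 2) + 2 * ‖x - y‖ ^ 2) := by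
  rw [@norm_sub_sq_real]
  simp only [mink, homLift, real_inner_smul_left, real_inner_smul_right]
  ring

lemma mink_homLift_self (x : E3) : mink (homLift x) (homLift x) = -(1 - ‖x‖ ^ 2) ^ 2 := by
  rw [mink_homLift]; simp; ring

lemma mem_ball3_iff {x : E3} : x ∈ ball3 ↔ 0 < 1 - ‖x‖ ^ 2 := by
  rw [ball3, mem_ball_zero_iff, sub_pos, sq_lt_one_iff₀ (norm_nonneg x)]

lemma mem_sphereInf_iff {x : E3} : x ∈ sphereInf ↔ 1 - ‖x‖ ^ 2 = 0 := by
  rw [sphereInf, mem_sphere_zero_iff_norm, sub_eq_zero, eq_comm (a := (1 : ℝ)),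
    pow_eq_one_iff_of_nonneg (norm_nonneg x) two_ne_zero]

lemma mem_closedBall3_iff {x : E3} : x ∈ Metric.closedBall (0 : E3) 1 ↔ 0 ≤ 1 - ‖x‖ ^ 2 := by
  rw [mem_closedBall_zero_iff, sub_nonneg, sq_le_one_iff₀ (norm_nonneg x)]

lemma hypDist_eq {x y : E3} (hx : x ∈ ball3) (hy : y ∈ ball3) : hypDist x y
    = Real.arcosh (-mink (homLift x) (homLift y) / ((1 - ‖x‖ ^ 2) * (1 - ‖y‖ ^ 2))) := by
  rw [mem_ball3_iff] at hx hy
  rw [hypDist, mink_homLift]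
  congr 1
  field_simp

lemma one_le_neg_mink_div {x y : E3} (hx : x ∈ ball3) (hy : y ∈ ball3) :
    1 ≤ -mink (homLift x) (homLift y) / ((1 - ‖x‖ ^ 2) * (1 - ‖y‖ ^ 2)) := by
  rw [mem_ball3_iff] at hx hy
  rw [mink_homLift, le_div_iff₀ (by positivity)]
  nlinarith [sq_nonneg ‖x - y‖]

/-- The transformation of the (closed) ball induced by a Lorentz transformation. -/
def LorentzIso.ballMap (L : LorentzIso) (x : E3) : E3 :=
  ((L.toEquiv (homLift x)).2 + (1 - ‖x‖ ^ 2))⁻¹ • (L.toEquiv (homLift x)).1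

namespace LorentzIso

variable (L : LorentzIso)

lemma time_pos (x : E3) : 0 < (L.toEquiv (homLift x)).2 :=
  L.future _ (by rw [mink_homLift_self]; nlinarith [sq_nonneg (1 - ‖x‖ ^ 2)])
    (by simp only [homLift]; positivity)

lemma denom_pos {x : E3} (hx : x ∈ Metric.closedBall (0 : E3) 1) :
    0 < (L.toEquiv (homLift x)).2 + (1 - ‖x‖ ^ 2) :=
  add_pos_of_pos_of_nonneg (L.time_pos x) (mem_closedBall3_iff.1 hx)

lemma one_sub_norm_ballMap {x : E3} (hx : x ∈ Metric.closedBall (0 : E3) 1) :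
    1 - ‖L.ballMap x‖ ^ 2
      = 2 / ((L.toEquiv (homLift x)).2 + (1 - ‖x‖ ^ 2)) * (1 - ‖x‖ ^ 2) := by
  have hd := L.denom_pos hx
  have h := L.mink_map (homLift x) (homLift x)
  rw [mink_self, mink_homLift_self] at h
  have h1 : ‖(L.toEquiv (homLift x)).1‖ ^ 2
    = (L.toEquiv (homLift x)).2 ^ 2 - (1 - ‖x‖ ^ 2) ^ 2 := by linarith
  rw [ballMap, norm_smul, mul_pow, h1, Real.norm_eq_abs, sq_abs]
  field_simp
  ring

/-- The induced map is the linear action on rays: a vector `(X, T)` of norm `-m²` projects to `X /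
(T + m)`, here with `m = 1 - ‖x‖²`. Conditions homogeneous in the lift are therefore transported by
`L`. -/
lemma homLift_ballMap {x : E3} (hx : x ∈ Metric.closedBall (0 : E3) 1) :
    homLift (L.ballMap x)
      = (2 / ((L.toEquiv (homLift x)).2 + (1 - ‖x‖ ^ 2))) • L.toEquiv (homLift x) := by
  have hd := L.denom_pos hx
  refine Prod.ext ?_ ?_
  · simp only [homLift, ballMap, Prod.smul_fst, smul_smul]
    rw [div_eq_mul_inv]
  · have h := L.one_sub_norm_ballMap hx
    have h1 : (homLift (L.ballMap x)).2 = 2 - (1 - ‖L.ballMap x‖ ^ 2) := by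
      simp only [homLift]; ring
    rw [h1, h, Prod.smul_snd, smul_eq_mul]
    field_simp
    ring

lemma ballMap_mem_ball {x : E3} (hx : x ∈ ball3) : L.ballMap x ∈ ball3 := by
  have hx' := Metric.ball_subset_closedBall hx
  have hd := L.denom_pos hx'
  rw [mem_ball3_iff] at hx ⊢
  rw [L.one_sub_norm_ballMap hx']
  positivity

lemma ballMap_mem_sphere {x : E3} (hx : x ∈ sphereInf) : L.ballMap x ∈ sphereInf := by
  have hx' := Metric.sphere_subset_closedBall hx
  rw [mem_sphereInf_iff] at hx ⊢
  rw [L.one_sub_norm_ballMap hx', hx, mul_zero]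

lemma symm_ballMap_ballMap {x : E3} (hx : x ∈ Metric.closedBall (0 : E3) 1) :
    L.symm.ballMap (L.ballMap x) = x := by
  have hd := L.denom_pos hx
  rw [ballMap, L.one_sub_norm_ballMap hx, L.homLift_ballMap hx, map_smul]
  simp only [symm, ContinuousLinearEquiv.symm_apply_apply, homLift, Prod.smul_fst, Prod.smul_snd,
    smul_smul, smul_eq_mul] at hd ⊢
  convert one_smul ℝ x using 2
  field_simp
  ring

lemma ballMap_symm_ballMap {x : E3} (hx : x ∈ Metric.closedBall (0 : E3) 1) :
    L.ballMap (L.symm.ballMap x) = x := L.symm.symm_ballMap_ballMap hx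

lemma continuousOn_ballMap : ContinuousOn L.ballMap (Metric.closedBall (0 : E3) 1) := by
  have h : Continuous fun x : E3 => L.toEquiv (homLift x) :=
    L.toEquiv.continuous.comp (by unfold homLift; fun_prop)
  unfold ballMap
  refine ContinuousOn.smul (ContinuousOn.inv₀
    (Continuous.continuousOn (h.snd.add (by fun_prop))) ?_) h.fst.continuousOn
  exact fun x hx => (L.denom_pos hx).ne'

lemma isHypIsometry_ballMap : IsHypIsometry L.ballMap := by
  refine ⟨⟨fun x hx => L.ballMap_mem_ball hx, ?_, ?_⟩, ?_⟩
  · intro x hx y hy h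
    rw [← L.symm_ballMap_ballMap (Metric.ball_subset_closedBall hx), h,
      L.symm_ballMap_ballMap (Metric.ball_subset_closedBall hy)]
  · intro x hx
    exact ⟨_, L.symm.ballMap_mem_ball hx, L.ballMap_symm_ballMap (Metric.ball_subset_closedBall hx)⟩
  · intro x hx y hy
    have hx' := Metric.ball_subset_closedBall hx
    have hy' := Metric.ball_subset_closedBall hy
    have dx := L.denom_pos hx'
    have dy := L.denom_pos hy'
    rw [hypDist_eq hx hy, hypDist_eq (L.ballMap_mem_ball hx) (L.ballMap_mem_ball hy),
      L.homLift_ballMap hx', L.homLift_ballMap hy', L.one_sub_norm_ballMap hx',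
      L.one_sub_norm_ballMap hy', mink_smul_left, mink_smul_right, L.mink_map]
    rw [mem_ball3_iff] at hx hy
    congr 1
    field_simp

/-- The map is continuous on the compact closed ball, so it commutes with closure, and it and its
inverse preserve the sphere. -/
lemma asymptoticBoundary_ballMap_image {S : Set E3} (hS : S ⊆ ball3) :
    asymptoticBoundary (L.ballMap '' S) = L.ballMap '' asymptoticBoundary S := by
  have hc : closure S ⊆ Metric.closedBall (0 : E3) 1 :=
    closure_minimal (hS.trans Metric.ball_subset_closedBall) Metric.isClosed_closedBall
  have hK : IsCompact (closure S) :=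
    (isCompact_closedBall (0 : E3) 1).of_isClosed_subset isClosed_closure hc
  rw [asymptoticBoundary, ← image_closure_of_isCompact hK (L.continuousOn_ballMap.mono hc)]
  ext z
  constructor
  · rintro ⟨⟨x, hx, rfl⟩, hz⟩
    refine ⟨x, ⟨hx, ?_⟩, rfl⟩
    rw [← L.symm_ballMap_ballMap (hc hx)]
    exact L.symm.ballMap_mem_sphere hz
  · rintro ⟨x, ⟨hx, hs⟩, rfl⟩
    exact ⟨⟨x, hx, rfl⟩, L.ballMap_mem_sphere hs⟩

/-- The image under `L` of the set of null directions orthogonal to `N`. -/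
lemma ballMap_image_null (N : E3 × ℝ) :
    L.ballMap '' {z | z ∈ sphereInf ∧ mink N (homLift z) = 0}
      = {z | z ∈ sphereInf ∧ mink (L.toEquiv N) (homLift z) = 0} := by
  have key : ∀ (M : LorentzIso) (N : E3 × ℝ) (z : E3), z ∈ sphereInf → mink N (homLift z) = 0 →
      mink (M.toEquiv N) (homLift (M.ballMap z)) = 0 := by
    intro M N z hz h
    rw [M.homLift_ballMap (Metric.sphere_subset_closedBall hz), mink_smul_right, M.mink_map, h,
      mul_zero]
  ext z
  constructor
  · rintro ⟨x, ⟨hx, h⟩, rfl⟩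
    exact ⟨L.ballMap_mem_sphere hx, key L N x hx h⟩
  · rintro ⟨hz, h⟩
    refine ⟨L.symm.ballMap z, ⟨L.symm.ballMap_mem_sphere hz, ?_⟩,
      L.ballMap_symm_ballMap (Metric.sphere_subset_closedBall hz)⟩
    have := key L.symm (L.toEquiv N) z hz h
    simpa [symm] using this

/-- The image under `L` of the plane orthogonal to `N`. -/
lemma ballMap_image_plane (N : E3 × ℝ) :
    L.ballMap '' {z | z ∈ ball3 ∧ mink N (homLift z) = 0}
      = {z | z ∈ ball3 ∧ mink (L.toEquiv N) (homLift z) = 0} := by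
  have key : ∀ (M : LorentzIso) (N : E3 × ℝ) (z : E3), z ∈ ball3 → mink N (homLift z) = 0 →
      mink (M.toEquiv N) (homLift (M.ballMap z)) = 0 := by
    intro M N z hz h
    rw [M.homLift_ballMap (Metric.ball_subset_closedBall hz), mink_smul_right, M.mink_map, h,
      mul_zero]
  ext z
  constructor
  · rintro ⟨x, ⟨hx, h⟩, rfl⟩
    exact ⟨L.ballMap_mem_ball hx, key L N x hx h⟩
  · rintro ⟨hz, h⟩
    refine ⟨L.symm.ballMap z, ⟨L.symm.ballMap_mem_ball hz, ?_⟩,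
      L.ballMap_symm_ballMap (Metric.ball_subset_closedBall hz)⟩
    have := key L.symm (L.toEquiv N) z hz h
    simpa [symm] using this

end LorentzIso

/-! ### Mean curvature through the hyperboloid model -/

/-- The projection of the hyperboloid onto the ball. -/
def stereo (v : E3 × ℝ) : E3 := (1 + v.2)⁻¹ • v.1

lemma one_sub_norm_stereo {v : E3 × ℝ} (h : mink v v = -1) (hv : 0 < v.2) :
    1 - ‖stereo v‖ ^ 2 = 2 / (1 + v.2) := by
  have h1 : ‖v.1‖ ^ 2 = v.2 ^ 2 - 1 := by rw [mink_self] at h; linarith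
  rw [stereo, norm_smul, mul_pow, h1, Real.norm_eq_abs, sq_abs]
  field_simp
  ring

lemma stereo_mem_ball {v : E3 × ℝ} (h : mink v v = -1) (hv : 0 < v.2) : stereo v ∈ ball3 := by
  rw [mem_ball3_iff, one_sub_norm_stereo h hv]
  positivity

lemma homLift_stereo {v : E3 × ℝ} (h : mink v v = -1) (hv : 0 < v.2) :
    homLift (stereo v) = (2 / (1 + v.2)) • v := by
  refine Prod.ext ?_ ?_
  · simp only [homLift, stereo, Prod.smul_fst, smul_smul]
    rw [div_eq_mul_inv]
  · have h1 : (homLift (stereo v)).2 = 2 - (1 - ‖stereo v‖ ^ 2) := by simp only [homLift]; ring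
    rw [h1, one_sub_norm_stereo h hv, Prod.smul_snd, smul_eq_mul]
    field_simp
    ring

lemma LorentzIso.ballMap_stereo (L : LorentzIso) {v : E3 × ℝ} (h : mink v v = -1) (hv : 0 < v.2) :
    L.ballMap (stereo v) = stereo (L.toEquiv v) := by
  have h1 := L.future v (by linarith) hv
  rw [ballMap, one_sub_norm_stereo h hv, homLift_stereo h hv, map_smul, stereo]
  simp only [Prod.smul_fst, Prod.smul_snd, smul_eq_mul, smul_smul]
  congr 1
  field_simp
  ring

lemma fderiv_hypMetric {x : E3} (hx : x ∈ ball3) (u v w : E3) :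
    fderiv ℝ (fun z => hypMetric z v w) x u
      = 2 * (2 / (1 - ‖x‖ ^ 2)) ^ 3 * inner ℝ x u * inner ℝ v w := by
  rw [mem_ball3_iff] at hx
  have h1 : HasFDerivAt (fun z : E3 => 1 - ‖z‖ ^ 2) (-(2 • innerSL ℝ x)) x := by
    simpa using (hasStrictFDerivAt_norm_sq x).hasFDerivAt.const_sub 1
  have h2 : HasDerivAt (fun r : ℝ => 4 / r ^ 2 * inner ℝ v w)
      (-8 / (1 - ‖x‖ ^ 2) ^ 3 * inner ℝ v w) (1 - ‖x‖ ^ 2) := by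
    refine HasDerivAt.mul_const ?_ _
    have := (HasDerivAt.fun_inv (c := fun r : ℝ => r ^ 2) (hasDerivAt_pow 2 (1 - ‖x‖ ^ 2))
      (pow_ne_zero 2 hx.ne')).const_mul 4
    refine (this.congr_deriv ?_).congr_of_eventuallyEq (.of_forall fun r => div_eq_mul_inv _ _)
    have hd := hx.ne'
    clear this h1
    generalize 1 - ‖x‖ ^ 2 = d at hd ⊢
    norm_num
    field_simp
    norm_num
  have h3 := (h2.comp_hasFDerivAt x h1).fderiv
  have h4 : (fun z => hypMetric z v w) = (fun r : ℝ => 4 / r ^ 2 * inner ℝ v w)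
      ∘ fun z : E3 => 1 - ‖z‖ ^ 2 := by
    ext z; simp [hypMetric]
  rw [h4, h3]
  simp only [smul_apply, neg_apply, innerSL_apply_apply,
    smul_eq_mul, nsmul_eq_mul, Nat.cast_ofNat]
  generalize 1 - ‖x‖ ^ 2 = d
  ring

lemma christoffel_eq {x : E3} (hx : x ∈ ball3) (u v w : E3) :
    christoffel x u v w = (2 / (1 - ‖x‖ ^ 2)) ^ 3 *
      (inner ℝ x u * inner ℝ v w + inner ℝ x v * inner ℝ u w - inner ℝ x w * inner ℝ u v) := by
  rw [christoffel, fderiv_hypMetric hx, fderiv_hypMetric hx, fderiv_hypMetric hx]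
  ring

/-! ### Fundamental forms of a surface in terms of its lift to the hyperboloid -/

section Stereo

variable {Y : ℝ × ℝ → E3 × ℝ} (hY : ContDiff ℝ ∞ Y) (hm : ∀ p, mink (Y p) (Y p) = -1)
  (hpos : ∀ p, 0 < (Y p).2)

include hY hpos in
lemma contDiff_stereo_comp : ContDiff ℝ ∞ fun p => stereo (Y p) := by
  unfold stereo
  refine ContDiff.smul (ContDiff.inv (contDiff_const.add (contDiff_snd.comp hY)) ?_)
    (contDiff_fst.comp hY)
  intro p
  have := hpos p
  simp only [Function.comp]
  positivity

lemma contDiff_dirDeriv {F : Type*} [NormedAddCommGroup F] [NormedSpace ℝ F] {X : ℝ × ℝ → F}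
    (hX : ContDiff ℝ ∞ X) (v : ℝ × ℝ) : ContDiff ℝ ∞ fun p => fderiv ℝ X p v :=
  (hX.fderiv_right (m := ∞) (by norm_num)).clm_apply contDiff_const

lemma fderiv_fst_comp {X : ℝ × ℝ → E3 × ℝ} (hX : ContDiff ℝ ∞ X) (p v : ℝ × ℝ) :
    fderiv ℝ (fun q => (X q).1) p v = (fderiv ℝ X p v).1 := by
  rw [fderiv.fst (hX.differentiable (by norm_num) p)]; rfl

lemma fderiv_snd_comp {X : ℝ × ℝ → E3 × ℝ} (hX : ContDiff ℝ ∞ X) (p v : ℝ × ℝ) :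
    fderiv ℝ (fun q => (X q).2) p v = (fderiv ℝ X p v).2 := by
  rw [fderiv.snd (hX.differentiable (by norm_num) p)]; rfl

-- This differentiates `(1 + Y.2) • stereo Y = Y.1` rather than the quotient, which keeps the
-- relation free of denominators. The second derivatives come from differentiating it once more.
include hY hpos in
lemma smul_dirDeriv_stereo (p v : ℝ × ℝ) :
    (1 + (Y p).2) • dirDeriv (fun q => stereo (Y q)) v p + (fderiv ℝ Y p v).2 • stereo (Y p)
      = (fderiv ℝ Y p v).1 := by
  have h1 : (fun q => (1 + (Y q).2) • stereo (Y q)) = fun q => (Y q).1 := by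
    ext1 q
    have := hpos q
    rw [stereo, smul_smul, mul_inv_cancel₀ (by positivity), one_smul]
  have h2 := congrArg (fun f => fderiv ℝ f p v) h1
  have hd : ContDiff ℝ ∞ fun q => 1 + (Y q).2 := contDiff_const.add (contDiff_snd.comp hY)
  rw [fderiv_fst_comp hY, fderiv_fun_smul (hd.differentiable (by norm_num) p)
    ((contDiff_stereo_comp hY hpos).differentiable (by norm_num) p)] at h2
  rw [← h2, ← fderiv_snd_comp hY]
  simp [dirDeriv]

include hY hpos in
lemma smul_dirDeriv_dirDeriv_stereo (p v w : ℝ × ℝ) :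
    (1 + (Y p).2) • dirDeriv (dirDeriv (fun q => stereo (Y q)) w) v p
      + (fderiv ℝ Y p v).2 • dirDeriv (fun q => stereo (Y q)) w p
      + (fderiv ℝ Y p w).2 • dirDeriv (fun q => stereo (Y q)) v p
      + (fderiv ℝ (fun q => fderiv ℝ Y q w) p v).2 • stereo (Y p)
      = (fderiv ℝ (fun q => fderiv ℝ Y q w) p v).1 := by
  have h1 : (fun q => (1 + (Y q).2) • dirDeriv (fun q => stereo (Y q)) w q
      + (fderiv ℝ Y q w).2 • stereo (Y q)) = fun q => (fderiv ℝ Y q w).1 := by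
    ext1 q
    exact smul_dirDeriv_stereo hY hpos q w
  have h2 := congrArg (fun f => fderiv ℝ f p v) h1
  have hX := contDiff_stereo_comp hY hpos
  have hXw := contDiff_dirDeriv hX w
  have hYw := contDiff_dirDeriv hY w
  have hd : ContDiff ℝ ∞ fun q => 1 + (Y q).2 := contDiff_const.add (contDiff_snd.comp hY)
  have hd' : ContDiff ℝ ∞ fun q => (fderiv ℝ Y q w).2 := contDiff_snd.comp hYw
  have t1 := hd.differentiable (by norm_num) p
  have t2 := hd'.differentiable (by norm_num) p
  have t3 := hX.differentiable (by norm_num) p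
  have t4 : DifferentiableAt ℝ (dirDeriv (fun q => stereo (Y q)) w) p :=
    hXw.differentiable (by norm_num) p
  rw [fderiv_fst_comp hYw, fderiv_fun_add (t1.fun_smul t4) (t2.fun_smul t3),
    fderiv_fun_smul t1 t4, fderiv_fun_smul t2 t3] at h2
  rw [← h2, ← fderiv_snd_comp hY (v := v), ← fderiv_snd_comp hYw]
  simp only [dirDeriv, fderiv_const_add, add_apply,
    smul_apply, ContinuousLinearMap.smulRight_apply]
  abel

include hY hm in
lemma mink_fderiv_eq_zero (p v : ℝ × ℝ) :
    inner ℝ (Y p).1 (fderiv ℝ Y p v).1 = (Y p).2 * (fderiv ℝ Y p v).2 := by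
  have h1 : (fun q => mink (Y q) (Y q)) = fun _ => (-1 : ℝ) := funext hm
  have h2 := congrArg (fun f => fderiv ℝ f p v) h1
  have a1 : DifferentiableAt ℝ (fun q => (Y q).1) p :=
    (contDiff_fst.comp hY).differentiable (by norm_num) p
  have a2 : DifferentiableAt ℝ (fun q => (Y q).2) p :=
    (contDiff_snd.comp hY).differentiable (by norm_num) p
  simp only [mink] at h2
  rw [fderiv_fun_sub (a1.inner ℝ a1) (a2.fun_mul a2), sub_apply,
    fderiv_inner_apply ℝ a1 a1, fderiv_fun_mul a2 a2] at h2
  simp only [add_apply, smul_apply, smul_eq_mul,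
    fderiv_fst_comp hY, fderiv_snd_comp hY, fderiv_fun_const, Pi.zero_apply,
    zero_apply, real_inner_comm (Y p).1] at h2
  linarith

-- Stereographic projection is an isometry from the hyperboloid to the ball. The cross terms are
-- eliminated with the tangency relation obtained from `⟨Y, Y⟩ = -1`.
include hY hm hpos in
lemma firstForm_stereo (p v w : ℝ × ℝ) :
    firstForm (fun q => stereo (Y q)) p v w = mink (fderiv ℝ Y p v) (fderiv ℝ Y p w) := by
  have hT := hpos p
  have ev := smul_dirDeriv_stereo hY hpos p v
  have ew := smul_dirDeriv_stereo hY hpos p w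
  have cv := mink_fderiv_eq_zero hY hm p v
  have cw := mink_fderiv_eq_zero hY hm p w
  have hX : ‖stereo (Y p)‖ ^ 2 = 1 - 2 / (1 + (Y p).2) := by
    linarith [one_sub_norm_stereo (hm p) hT]
  have e1 : (Y p).1 = (1 + (Y p).2) • stereo (Y p) := by
    rw [stereo, smul_smul, mul_inv_cancel₀ (by positivity), one_smul]
  rw [e1, real_inner_smul_left] at cv cw
  have hT' : (1 + (Y p).2) ≠ 0 := by positivity
  set T := (Y p).2
  set X := stereo (Y p)
  set Xv := dirDeriv (fun q => stereo (Y q)) v p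
  set Xw := dirDeriv (fun q => stereo (Y q)) w p
  set Yv := fderiv ℝ Y p v
  set Yw := fderiv ℝ Y p w
  have k1 : (1 + T) ^ 2 * inner ℝ Xv Xw = inner ℝ (Yv.1 - Yv.2 • X) (Yw.1 - Yw.2 • X) := by
    rw [← ev, ← ew, add_sub_cancel_right, add_sub_cancel_right, real_inner_smul_left,
      real_inner_smul_right]
    ring
  have k2 : firstForm (fun q => stereo (Y q)) p v w = (1 + T) ^ 2 * inner ℝ Xv Xw := by
    rw [firstForm, hypMetric, one_sub_norm_stereo (hm p) hT]
    congr 1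
    change _ = (1 + (Y p).2) ^ 2
    field_simp
    norm_num
  rw [k2, k1, inner_sub_left, inner_sub_right, inner_sub_right, real_inner_smul_left,
    real_inner_smul_left, real_inner_smul_right, real_inner_smul_right, real_inner_self_eq_norm_sq,
    hX, mink, real_inner_comm X Yv.1]
  have cv' : inner ℝ X Yv.1 = T * Yv.2 / (1 + T) := by field_simp; linarith
  have cw' : inner ℝ X Yw.1 = T * Yw.2 / (1 + T) := by field_simp; linarith
  rw [cv', cw']
  field_simp
  ring

/-- The functional on Minkowski space given by the product with the lift of `ν` at `stereo y`. -/
def normalFunctional (x ν : E3) (Z : E3 × ℝ) : ℝ := inner ℝ Z.1 ν - Z.2 * inner ℝ x ν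

-- Gauss formula: the covariant derivative in the hyperboloid is `Y_vw - ⟨Y_v, Y_w⟩ Y`, which is
-- orthogonal to `Y`. On vectors orthogonal to `Y`, `normalFunctional` is the product with the lift
-- of `ν` up to the factor `1 + Y.2`.
include hY hm hpos in
lemma secondForm_stereo (p : ℝ × ℝ) {ν : E3}
    (hν : ∀ v, hypMetric (stereo (Y p)) (dirDeriv (fun q => stereo (Y q)) v p) ν = 0)
    (v w : ℝ × ℝ) :
    secondForm (fun q => stereo (Y q)) ν p v w = -((1 + (Y p).2) *
      (normalFunctional (stereo (Y p)) ν (fderiv ℝ (fun q => fderiv ℝ Y q w) p v)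
        - normalFunctional (stereo (Y p)) ν (Y p) * mink (fderiv ℝ Y p v) (fderiv ℝ Y p w))) := by
  have hT := hpos p
  have hT' : (1 + (Y p).2) ≠ 0 := by positivity
  have e1 : (Y p).1 = (1 + (Y p).2) • stereo (Y p) := by
    rw [stereo, smul_smul, mul_inv_cancel₀ hT', one_smul]
  have h0 : ∀ v, inner ℝ (dirDeriv (fun q => stereo (Y q)) v p) ν = 0 := by
    intro v
    have := hν v
    rw [hypMetric, one_sub_norm_stereo (hm p) hT] at this
    refine (mul_eq_zero.1 this).resolve_left ?_
    positivity
  rw [← firstForm_stereo hY hm hpos, secondForm, christoffel_eq (stereo_mem_ball (hm p) hT),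
    firstForm, hypMetric, hypMetric, one_sub_norm_stereo (hm p) hT, h0, h0, normalFunctional,
    normalFunctional, ← smul_dirDeriv_dirDeriv_stereo hY hpos, e1]
  simp only [inner_add_left, real_inner_smul_left, h0]
  field_simp
  ring

include hY hm hpos in
/-- A surface in the hyperboloid with `Δ Y = 2 Y` up to tangent vectors is minimal. -/
lemma meanCurvature_stereo_eq_zero (p : ℝ × ℝ) {ν : E3}
    (hν : ∀ v, hypMetric (stereo (Y p)) (dirDeriv (fun q => stereo (Y q)) v p) ν = 0)
    {E F G α β : ℝ} (hE : mink (fderiv ℝ Y p (1, 0)) (fderiv ℝ Y p (1, 0)) = E)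
    (hF : mink (fderiv ℝ Y p (1, 0)) (fderiv ℝ Y p (0, 1)) = F)
    (hG : mink (fderiv ℝ Y p (0, 1)) (fderiv ℝ Y p (0, 1)) = G)
    (h : G • fderiv ℝ (fun q => fderiv ℝ Y q (1, 0)) p (1, 0)
      - (2 * F) • fderiv ℝ (fun q => fderiv ℝ Y q (0, 1)) p (1, 0)
      + E • fderiv ℝ (fun q => fderiv ℝ Y q (0, 1)) p (0, 1)
      - (2 * (E * G - F ^ 2)) • Y p = α • fderiv ℝ Y p (1, 0) + β • fderiv ℝ Y p (0, 1)) :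
    meanCurvature (fun q => stereo (Y q)) ν p = 0 := by
  have hT := hpos p
  have hT' : (1 + (Y p).2) ≠ 0 := by positivity
  have h0 : ∀ v, normalFunctional (stereo (Y p)) ν (fderiv ℝ Y p v) = 0 := by
    intro v
    have := hν v
    rw [hypMetric, one_sub_norm_stereo (hm p) hT] at this
    have h1 := (mul_eq_zero.1 this).resolve_left (by positivity)
    rw [normalFunctional, ← smul_dirDeriv_stereo hY hpos, inner_add_left, real_inner_smul_left,
      real_inner_smul_left, h1]
    ring
  -- The functional kills the tangent right-hand side. Since `G E - 2 F F + E G = 2 (E G - F²)`,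
  -- what remains is the numerator of the mean curvature up to a factor.
  have key := congrArg (normalFunctional (stereo (Y p)) ν) h
  have hadd : ∀ a b, normalFunctional (stereo (Y p)) ν (a + b)
      = normalFunctional (stereo (Y p)) ν a + normalFunctional (stereo (Y p)) ν b := by
    intro a b; simp only [normalFunctional, Prod.fst_add, Prod.snd_add, inner_add_left]; ring
  have hsub : ∀ a b, normalFunctional (stereo (Y p)) ν (a - b)
      = normalFunctional (stereo (Y p)) ν a - normalFunctional (stereo (Y p)) ν b := by
    intro a b; simp only [normalFunctional, Prod.fst_sub, Prod.snd_sub, inner_sub_left]; ring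
  have hsmul : ∀ (c : ℝ) b, normalFunctional (stereo (Y p)) ν (c • b)
      = c * normalFunctional (stereo (Y p)) ν b := by
    intro a b
    simp only [normalFunctional, Prod.smul_fst, Prod.smul_snd, real_inner_smul_left, smul_eq_mul]
    ring
  rw [hsub, hadd, hsub, hadd, hsmul, hsmul, hsmul, hsmul, hsmul, hsmul, h0, h0] at key
  rw [meanCurvature]
  simp only [firstForm_stereo hY hm hpos, secondForm_stereo hY hm hpos p hν, hE, hF, hG]
  rw [div_eq_zero_iff]
  left
  linear_combination (-(1 + (Y p).2)) * key

include hY hm hpos in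
lemma isMinimalImmersion_stereo {E F G α β : ℝ × ℝ → ℝ}
    (hE : ∀ p, mink (fderiv ℝ Y p (1, 0)) (fderiv ℝ Y p (1, 0)) = E p)
    (hF : ∀ p, mink (fderiv ℝ Y p (1, 0)) (fderiv ℝ Y p (0, 1)) = F p)
    (hG : ∀ p, mink (fderiv ℝ Y p (0, 1)) (fderiv ℝ Y p (0, 1)) = G p)
    (hE0 : ∀ p, 0 < E p) (hdet : ∀ p, 0 < E p * G p - F p ^ 2)
    (h : ∀ p, G p • fderiv ℝ (fun q => fderiv ℝ Y q (1, 0)) p (1, 0)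
      - (2 * F p) • fderiv ℝ (fun q => fderiv ℝ Y q (0, 1)) p (1, 0)
      + E p • fderiv ℝ (fun q => fderiv ℝ Y q (0, 1)) p (0, 1)
      - (2 * (E p * G p - F p ^ 2)) • Y p
      = α p • fderiv ℝ Y p (1, 0) + β p • fderiv ℝ Y p (0, 1)) :
    IsMinimalImmersion fun q => stereo (Y q) where
  smooth := contDiff_stereo_comp hY hpos
  mem_ball p := stereo_mem_ball (hm p) (hpos p)
  immersion p := by
    rw [injective_iff_map_eq_zero]
    intro v hv
    have h1 := firstForm_stereo hY hm hpos p v v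
    have h2 : firstForm (fun q => stereo (Y q)) p v v = 0 := by
      simp [firstForm, dirDeriv, hv, hypMetric]
    have h3 : v = v.1 • ((1, 0) : ℝ × ℝ) + v.2 • ((0, 1) : ℝ × ℝ) := by ext <;> simp
    rw [h2, h3, map_add, map_smul, map_smul] at h1
    simp only [mink_add_left, mink_add_right, mink_smul_left, mink_smul_right, hE, hF, hG,
      mink_comm (fderiv ℝ Y p (0, 1)) (fderiv ℝ Y p (1, 0))] at h1
    have e := hE0 p
    have d := hdet p
    -- The first fundamental form of `v`, multiplied by `E` and completed to squares.
    have k : (E p * v.1 + F p * v.2) ^ 2 + (E p * G p - F p ^ 2) * v.2 ^ 2 = 0 := by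
      linear_combination (-E p) * h1
    have k2 : v.2 = 0 := by
      by_contra hne
      have : 0 < v.2 ^ 2 := by positivity
      nlinarith [sq_nonneg (E p * v.1 + F p * v.2), mul_pos d this]
    have k1 : v.1 = 0 := by
      rw [k2] at k
      have : E p * v.1 = 0 := by
        have : (E p * v.1) ^ 2 = 0 := by linear_combination k
        exact pow_eq_zero_iff two_ne_zero |>.1 this
      exact (mul_eq_zero.1 this).resolve_left e.ne'
    exact Prod.ext k1 k2
  minimal p ν hν _ :=
    meanCurvature_stereo_eq_zero hY hm hpos p hν (hE p) (hF p) (hG p) (h p)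

end Stereo

/-! ### The catenoids are minimal -/

/-- The surface `(s, θ) ↦ (a w₀, b w₁, b w₂; d w₀)` in Minkowski space, for functions
`a, b, d` of `s` and `w₀, w₁, w₂` of `θ`. -/
def sepSurface (a b d w₀ w₁ w₂ : ℝ → ℝ) (p : ℝ × ℝ) : E3 × ℝ :=
  (!₂[a p.1 * w₀ p.2, b p.1 * w₁ p.2, b p.1 * w₂ p.2], d p.1 * w₀ p.2)

lemma mink_coords (x y : E3) (r t : ℝ) :
    mink (x, r) (y, t) = x 0 * y 0 + x 1 * y 1 + x 2 * y 2 - r * t := by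
  simp only [mink, PiLp.inner_apply, Fin.sum_univ_three, RCLike.inner_apply, conj_trivial]
  ring

lemma hasFDerivAt_sepSurface {a b d w₀ w₁ w₂ a' b' d' w₀' w₁' w₂' : ℝ → ℝ}
    (ha : ∀ s, HasDerivAt a (a' s) s) (hb : ∀ s, HasDerivAt b (b' s) s)
    (hd : ∀ s, HasDerivAt d (d' s) s) (h₀ : ∀ s, HasDerivAt w₀ (w₀' s) s)
    (h₁ : ∀ s, HasDerivAt w₁ (w₁' s) s) (h₂ : ∀ s, HasDerivAt w₂ (w₂' s) s) (p : ℝ × ℝ) :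
    HasFDerivAt (sepSurface a b d w₀ w₁ w₂)
      ((ContinuousLinearMap.fst ℝ ℝ ℝ).smulRight (sepSurface a' b' d' w₀ w₁ w₂ p)
        + (ContinuousLinearMap.snd ℝ ℝ ℝ).smulRight (sepSurface a b d w₀' w₁' w₂' p)) p := by
  have key : ∀ {f g f' g' : ℝ → ℝ}, (∀ s, HasDerivAt f (f' s) s) → (∀ s, HasDerivAt g (g' s) s) →
      HasFDerivAt (fun q : ℝ × ℝ => f q.1 * g q.2)
        ((ContinuousLinearMap.fst ℝ ℝ ℝ).smulRight (f' p.1 * g p.2)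
          + (ContinuousLinearMap.snd ℝ ℝ ℝ).smulRight (f p.1 * g' p.2)) p := by
    intro f g f' g' hf hg
    have h1 : HasFDerivAt (fun q : ℝ × ℝ => f q.1) (f' p.1 • ContinuousLinearMap.fst ℝ ℝ ℝ) p :=
      HasDerivAt.comp_hasFDerivAt (f := Prod.fst) p (hf p.1) hasFDerivAt_fst
    have h2 : HasFDerivAt (fun q : ℝ × ℝ => g q.2) (g' p.2 • ContinuousLinearMap.snd ℝ ℝ ℝ) p :=
      HasDerivAt.comp_hasFDerivAt (f := Prod.snd) p (hg p.2) hasFDerivAt_snd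
    refine (h1.mul h2).congr_fderiv ?_
    ext <;> simp [mul_comm]
  refine HasFDerivAt.congr_fderiv (HasFDerivAt.prodMk
    (f₁' := (PiLp.continuousLinearEquiv 2 ℝ (fun _ : Fin 3 => ℝ)).symm.toContinuousLinearMap.comp
      (ContinuousLinearMap.pi ![(ContinuousLinearMap.fst ℝ ℝ ℝ).smulRight (a' p.1 * w₀ p.2)
          + (ContinuousLinearMap.snd ℝ ℝ ℝ).smulRight (a p.1 * w₀' p.2),
        (ContinuousLinearMap.fst ℝ ℝ ℝ).smulRight (b' p.1 * w₁ p.2)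
          + (ContinuousLinearMap.snd ℝ ℝ ℝ).smulRight (b p.1 * w₁' p.2),
        (ContinuousLinearMap.fst ℝ ℝ ℝ).smulRight (b' p.1 * w₂ p.2)
          + (ContinuousLinearMap.snd ℝ ℝ ℝ).smulRight (b p.1 * w₂' p.2)]))
    ?_ (key hd h₀)) ?_
  · rw [← hasFDerivWithinAt_univ, hasFDerivWithinAt_euclidean]
    intro i
    rw [hasFDerivWithinAt_univ]
    fin_cases i
    · exact key ha h₀
    · exact key hb h₁
    · exact key hb h₂
  · refine ContinuousLinearMap.ext fun v => Prod.ext (PiLp.ext fun i => ?_) ?_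
    · fin_cases i <;> simp [sepSurface]
    · simp [sepSurface]

/-- Separated surfaces are closed under both partial derivatives, so all second derivatives come
from applying these two lemmas twice. -/
lemma fderiv_sepSurface_fst {a b d w₀ w₁ w₂ a' b' d' w₀' w₁' w₂' : ℝ → ℝ}
    (ha : ∀ s, HasDerivAt a (a' s) s) (hb : ∀ s, HasDerivAt b (b' s) s)
    (hd : ∀ s, HasDerivAt d (d' s) s) (h₀ : ∀ s, HasDerivAt w₀ (w₀' s) s)
    (h₁ : ∀ s, HasDerivAt w₁ (w₁' s) s) (h₂ : ∀ s, HasDerivAt w₂ (w₂' s) s) :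
    (fun p => fderiv ℝ (sepSurface a b d w₀ w₁ w₂) p (1, 0))
      = sepSurface a' b' d' w₀ w₁ w₂ := by
  ext1 p
  rw [(hasFDerivAt_sepSurface ha hb hd h₀ h₁ h₂ p).fderiv]
  simp

lemma fderiv_sepSurface_snd {a b d w₀ w₁ w₂ a' b' d' w₀' w₁' w₂' : ℝ → ℝ}
    (ha : ∀ s, HasDerivAt a (a' s) s) (hb : ∀ s, HasDerivAt b (b' s) s)
    (hd : ∀ s, HasDerivAt d (d' s) s) (h₀ : ∀ s, HasDerivAt w₀ (w₀' s) s)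
    (h₁ : ∀ s, HasDerivAt w₁ (w₁' s) s) (h₂ : ∀ s, HasDerivAt w₂ (w₂' s) s) :
    (fun p => fderiv ℝ (sepSurface a b d w₀ w₁ w₂) p (0, 1))
      = sepSurface a b d w₀' w₁' w₂' := by
  ext1 p
  rw [(hasFDerivAt_sepSurface ha hb hd h₀ h₁ h₂ p).fderiv]
  simp

/-- The surface of revolution in the hyperboloid with the profile curve `(x, y)`. -/
def revolutionLift (x y : ℝ → ℝ) : ℝ × ℝ → E3 × ℝ :=
  sepSurface (fun s => Real.sinh (x s) * Real.cosh (y s)) (fun s => Real.sinh (y s))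
    (fun s => Real.cosh (x s) * Real.cosh (y s)) (fun _ => 1) Real.cos Real.sin

lemma stereo_revolutionLift (x y : ℝ → ℝ) (p : ℝ × ℝ) :
    stereo (revolutionLift x y p) = ballPoint (x p.1) (y p.1) p.2 := by
  ext i
  fin_cases i <;> simp [stereo, revolutionLift, sepSurface, ballPoint] <;> ring

lemma mink_revolutionLift (x y : ℝ → ℝ) (p : ℝ × ℝ) :
    mink (revolutionLift x y p) (revolutionLift x y p) = -1 := by
  rw [revolutionLift, sepSurface, mink_coords]
  simp only [Matrix.cons_val]
  linear_combination (Real.sinh (y p.1)) ^ 2 * Real.sin_sq_add_cos_sq p.2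
    - (Real.cosh (y p.1)) ^ 2 * Real.cosh_sq (x p.1) - Real.cosh_sq (y p.1)

lemma revolutionLift_snd_pos (x y : ℝ → ℝ) (p : ℝ × ℝ) : 0 < (revolutionLift x y p).2 := by
  simp only [revolutionLift, sepSurface, mul_one]
  exact mul_pos (Real.cosh_pos _) (Real.cosh_pos _)

lemma contDiff_revolutionLift {x y : ℝ → ℝ} (hx : ContDiff ℝ ∞ x) (hy : ContDiff ℝ ∞ y) :
    ContDiff ℝ ∞ (revolutionLift x y) := by
  have hx' : ContDiff ℝ ∞ fun p : ℝ × ℝ => x p.1 := hx.comp contDiff_fst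
  have hy' : ContDiff ℝ ∞ fun p : ℝ × ℝ => y p.1 := hy.comp contDiff_fst
  refine ContDiff.prodMk ?_ ?_
  · rw [contDiff_euclidean]
    intro i
    fin_cases i
    · exact (hx'.sinh.mul hy'.cosh).mul contDiff_const
    · exact hy'.sinh.mul contDiff_snd.cos
    · exact hy'.sinh.mul contDiff_snd.sin
  · exact (hx'.cosh.mul hy'.cosh).mul contDiff_const

/-- A surface of revolution whose profile curve satisfies the catenary equations is minimal,
and so are its images under Lorentz transformations. -/
lemma isMinimalImmersion_revolution (L : LorentzIso) {x y x' y' x'' y'' : ℝ → ℝ}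
    (hx : ContDiff ℝ ∞ x) (hy : ContDiff ℝ ∞ y)
    (dx : ∀ s, HasDerivAt x (x' s) s) (dy : ∀ s, HasDerivAt y (y' s) s)
    (dx' : ∀ s, HasDerivAt x' (x'' s) s) (dy' : ∀ s, HasDerivAt y' (y'' s) s)
    (hpos : ∀ s, 0 < y s)
    (hunit : ∀ s, Real.cosh (y s) ^ 2 * x' s ^ 2 + y' s ^ 2 = 1)
    (hx2 : ∀ s, Real.sinh (y s) * Real.cosh (y s) * x'' s
      = -(x' s * y' s * (Real.cosh (y s) ^ 2 + 2 * Real.sinh (y s) ^ 2)))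
    (hy2 : ∀ s, Real.sinh (y s) * y'' s
      = (Real.cosh (y s) ^ 2 + Real.sinh (y s) ^ 2) * Real.cosh (y s) * x' s ^ 2) :
    IsMinimalImmersion fun p => stereo (L.toEquiv (revolutionLift x y p)) := by
  have hc : ∀ s, HasDerivAt Real.cos (-Real.sin s) s := Real.hasDerivAt_cos
  have hs : ∀ s, HasDerivAt Real.sin (Real.cos s) s := Real.hasDerivAt_sin
  have hc' : ∀ s, HasDerivAt (fun s => -Real.sin s) (-Real.cos s) s := fun s => (hs s).neg
  have h1 : ∀ s : ℝ, HasDerivAt (fun _ => (1 : ℝ)) ((fun _ => (0 : ℝ)) s) s :=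
    fun s => hasDerivAt_const s 1
  have h0 : ∀ s : ℝ, HasDerivAt (fun _ => (0 : ℝ)) ((fun _ => (0 : ℝ)) s) s :=
    fun s => hasDerivAt_const s 0
  have da : ∀ s, HasDerivAt (fun s => Real.sinh (x s) * Real.cosh (y s))
      (Real.cosh (x s) * x' s * Real.cosh (y s) + Real.sinh (x s) * (Real.sinh (y s) * y' s)) s :=
    fun s => (dx s).sinh.mul (dy s).cosh
  have dd : ∀ s, HasDerivAt (fun s => Real.cosh (x s) * Real.cosh (y s))
      (Real.sinh (x s) * x' s * Real.cosh (y s) + Real.cosh (x s) * (Real.sinh (y s) * y' s)) s :=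
    fun s => (dx s).cosh.mul (dy s).cosh
  have db : ∀ s, HasDerivAt (fun s => Real.sinh (y s)) (Real.cosh (y s) * y' s) s :=
    fun s => (dy s).sinh
  have da' : ∀ s, HasDerivAt (fun s => Real.cosh (x s) * x' s * Real.cosh (y s)
      + Real.sinh (x s) * (Real.sinh (y s) * y' s)) ((Real.sinh (x s) * x' s * x' s
      + Real.cosh (x s) * x'' s) * Real.cosh (y s) + Real.cosh (x s) * x' s * (Real.sinh (y s) * y' s)
      + (Real.cosh (x s) * x' s * (Real.sinh (y s) * y' s) + Real.sinh (x s) *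
      (Real.cosh (y s) * y' s * y' s + Real.sinh (y s) * y'' s))) s :=
    fun s => (((dx s).cosh.mul (dx' s)).mul (dy s).cosh).add
      ((dx s).sinh.mul ((dy s).sinh.mul (dy' s)))
  have dd' : ∀ s, HasDerivAt (fun s => Real.sinh (x s) * x' s * Real.cosh (y s)
      + Real.cosh (x s) * (Real.sinh (y s) * y' s)) ((Real.cosh (x s) * x' s * x' s
      + Real.sinh (x s) * x'' s) * Real.cosh (y s) + Real.sinh (x s) * x' s * (Real.sinh (y s) * y' s)
      + (Real.sinh (x s) * x' s * (Real.sinh (y s) * y' s) + Real.cosh (x s) *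
      (Real.cosh (y s) * y' s * y' s + Real.sinh (y s) * y'' s))) s :=
    fun s => (((dx s).sinh.mul (dx' s)).mul (dy s).cosh).add
      ((dx s).cosh.mul ((dy s).sinh.mul (dy' s)))
  have db' : ∀ s, HasDerivAt (fun s => Real.cosh (y s) * y' s)
      (Real.sinh (y s) * y' s * y' s + Real.cosh (y s) * y'' s) s :=
    fun s => (dy s).cosh.mul (dy' s)
  have e1 := fderiv_sepSurface_fst da db dd h1 hc hs
  have e2 := fderiv_sepSurface_snd da db dd h1 hc hs
  have e11 := fderiv_sepSurface_fst da' db' dd' h1 hc hs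
  have e22 := fderiv_sepSurface_snd da db dd h0 hc' hc
  have hR := contDiff_revolutionLift hx hy
  have f1 : ∀ p v, fderiv ℝ (fun q => L.toEquiv (revolutionLift x y q)) p v
      = L.toEquiv (fderiv ℝ (revolutionLift x y) p v) := by
    intro p v
    have := L.toEquiv.comp_fderiv (f := revolutionLift x y) (x := p)
    rw [Function.comp_def] at this
    rw [this]
    rfl
  have f2 : ∀ p v w, fderiv ℝ (fun q => fderiv ℝ (fun q => L.toEquiv (revolutionLift x y q)) q w) p v
      = L.toEquiv (fderiv ℝ (fun q => fderiv ℝ (revolutionLift x y) q w) p v) := by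
    intro p v w
    simp only [f1]
    have := L.toEquiv.comp_fderiv (f := fun q => fderiv ℝ (revolutionLift x y) q w) (x := p)
    rw [Function.comp_def] at this
    rw [this]
    rfl
  have e1' : ∀ p, fderiv ℝ (revolutionLift x y) p (1, 0) = _ := fun p => congrFun e1 p
  have e2' : ∀ p, fderiv ℝ (revolutionLift x y) p (0, 1) = _ := fun p => congrFun e2 p
  -- Arc length gives the metric `ds² + sinh² y dθ²`. The only tangential term comes from `Y_θθ`,
  -- whose product with `Y_s` is `-G_s / 2 = -sinh y cosh y y'`; this is `α`.
  refine isMinimalImmersion_stereo (Y := fun p => L.toEquiv (revolutionLift x y p))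
    (L.toEquiv.contDiff.comp hR) (fun p => by rw [L.mink_map, mink_revolutionLift])
    (fun p => L.future _ (by rw [mink_revolutionLift]; norm_num) (revolutionLift_snd_pos x y p))
    (E := fun _ => 1) (F := fun _ => 0) (G := fun p => Real.sinh (y p.1) ^ 2)
    (α := fun p => -(Real.sinh (y p.1) * Real.cosh (y p.1) * y' p.1)) (β := fun _ => 0)
    ?_ ?_ ?_ ?_ ?_ ?_
  · intro p
    rw [f1, L.mink_map, e1', sepSurface, mink_coords]
    simp only [Matrix.cons_val]
    linear_combination hunit p.1 + (Real.cosh (y p.1)) ^ 2 * y' p.1 ^ 2 *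
      Real.sin_sq_add_cos_sq p.2 + (x' p.1 ^ 2 * Real.cosh (y p.1) ^ 2
      - y' p.1 ^ 2 * Real.sinh (y p.1) ^ 2) * Real.cosh_sq (x p.1) + y' p.1 ^ 2 * Real.cosh_sq (y p.1)
  · intro p
    rw [f1, f1, L.mink_map, e1', e2', sepSurface, sepSurface, mink_coords]
    simp only [Matrix.cons_val]
    ring
  · intro p
    rw [f1, L.mink_map, e2', sepSurface, mink_coords]
    simp only [Matrix.cons_val]
    linear_combination (Real.sinh (y p.1)) ^ 2 * Real.sin_sq_add_cos_sq p.2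
  · intro p; norm_num
  · intro p
    have := Real.sinh_pos_iff.2 (hpos p.1)
    rw [one_mul, zero_pow two_ne_zero, sub_zero]
    positivity
  · intro p
    have hL : ∀ (c : ℝ) (v : E3 × ℝ), c • L.toEquiv v = L.toEquiv (c • v) :=
      fun c v => (map_smul L.toEquiv c v).symm
    rw [f1, f1, f2, f2, f2, hL, hL, hL, hL, hL, hL,
      ← map_sub, ← map_add, ← map_sub, ← map_add]
    congr 1
    simp only [e1', e2']
    rw [congrFun e11 p, congrFun e22 p, zero_smul, mul_zero, zero_smul, add_zero, sub_zero,
      revolutionLift]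
    have hS := Real.sinh_pos_iff.2 (hpos p.1)
    have hu := hunit p.1
    have h2 := hx2 p.1
    have h3 := hy2 p.1
    have hC := Real.cosh_sq (y p.1)
    -- In the plane of the first and time coordinates, `k1` is the component along `(cosh x; sinh
    -- x)` and `k2` the one along `(sinh x; cosh x)`. The rotating coordinates give `k3`.
    have k1 : Real.sinh (y p.1) ^ 2 * (x'' p.1 * Real.cosh (y p.1)
        + 2 * x' p.1 * y' p.1 * Real.sinh (y p.1))
        = -(Real.sinh (y p.1) * Real.cosh (y p.1) ^ 2 * y' p.1 * x' p.1) := by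
      linear_combination Real.sinh (y p.1) * h2
    have k2 : Real.sinh (y p.1) ^ 2 * (x' p.1 ^ 2 * Real.cosh (y p.1)
        + y' p.1 ^ 2 * Real.cosh (y p.1) + Real.sinh (y p.1) * y'' p.1 - 2 * Real.cosh (y p.1))
        = -(Real.sinh (y p.1) ^ 2 * Real.cosh (y p.1) * y' p.1 ^ 2) := by
      linear_combination Real.sinh (y p.1) ^ 2 * h3
        + 2 * Real.sinh (y p.1) ^ 2 * Real.cosh (y p.1) * hu
        - Real.sinh (y p.1) ^ 2 * Real.cosh (y p.1) * x' p.1 ^ 2 * hC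
    have k3 : Real.sinh (y p.1) ^ 2 * (Real.sinh (y p.1) * y' p.1 ^ 2 + Real.cosh (y p.1) * y'' p.1)
        - Real.sinh (y p.1) - 2 * Real.sinh (y p.1) ^ 3
        = -(Real.sinh (y p.1) * Real.cosh (y p.1) ^ 2 * y' p.1 ^ 2) := by
      linear_combination Real.sinh (y p.1) * Real.cosh (y p.1) * h3
        + Real.sinh (y p.1) * (Real.sinh (y p.1) ^ 2 + Real.cosh (y p.1) ^ 2) * hu
        + Real.sinh (y p.1) * hC
    refine Prod.ext (PiLp.ext fun i => ?_) ?_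
    · fin_cases i
      · simp [sepSurface]
        linear_combination Real.cosh (x p.1) * k1 + Real.sinh (x p.1) * k2
      · simp [sepSurface]
        linear_combination Real.cos p.2 * k3
      · simp [sepSurface]
        linear_combination Real.sin p.2 * k3
    · simp [sepSurface]
      linear_combination Real.sinh (x p.1) * k1 + Real.cosh (x p.1) * k2

/-! ### The catenary -/

section Catenary

variable {a : ℝ} (ha : 0 < a)

include ha in
lemma one_lt_cosh_two_mul : 1 < Real.cosh (2 * a) := Real.one_lt_cosh.2 (by positivity)

include ha in
lemma one_lt_cosh_mul_cosh (s : ℝ) : 1 < Real.cosh (2 * a) * Real.cosh (2 * s) :=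
  lt_of_lt_of_le (one_lt_cosh_two_mul ha)
    (le_mul_of_one_le_right (Real.cosh_pos _).le (Real.one_le_cosh _))

include ha in
lemma catY_pos (s : ℝ) : 0 < catY a s :=
  div_pos (Real.arcosh_pos (one_lt_cosh_mul_cosh ha s)) two_pos

include ha in
lemma cosh_two_mul_catY (s : ℝ) :
    Real.cosh (2 * catY a s) = Real.cosh (2 * a) * Real.cosh (2 * s) := by
  rw [catY, mul_div_cancel₀ _ two_ne_zero, Real.cosh_arcosh (one_lt_cosh_mul_cosh ha s).le]

include ha in
lemma contDiff_catY : ContDiff ℝ ∞ (catY a) := by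
  rw [contDiff_iff_contDiffAt]
  intro s
  refine ContDiffAt.div_const ?_ 2
  refine (Real.contDiffAt_arcosh (one_lt_cosh_mul_cosh ha s)).comp
    (f := fun s => Real.cosh (2 * a) * Real.cosh (2 * s)) s ?_
  exact (contDiff_const.mul (contDiff_const.mul contDiff_id).cosh).contDiffAt

-- The value of the derivative is read off from `cosh (2y) = cosh (2a) cosh (2s)` by uniqueness of
-- derivatives.
include ha in
lemma hasDerivAt_catY (s : ℝ) : HasDerivAt (catY a)
    (Real.cosh (2 * a) * Real.sinh (2 * s) / Real.sinh (2 * catY a s)) s := by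
  have hd := (contDiff_catY ha).differentiable (by norm_num) s
  have h1 := hd.hasDerivAt
  have h2 : HasDerivAt (fun s => Real.cosh (2 * catY a s))
      (Real.sinh (2 * catY a s) * (2 * deriv (catY a) s)) s := (h1.const_mul 2).cosh
  have h3 : HasDerivAt (fun s => Real.cosh (2 * a) * Real.cosh (2 * s))
      (Real.cosh (2 * a) * (Real.sinh (2 * s) * (2 * 1))) s :=
    (((hasDerivAt_id s).const_mul 2).cosh).const_mul _
  have h4 : (fun s => Real.cosh (2 * catY a s)) = fun s => Real.cosh (2 * a) * Real.cosh (2 * s) :=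
    funext (cosh_two_mul_catY ha)
  rw [h4] at h2
  have h5 := h2.unique h3
  have hS : 0 < Real.sinh (2 * catY a s) := Real.sinh_pos_iff.2 (by linarith [catY_pos ha s])
  refine h1.congr_deriv ?_
  rw [eq_div_iff hS.ne']
  linarith

-- With `cosh (2y) = cosh (2a) cosh (2s)`, the radicand is `2 sinh² y` and the denominator `4 sinh²
-- y cosh² y`.
include ha in
lemma catX_integrand (s : ℝ) :
    √2 * Real.sinh (2 * a) * (√(Real.cosh (2 * a) * Real.cosh (2 * s) - 1) /
      (Real.cosh (2 * a) ^ 2 * Real.cosh (2 * s) ^ 2 - 1))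
      = Real.sinh (2 * a) / (2 * Real.sinh (catY a s) * Real.cosh (catY a s) ^ 2) := by
  have hS : 0 < Real.sinh (catY a s) := Real.sinh_pos_iff.2 (catY_pos ha s)
  have hC : 0 < Real.cosh (catY a s) := Real.cosh_pos _
  have h1 := cosh_two_mul_catY ha s
  rw [Real.cosh_two_mul] at h1
  have h2 := Real.cosh_sq (catY a s)
  have h3 : Real.cosh (2 * a) * Real.cosh (2 * s) - 1 = 2 * Real.sinh (catY a s) ^ 2 := by linarith
  have h4 : Real.cosh (2 * a) ^ 2 * Real.cosh (2 * s) ^ 2 - 1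
      = 4 * Real.sinh (catY a s) ^ 2 * Real.cosh (catY a s) ^ 2 := by
    rw [← mul_pow, ← h1, h2]; ring
  rw [h3, h4, Real.sqrt_mul zero_le_two, Real.sqrt_sq hS.le]
  have h5 : √2 * √2 = (2 : ℝ) := Real.mul_self_sqrt zero_le_two
  field_simp
  linear_combination 2 * h5

include ha in
lemma continuous_catX_integrand : Continuous fun t =>
    √(Real.cosh (2 * a) * Real.cosh (2 * t) - 1) /
      (Real.cosh (2 * a) ^ 2 * Real.cosh (2 * t) ^ 2 - 1) := by
  have hc : Continuous fun t : ℝ => Real.cosh (2 * t) :=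
    Real.continuous_cosh.comp (continuous_const.mul continuous_id)
  refine Continuous.div (by fun_prop) (by fun_prop) fun t => ?_
  have := one_lt_cosh_mul_cosh ha t
  rw [← mul_pow]
  nlinarith

include ha in
lemma hasDerivAt_catX (s : ℝ) : HasDerivAt (catX a)
    (Real.sinh (2 * a) / (2 * Real.sinh (catY a s) * Real.cosh (catY a s) ^ 2)) s := by
  rw [← catX_integrand ha]
  have hc := continuous_catX_integrand ha
  exact (intervalIntegral.integral_hasDerivAt_right (hc.intervalIntegrable _ _)
    (hc.stronglyMeasurableAtFilter _ _) hc.continuousAt).const_mul _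

include ha in
lemma contDiff_catX : ContDiff ℝ ∞ (catX a) := by
  rw [contDiff_infty_iff_deriv]
  refine ⟨fun s => (hasDerivAt_catX ha s).differentiableAt, ?_⟩
  have h1 : deriv (catX a) = fun s =>
      Real.sinh (2 * a) / (2 * Real.sinh (catY a s) * Real.cosh (catY a s) ^ 2) :=
    funext fun s => (hasDerivAt_catX ha s).deriv
  rw [h1]
  have hy := contDiff_catY ha
  refine contDiff_const.div ((contDiff_const.mul hy.sinh).mul (hy.cosh.pow 2)) fun s => ?_
  have hS : 0 < Real.sinh (catY a s) := Real.sinh_pos_iff.2 (catY_pos ha s)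
  have hC : 0 < Real.cosh (catY a s) := Real.cosh_pos _
  positivity

lemma catX_neg (a s : ℝ) : catX a (-s) = -catX a s := by
  rw [catX, catX, ← mul_neg]
  congr 1
  have h := intervalIntegral.integral_comp_neg (a := 0) (b := s) fun t =>
    √(Real.cosh (2 * a) * Real.cosh (2 * t) - 1) /
      (Real.cosh (2 * a) ^ 2 * Real.cosh (2 * t) ^ 2 - 1)
  simp only [mul_neg, Real.cosh_neg, neg_zero] at h
  rw [h, intervalIntegral.integral_symm]

lemma catY_neg (a s : ℝ) : catY a (-s) = catY a s := by
  rw [catY, catY, mul_neg, Real.cosh_neg]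

/-- The lift of the catenoid to the hyperboloid. -/
abbrev catenoidLift (a : ℝ) : ℝ × ℝ → E3 × ℝ := revolutionLift (catX a) (catY a)

lemma catenoidParam_eq (a : ℝ) (p : ℝ × ℝ) : catenoidParam a p = stereo (catenoidLift a p) := by
  rw [stereo_revolutionLift, catenoidParam]

lemma ballMap_catenoidParam (L : LorentzIso) (a : ℝ) (p : ℝ × ℝ) :
    L.ballMap (catenoidParam a p) = stereo (L.toEquiv (catenoidLift a p)) := by
  rw [catenoidParam_eq, L.ballMap_stereo (mink_revolutionLift _ _ _)
    (revolutionLift_snd_pos _ _ _)]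

lemma catenoidParam_mem_ball (a : ℝ) (p : ℝ × ℝ) : catenoidParam a p ∈ ball3 := by
  rw [catenoidParam_eq]
  exact stereo_mem_ball (mink_revolutionLift _ _ _) (revolutionLift_snd_pos _ _ _)

-- The formula for `x'` says that `x' sinh y cosh² y` is the constant `sinh (2a) / 2`, a first
-- integral of the catenary equations. Its derivative is the equation for `x''`; the equation for
-- `y''` uses unit speed to eliminate `x'²`.
include ha in
theorem isMinimalImmersion_catenoid (L : LorentzIso) :
    IsMinimalImmersion fun p => L.ballMap (catenoidParam a p) := by
  simp only [ballMap_catenoidParam]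
  have hS : ∀ s, 0 < Real.sinh (catY a s) := fun s => Real.sinh_pos_iff.2 (catY_pos ha s)
  have hC : ∀ s, 0 < Real.cosh (catY a s) := fun s => Real.cosh_pos _
  have dy := hasDerivAt_catY ha
  have dx := hasDerivAt_catX ha
  have hY : ∀ s, Real.sinh (2 * catY a s) = 2 * Real.sinh (catY a s) * Real.cosh (catY a s) :=
    fun s => Real.sinh_two_mul _
  have hY2 : ∀ s, 0 < Real.sinh (2 * catY a s) := fun s => by
    rw [hY]; exact mul_pos (mul_pos two_pos (hS s)) (hC s)
  have hunit : ∀ s, Real.cosh (catY a s) ^ 2 *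
      (Real.sinh (2 * a) / (2 * Real.sinh (catY a s) * Real.cosh (catY a s) ^ 2)) ^ 2
      + (Real.cosh (2 * a) * Real.sinh (2 * s) / Real.sinh (2 * catY a s)) ^ 2 = 1 := by
    intro s
    have hs := (hS s).ne'
    have hc := (hC s).ne'
    have e1 := Real.sinh_sq (2 * catY a s)
    rw [cosh_two_mul_catY ha, hY] at e1
    have e2 := Real.sinh_sq (2 * a)
    have e3 := Real.sinh_sq (2 * s)
    rw [hY]
    field_simp
    linear_combination (e2 + Real.cosh (2 * a) ^ 2 * e3 - e1)
  have dx' : ∀ s, HasDerivAt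
      (fun s => Real.sinh (2 * a) / (2 * Real.sinh (catY a s) * Real.cosh (catY a s) ^ 2)) _ s :=
    fun s => HasDerivAt.div (hasDerivAt_const s _) (((dy s).sinh.const_mul 2).mul
      ((dy s).cosh.pow 2)) (by have := hS s; have := hC s; positivity)
  have dy' : ∀ s, HasDerivAt
      (fun s => Real.cosh (2 * a) * Real.sinh (2 * s) / Real.sinh (2 * catY a s)) _ s :=
    fun s => HasDerivAt.div (((hasDerivAt_id s).const_mul 2).sinh.const_mul _)
      ((dy s).const_mul 2).sinh (hY2 s).ne'
  refine isMinimalImmersion_revolution L (contDiff_catX ha) (contDiff_catY ha) dx dy dx' dy'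
    (catY_pos ha) hunit (fun s => ?_) (fun s => ?_)
  · have hs := (hS s).ne'
    have hc := (hC s).ne'
    have h2 := (hY2 s).ne'
    field_simp
    norm_num
    ring
  · have hs := (hS s).ne'
    have hc := (hC s).ne'
    have h2 := (hY2 s).ne'
    have e1 := hunit s
    have e2 := cosh_two_mul_catY ha s
    have e3 := Real.cosh_two_mul (catY a s)
    simp only [id]
    rw [← e3]
    have e4 : Real.cosh (catY a s) *
      (Real.sinh (2 * a) / (2 * Real.sinh (catY a s) * Real.cosh (catY a s) ^ 2)) ^ 2
      = (1 - (Real.cosh (2 * a) * Real.sinh (2 * s) / Real.sinh (2 * catY a s)) ^ 2)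
        / Real.cosh (catY a s) := by
      rw [eq_div_iff hc]; linear_combination e1
    rw [mul_assoc (Real.cosh (2 * catY a s)), e4]
    have e5 : Real.sinh (catY a s) = Real.sinh (2 * catY a s) / (2 * Real.cosh (catY a s)) := by
      rw [hY]; field_simp
    rw [e5]
    field_simp
    rw [e2]
    ring

end Catenary

/-! ### The asymptotic boundary of the catenoids -/

lemma exists_polar {x y r : ℝ} (hr : 0 ≤ r) (h : x ^ 2 + y ^ 2 = r ^ 2) :
    ∃ θ : ℝ, x = r * Real.cos θ ∧ y = r * Real.sin θ := by
  have hn : ‖(⟨x, y⟩ : ℂ)‖ = r := by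
    rw [Complex.norm_eq_sqrt_sq_add_sq, h, Real.sqrt_sq hr]
  refine ⟨Complex.arg ⟨x, y⟩, ?_, ?_⟩
  · rw [← hn, Complex.norm_mul_cos_arg]
  · rw [← hn, Complex.norm_mul_sin_arg]

lemma norm_sq_E3 (x : E3) : ‖x‖ ^ 2 = x 0 ^ 2 + x 1 ^ 2 + x 2 ^ 2 := by
  rw [EuclideanSpace.real_norm_sq_eq, Fin.sum_univ_three]

lemma tendsto_cosh_atTop' : Tendsto Real.cosh atTop atTop := by
  refine tendsto_atTop_mono (fun x => ?_) tendsto_id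
  rw [Real.cosh_eq]
  have h1 := Real.add_one_le_exp (x / 2)
  have h2 : Real.exp x = Real.exp (x / 2) ^ 2 := by rw [← Real.exp_nat_mul]; norm_num; ring_nf
  have h3 := Real.add_one_le_exp (-x)
  by_cases hx : x ≤ 0
  · simp only [id]; nlinarith [Real.exp_pos x, Real.exp_pos (-x)]
  · simp only [id]
    push Not at hx
    have : (x / 2 + 1) ^ 2 ≤ Real.exp (x / 2) ^ 2 := by gcongr
    rw [h2]
    nlinarith [Real.exp_pos (-x), sq_nonneg (x / 2 - 1), sq_nonneg x]

/-! ### Limits of points of the ball far from the axis -/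

section Limits

variable {ι : Type*} {l : Filter ι} {x y : ι → ℝ} {ρ : ℝ}

lemma tendsto_inv_cosh (hy : Tendsto y l atTop) :
    Tendsto (fun i => (Real.cosh (y i))⁻¹) l (𝓝 0) :=
  tendsto_inv_atTop_zero.comp (tendsto_cosh_atTop'.comp hy)

/-- Divide numerator and denominator by `cosh y`. The angle may vary arbitrarily along the filter,
as it does for an uncontrolled sequence of points on the catenoid. -/
lemma tendsto_ballPoint_zero (hx : Tendsto x l (𝓝 ρ)) (hy : Tendsto y l atTop) (θ : ι → ℝ) :
    Tendsto (fun i => ballPoint (x i) (y i) (θ i) 0) l (𝓝 (Real.tanh ρ)) := by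
  have h1 : Tendsto (fun i => Real.sinh (x i) / ((Real.cosh (y i))⁻¹ + Real.cosh (x i))) l
      (𝓝 (Real.sinh ρ / (0 + Real.cosh ρ))) :=
    ((Real.continuous_sinh.tendsto ρ).comp hx).div
      ((tendsto_inv_cosh hy).add ((Real.continuous_cosh.tendsto ρ).comp hx))
      (by rw [zero_add]; exact (Real.cosh_pos ρ).ne')
  rw [zero_add, ← Real.tanh_eq_sinh_div_cosh] at h1
  refine h1.congr fun i => ?_
  have hc := Real.cosh_pos (y i)
  have hc' := Real.cosh_pos (x i)
  simp only [ballPoint, Matrix.cons_val]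
  field_simp

lemma tendsto_ballPoint_radius (hx : Tendsto x l (𝓝 ρ)) (hy : Tendsto y l atTop) :
    Tendsto (fun i => Real.sinh (y i) / (1 + Real.cosh (x i) * Real.cosh (y i))) l
      (𝓝 (Real.cosh ρ)⁻¹) := by
  have h0 : Tendsto (fun i => Real.exp (-y i)) l (𝓝 0) := Real.tendsto_exp_neg_atTop_nhds_zero.comp hy
  have h1 : Tendsto (fun i => (1 - Real.exp (-y i) * (Real.cosh (y i))⁻¹) /
      ((Real.cosh (y i))⁻¹ + Real.cosh (x i))) l (𝓝 ((1 - 0 * 0) / (0 + Real.cosh ρ))) :=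
    (tendsto_const_nhds.sub (h0.mul (tendsto_inv_cosh hy))).div
      ((tendsto_inv_cosh hy).add ((Real.continuous_cosh.tendsto ρ).comp hx))
      (by rw [zero_add]; exact (Real.cosh_pos ρ).ne')
  have h2 : (1 - 0 * 0) / (0 + Real.cosh ρ) = (Real.cosh ρ)⁻¹ := by simp
  rw [h2] at h1
  refine h1.congr fun i => ?_
  have hc := Real.cosh_pos (y i)
  have hc' := Real.cosh_pos (x i)
  rw [← Real.cosh_sub_sinh]
  field_simp
  ring

lemma tendsto_ballPoint (hx : Tendsto x l (𝓝 ρ)) (hy : Tendsto y l atTop) (θ : ℝ) :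
    Tendsto (fun i => ballPoint (x i) (y i) θ) l
      (𝓝 !₂[Real.tanh ρ, (Real.cosh ρ)⁻¹ * Real.cos θ, (Real.cosh ρ)⁻¹ * Real.sin θ]) := by
  have h : Tendsto (fun i => (WithLp.ofLp (ballPoint (x i) (y i) θ))) l
      (𝓝 ![Real.tanh ρ, (Real.cosh ρ)⁻¹ * Real.cos θ, (Real.cosh ρ)⁻¹ * Real.sin θ]) := by
    rw [tendsto_pi_nhds]
    intro i
    fin_cases i
    · exact tendsto_ballPoint_zero hx hy _
    · exact (tendsto_ballPoint_radius hx hy).mul_const _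
    · exact (tendsto_ballPoint_radius hx hy).mul_const _
  exact ((PiLp.continuous_toLp 2 _).tendsto _).comp h

end Limits

/-- The unit normal of the geodesic plane orthogonal to the axis at signed distance `ρ` from
the origin. -/
def axisNormal (ρ : ℝ) : E3 × ℝ := (!₂[Real.cosh ρ, 0, 0], Real.sinh ρ)

lemma mink_axisNormal_homLift (ρ : ℝ) (z : E3) : mink (axisNormal ρ) (homLift z)
    = 2 * Real.cosh ρ * z 0 - Real.sinh ρ * (1 + ‖z‖ ^ 2) := by
  rw [axisNormal, homLift, mink_coords]
  simp only [Matrix.cons_val, PiLp.smul_apply, smul_eq_mul]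
  ring

lemma mink_axisNormal_eq_zero_iff {ρ : ℝ} {z : E3} (hz : z ∈ sphereInf) :
    mink (axisNormal ρ) (homLift z) = 0 ↔ z 0 = Real.tanh ρ := by
  have h1 : ‖z‖ ^ 2 = 1 := by linarith [mem_sphereInf_iff.1 hz]
  have hc := Real.cosh_pos ρ
  rw [mink_axisNormal_homLift, h1, Real.tanh_eq_sinh_div_cosh, eq_div_iff hc.ne']
  constructor <;> intro h <;> linarith

lemma exists_eq_of_mem_axis_circle {ρ : ℝ} {z : E3} (hz : z ∈ sphereInf)
    (h : z 0 = Real.tanh ρ) :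
    ∃ θ, z = !₂[Real.tanh ρ, (Real.cosh ρ)⁻¹ * Real.cos θ, (Real.cosh ρ)⁻¹ * Real.sin θ] := by
  have h1 : ‖z‖ ^ 2 = 1 := by linarith [mem_sphereInf_iff.1 hz]
  have hc := Real.cosh_pos ρ
  rw [norm_sq_E3, h, Real.tanh_eq_sinh_div_cosh] at h1
  obtain ⟨θ, e1, e2⟩ := exists_polar (x := z 1) (y := z 2) (r := (Real.cosh ρ)⁻¹) (by positivity) (by
    have := Real.cosh_sq ρ
    field_simp at h1 ⊢
    linarith)
  refine ⟨θ, PiLp.ext fun i => ?_⟩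
  fin_cases i
  · exact h
  · exact e1
  · exact e2

lemma continuous_homLift : Continuous homLift := by
  unfold homLift; fun_prop

lemma continuous_mink_homLift (N : E3 × ℝ) : Continuous fun z => mink N (homLift z) := by
  have := continuous_homLift
  unfold mink
  fun_prop

/-- The plane is itself a surface of revolution, with constant axial position `ρ`. -/
lemma ballPoint_mem_axis_plane (ρ y θ : ℝ) :
    ballPoint ρ y θ ∈ {z | z ∈ ball3 ∧ mink (axisNormal ρ) (homLift z) = 0} := by
  have e := stereo_revolutionLift (fun _ => ρ) id (y, θ)
  have m := mink_revolutionLift (fun _ => ρ) id (y, θ)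
  have p := revolutionLift_snd_pos (fun _ => ρ) id (y, θ)
  simp only [id] at e
  rw [← e]
  refine ⟨stereo_mem_ball m p, ?_⟩
  rw [homLift_stereo m p, mink_smul_right]
  refine mul_eq_zero_of_right _ ?_
  rw [axisNormal, revolutionLift, sepSurface, mink_coords]
  simp only [Matrix.cons_val]
  ring

/-- The asymptotic boundary of the plane `axisNormal ρ`. -/
lemma asymptoticBoundary_axis_plane (ρ : ℝ) :
    asymptoticBoundary {z | z ∈ ball3 ∧ mink (axisNormal ρ) (homLift z) = 0}
      = {z | z ∈ sphereInf ∧ mink (axisNormal ρ) (homLift z) = 0} := by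
  ext z
  constructor
  · rintro ⟨hz, hs⟩
    refine ⟨hs, ?_⟩
    exact closure_minimal (fun x hx => hx.2)
      (isClosed_eq (continuous_mink_homLift (axisNormal ρ)) continuous_const) hz
  · rintro ⟨hs, h⟩
    refine ⟨?_, hs⟩
    obtain ⟨θ, rfl⟩ := exists_eq_of_mem_axis_circle hs ((mink_axisNormal_eq_zero_iff hs).1 h)
    exact mem_closure_of_tendsto (tendsto_ballPoint (x := fun _ : ℝ => ρ) (y := id)
      tendsto_const_nhds tendsto_id θ) (.of_forall fun t => ballPoint_mem_axis_plane ρ t θ)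

lemma tendsto_catY_atTop {a : ℝ} (ha : 0 < a) : Tendsto (catY a) atTop atTop := by
  refine tendsto_atTop_mono' atTop (f₁ := id) ?_ tendsto_id
  filter_upwards [eventually_ge_atTop 0] with s hs
  have h := cosh_two_mul_catY ha s
  have h1 : Real.cosh (2 * s) ≤ Real.cosh (2 * catY a s) := by
    rw [h]
    exact le_mul_of_one_le_left (Real.cosh_pos _).le (Real.one_le_cosh _)
  rw [Real.cosh_le_cosh, abs_of_nonneg (by positivity),
    abs_of_pos (by linarith [catY_pos ha s])] at h1
  simp only [id]
  linarith

lemma tendsto_catY_atBot {a : ℝ} (ha : 0 < a) : Tendsto (catY a) atBot atTop := by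
  have := (tendsto_catY_atTop ha).comp tendsto_neg_atBot_atTop
  exact this.congr fun s => catY_neg a s

lemma tendsto_catX_atBot {a ρ : ℝ} (h : Tendsto (catX a) atTop (𝓝 ρ)) :
    Tendsto (catX a) atBot (𝓝 (-ρ)) := by
  have := (h.comp tendsto_neg_atBot_atTop).neg
  exact this.congr fun s => by simp [catX_neg]

/-- A boundary point is a limit along an ultrafilter on the parameter plane. There the time
component of the lift must blow up, while it is bounded over compact ranges of `s`, so `s` leaves
every interval. The ultrafilter selects one end, and the first coordinate tends to `± tanh ρ`.
Conversely, each meridian converges to a point of either circle, and every point of the circles is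
reached. -/
lemma asymptoticBoundary_catenoid {a ρ : ℝ} (ha : 0 < a) (h : Tendsto (catX a) atTop (𝓝 ρ)) :
    asymptoticBoundary (range (catenoidParam a))
      = {z | z ∈ sphereInf ∧ mink (axisNormal ρ) (homLift z) = 0}
        ∪ {z | z ∈ sphereInf ∧ mink (axisNormal (-ρ)) (homLift z) = 0} := by
  ext z
  constructor
  · rintro ⟨hz, hs⟩
    have hne : (comap (catenoidParam a) (𝓝 z)).NeBot := by
      rw [comap_neBot_iff]
      intro t ht
      obtain ⟨_, hy, ⟨p, rfl⟩⟩ := mem_closure_iff_nhds.1 hz t ht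
      exact ⟨p, hy⟩
    let u : Ultrafilter (ℝ × ℝ) := Ultrafilter.of (comap (catenoidParam a) (𝓝 z))
    have hu : Tendsto (catenoidParam a) u (𝓝 z) := tendsto_comap.mono_left (Ultrafilter.of_le _)
    have hu0 : Tendsto (fun p => catenoidParam a p 0) u (𝓝 (z 0)) :=
      ((EuclideanSpace.proj (𝕜 := ℝ) (0 : Fin 3)).continuous.tendsto z).comp hu
    have hlim : Tendsto (fun p => 2 / (1 + (catenoidLift a p).2)) u (𝓝 0) := by
      have h1 : Tendsto (fun p => 1 - ‖catenoidParam a p‖ ^ 2) u (𝓝 (1 - ‖z‖ ^ 2)) :=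
        ((continuous_const.sub (continuous_norm.pow 2)).tendsto z).comp hu
      rw [mem_sphereInf_iff.1 hs] at h1
      refine h1.congr fun p => ?_
      rw [catenoidParam_eq, one_sub_norm_stereo (mink_revolutionLift _ _ _)
        (revolutionLift_snd_pos _ _ _)]
    have hbig : ∀ M : ℝ, ∀ᶠ p in (u : Filter (ℝ × ℝ)), p.1 ∉ Icc (-M) M := by
      intro M
      have hc : ContinuousOn (fun s => Real.cosh (catX a s) * Real.cosh (catY a s)) (Icc (-M) M) := by
        have h1 := (contDiff_catX ha).continuous
        have h2 := (contDiff_catY ha).continuous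
        exact ((Real.continuous_cosh.comp h1).mul (Real.continuous_cosh.comp h2)).continuousOn
      obtain ⟨B, hB⟩ := isCompact_Icc.bddAbove_image hc
      have hBpos : 0 < 2 / (1 + max B 0) := by positivity
      filter_upwards [hlim.eventually (gt_mem_nhds hBpos)] with p hp hmem
      have h3 := hB (mem_image_of_mem _ hmem)
      have h4 : (catenoidLift a p).2 ≤ max B 0 := by
        simpa [catenoidLift, revolutionLift, sepSurface] using Or.inl h3
      have h5 := revolutionLift_snd_pos (catX a) (catY a) p
      have h6 : 2 / (1 + max B 0) ≤ 2 / (1 + (catenoidLift a p).2) := by gcongr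
      linarith
    rcases (Ultrafilter.eventually_or (f := u) (p := fun p => 0 ≤ p.1)
      (q := fun p => p.1 ≤ 0)).1 (.of_forall fun p => le_total _ _) with hp | hp
    · left
      have ht : Tendsto Prod.fst (u : Filter (ℝ × ℝ)) atTop := by
        rw [tendsto_atTop]
        intro M
        filter_upwards [hp, hbig M] with p h1 h2
        by_contra h3
        push Not at h3
        exact h2 ⟨by linarith, h3.le⟩
      refine ⟨hs, (mink_axisNormal_eq_zero_iff hs).2 ?_⟩
      exact tendsto_nhds_unique hu0 (tendsto_ballPoint_zero (h.comp ht)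
        ((tendsto_catY_atTop ha).comp ht) Prod.snd)
    · right
      have ht : Tendsto Prod.fst (u : Filter (ℝ × ℝ)) atBot := by
        rw [tendsto_atBot]
        intro M
        filter_upwards [hp, hbig (-M)] with p h1 h2
        by_contra h3
        push Not at h3
        exact h2 ⟨by linarith, by linarith⟩
      refine ⟨hs, (mink_axisNormal_eq_zero_iff hs).2 ?_⟩
      exact tendsto_nhds_unique hu0 (tendsto_ballPoint_zero ((tendsto_catX_atBot h).comp ht)
        ((tendsto_catY_atBot ha).comp ht) Prod.snd)
  · rintro (⟨hs, hz⟩ | ⟨hs, hz⟩)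
    · refine ⟨?_, hs⟩
      obtain ⟨θ, rfl⟩ := exists_eq_of_mem_axis_circle hs ((mink_axisNormal_eq_zero_iff hs).1 hz)
      exact mem_closure_of_tendsto (tendsto_ballPoint h (tendsto_catY_atTop ha) θ)
        (.of_forall fun s => ⟨(s, θ), rfl⟩)
    · refine ⟨?_, hs⟩
      obtain ⟨θ, rfl⟩ := exists_eq_of_mem_axis_circle hs ((mink_axisNormal_eq_zero_iff hs).1 hz)
      exact mem_closure_of_tendsto (tendsto_ballPoint (tendsto_catX_atBot h)
        (tendsto_catY_atBot ha) θ) (.of_forall fun s => ⟨(s, θ), rfl⟩)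

/-! ### The catenoids are surfaces of revolution -/

lemma norm_sub_eq_of_hypDist_eq {x c u : E3} (hx : x ∈ ball3) (hc : c ∈ ball3) (hu : u ∈ ball3)
    (h : hypDist x c = hypDist x u) :
    ‖x - c‖ ^ 2 * (1 - ‖u‖ ^ 2) = ‖x - u‖ ^ 2 * (1 - ‖c‖ ^ 2) := by
  rw [mem_ball3_iff] at hx hc hu
  have h1 : 1 + 2 * ‖x - c‖ ^ 2 / ((1 - ‖x‖ ^ 2) * (1 - ‖c‖ ^ 2))
      = 1 + 2 * ‖x - u‖ ^ 2 / ((1 - ‖x‖ ^ 2) * (1 - ‖u‖ ^ 2)) := by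
    refine Real.arcosh_injOn ?_ ?_ h
    · rw [mem_Ici, le_add_iff_nonneg_right]; positivity
    · rw [mem_Ici, le_add_iff_nonneg_right]; positivity
  rw [add_right_inj, div_eq_div_iff (by positivity) (by positivity)] at h1
  have h2 := mul_left_cancel₀ (mul_pos two_pos hx).ne'
    (a := 2 * (1 - ‖x‖ ^ 2)) (b := ‖x - c‖ ^ 2 * (1 - ‖u‖ ^ 2))
    (c := ‖x - u‖ ^ 2 * (1 - ‖c‖ ^ 2)) (by linear_combination h1)
  exact h2

/-- Distances to the two axis points `0` and `(1/2, 0, 0)` determine the norm and the first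
coordinate, hence the point up to rotation about the axis. -/
lemma exists_catenoidParam_eq {a : ℝ} (ha : 0 < a) {p : ℝ × ℝ} {u : E3} (hu : u ∈ ball3)
    (h : ∀ x ∈ axis0, hypDist x (catenoidParam a p) = hypDist x u) :
    ∃ q, catenoidParam a q = u := by
  have hc := catenoidParam_mem_ball a p
  have n0 : (0 : E3) ∈ ball3 := by simp [ball3]
  have n1 : (!₂[1 / 2, 0, 0] : E3) ∈ ball3 := by
    rw [mem_ball3_iff, norm_sq_E3]; simp; norm_num
  have h0 := norm_sub_eq_of_hypDist_eq n0 hc hu (h 0 ⟨n0, rfl, rfl⟩)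
  have h1 := norm_sub_eq_of_hypDist_eq n1 hc hu (h _ ⟨n1, rfl, rfl⟩)
  rw [mem_ball3_iff] at hu
  simp only [zero_sub, norm_neg] at h0
  have e0 : ‖catenoidParam a p‖ ^ 2 = ‖u‖ ^ 2 := by linarith
  rw [e0, mul_left_inj' hu.ne'] at h1
  simp only [norm_sq_E3, PiLp.sub_apply, Matrix.cons_val] at e0 h1
  have e1 : catenoidParam a p 0 = u 0 := by linarith
  have hr : 0 ≤ Real.sinh (catY a p.1)
      / (1 + Real.cosh (catX a p.1) * Real.cosh (catY a p.1)) := by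
    have := Real.sinh_pos_iff.2 (catY_pos ha p.1)
    have := Real.cosh_pos (catX a p.1)
    have := Real.cosh_pos (catY a p.1)
    positivity
  have e2 : catenoidParam a p 1 ^ 2 + catenoidParam a p 2 ^ 2 = (Real.sinh (catY a p.1)
      / (1 + Real.cosh (catX a p.1) * Real.cosh (catY a p.1))) ^ 2 := by
    simp only [catenoidParam, ballPoint, Matrix.cons_val]
    linear_combination (Real.sinh (catY a p.1)
      / (1 + Real.cosh (catX a p.1) * Real.cosh (catY a p.1))) ^ 2 * Real.sin_sq_add_cos_sq p.2
  obtain ⟨θ, t1, t2⟩ := exists_polar (x := u 1) (y := u 2) hr (by rw [← e2]; rw [e1] at e0; linarith)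
  refine ⟨(p.1, θ), PiLp.ext fun i => ?_⟩
  fin_cases i
  · exact e1
  · exact t1.symm
  · exact t2.symm

/-- An isometry fixing the axis preserves distances to its points, so it moves each point within its
rotation orbit. No classification of isometries is needed. -/
lemma isSurfaceOfRevolution_catenoid (L : LorentzIso) {a : ℝ} (ha : 0 < a) :
    IsSurfaceOfRevolution (L.ballMap '' axis0) (range fun p => L.ballMap (catenoidParam a p)) := by
  intro ψ hψ hfix
  have hL := L.isHypIsometry_ballMap
  have key : ∀ s ∈ ball3, ∀ t ∈ ball3, (∀ x ∈ axis0, hypDist (L.ballMap x) s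
      = hypDist (L.ballMap x) t) → s ∈ range (fun p => L.ballMap (catenoidParam a p)) →
      t ∈ range (fun p => L.ballMap (catenoidParam a p)) := by
    rintro s hs t ht hd ⟨p, rfl⟩
    have hinv := L.ballMap_symm_ballMap (Metric.ball_subset_closedBall ht)
    have hu := L.symm.ballMap_mem_ball ht
    obtain ⟨q, hq⟩ := exists_catenoidParam_eq ha (p := p) hu (fun x hx => by
      rw [← hL.2 x hx.1 _ (catenoidParam_mem_ball a p), ← hL.2 x hx.1 _ hu, hinv]
      exact hd x hx)
    exact ⟨q, by simp only [hq, hinv]⟩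
  have hball : ∀ s ∈ range (fun p => L.ballMap (catenoidParam a p)), s ∈ ball3 := by
    rintro _ ⟨p, rfl⟩
    exact L.ballMap_mem_ball (catenoidParam_mem_ball a p)
  have hψd : ∀ x ∈ axis0, ∀ t ∈ ball3, hypDist (L.ballMap x) (ψ t) = hypDist (L.ballMap x) t := by
    intro x hx t ht
    conv_lhs => rw [← hfix _ (mem_image_of_mem _ hx)]
    exact hψ.2 _ (L.ballMap_mem_ball hx.1) _ ht
  apply Subset.antisymm
  · rintro _ ⟨s, hs, rfl⟩
    exact key s (hball s hs) _ (hψ.1.mapsTo (hball s hs))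
      (fun x hx => (hψd x hx s (hball s hs)).symm) hs
  · intro s hs
    obtain ⟨t, ht, rfl⟩ := hψ.1.surjOn (hball s hs)
    exact ⟨t, key _ (hball _ hs) t ht (fun x hx => hψd x hx t ht) hs, rfl⟩

/-! ### Circles at infinity and their normals -/

lemma exists_unit_orthogonal (m n : E3) :
    ∃ e : E3, ‖e‖ = 1 ∧ inner ℝ m e = 0 ∧ inner ℝ n e = 0 := by
  classical
  let K : Submodule ℝ E3 := Submodule.span ℝ (({m, n} : Finset E3) : Set E3)
  have h1 : Module.finrank ℝ K ≤ 2 :=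
    (finrank_span_finset_le_card _).trans Finset.card_le_two
  have h2 := K.finrank_add_finrank_orthogonal
  rw [finrank_euclideanSpace_fin] at h2
  have h3 : Kᗮ ≠ ⊥ := by
    intro h
    rw [h, finrank_bot] at h2
    omega
  obtain ⟨v, hv, hv0⟩ := Submodule.exists_mem_ne_zero_of_ne_bot h3
  have hn : ‖v‖ ≠ 0 := norm_ne_zero_iff.2 hv0
  have hm : ∀ w ∈ ({m, n} : Finset E3), inner ℝ w v = 0 := fun w hw =>
    (K.mem_orthogonal v).1 hv w (Submodule.subset_span hw)
  refine ⟨‖v‖⁻¹ • v, ?_, ?_, ?_⟩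
  · rw [norm_smul, norm_inv, norm_norm, inv_mul_cancel₀ hn]
  · rw [real_inner_smul_right, hm m (by simp), mul_zero]
  · rw [real_inner_smul_right, hm n (by simp), mul_zero]

lemma mink_homLift_sphere (M : E3 × ℝ) {z : E3} (hz : z ∈ sphereInf) :
    mink M (homLift z) = 2 * (inner ℝ M.1 z - M.2) := by
  have h1 : ‖z‖ ^ 2 = 1 := by linarith [mem_sphereInf_iff.1 hz]
  simp only [mink, homLift, real_inner_smul_right, h1]
  ring

section Circles

variable {n : E3} {h : ℝ} (hn : ‖n‖ = 1)

include hn in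
lemma circle_point_mem {e : E3} (he : ‖e‖ = 1) (hne : inner ℝ n e = 0) {t : ℝ}
    (ht : t ^ 2 = 1 - h ^ 2) :
    h • n + t • e ∈ sphereInf ∧ inner ℝ n (h • n + t • e) = h := by
  constructor
  · rw [mem_sphereInf_iff, norm_add_sq_real, norm_smul, norm_smul, mul_pow, mul_pow, hn, he,
      real_inner_smul_left, real_inner_smul_right, hne, Real.norm_eq_abs, Real.norm_eq_abs,
      sq_abs, sq_abs, ht]
    ring
  · rw [inner_add_right, real_inner_smul_right, real_inner_smul_right, hne,
      real_inner_self_eq_norm_sq, hn]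
    ring

include hn in
/-- A circle determines its normal up to a factor. -/
lemma eq_smul_of_circle_subset (hh : |h| < 1) {M : E3 × ℝ}
    (hM : ∀ z ∈ sphereInf, inner ℝ n z = h → mink M (homLift z) = 0) :
    M = inner ℝ M.1 n • (n, h) := by
  have hs : 0 < 1 - h ^ 2 := by rw [sub_pos, sq_lt_one_iff_abs_lt_one]; exact hh
  -- For the opposite points `h n ± √(1 - h²) e` of the circle, the difference of the two conditions
  -- gives `M.1 ⟂ e` and their sum gives `M.2`.
  have key : ∀ e : E3, ‖e‖ = 1 → inner ℝ n e = 0 →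
      inner ℝ M.1 e = 0 ∧ h * inner ℝ M.1 n = M.2 := by
    intro e he hne
    have ht : √(1 - h ^ 2) ^ 2 = 1 - h ^ 2 := Real.sq_sqrt hs.le
    have h1 := circle_point_mem hn he hne ht
    have h2 := circle_point_mem (h := h) hn he hne (t := -√(1 - h ^ 2)) (by rw [neg_sq, ht])
    have k1 := hM _ h1.1 h1.2
    have k2 := hM _ h2.1 h2.2
    rw [mink_homLift_sphere M h1.1, inner_add_right, real_inner_smul_right,
      real_inner_smul_right] at k1
    rw [mink_homLift_sphere M h2.1, inner_add_right, real_inner_smul_right,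
      real_inner_smul_right] at k2
    have hp : 0 < √(1 - h ^ 2) := Real.sqrt_pos.2 hs
    constructor
    · have : √(1 - h ^ 2) * inner ℝ M.1 e = 0 := by linarith
      exact (mul_eq_zero.1 this).resolve_left hp.ne'
    · linarith
  obtain ⟨e, he, hne, -⟩ := exists_unit_orthogonal n n
  -- If nonzero, the part of `M.1` orthogonal to `n` would be an admissible direction `e`, hence
  -- orthogonal to itself.
  have hr : M.1 - inner ℝ M.1 n • n = 0 := by
    by_contra hne0
    set r := M.1 - inner ℝ M.1 n • n with hrdef
    have hnr : ‖r‖ ≠ 0 := norm_ne_zero_iff.2 hne0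
    have hor : inner ℝ n r = 0 := by
      rw [hrdef, inner_sub_right, real_inner_smul_right, real_inner_self_eq_norm_sq, hn,
        real_inner_comm]
      ring
    have k := (key (‖r‖⁻¹ • r) (by rw [norm_smul, norm_inv, norm_norm, inv_mul_cancel₀ hnr])
      (by rw [real_inner_smul_right, hor, mul_zero])).1
    rw [real_inner_smul_right] at k
    have k1 : inner ℝ M.1 r = 0 := (mul_eq_zero.1 k).resolve_left (inv_ne_zero hnr)
    have k2 : inner ℝ r r = 0 := by
      conv_lhs => rw [hrdef]
      rw [inner_sub_left, real_inner_smul_left, k1, hor]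
      ring
    exact hne0 (inner_self_eq_zero.1 k2)
  refine Prod.ext ?_ ?_
  · simpa using sub_eq_zero.1 hr
  · simp only [Prod.smul_snd, smul_eq_mul]
    linarith [(key e he hne).2]

end Circles

/-- The hypothesis says that the line common to the two planes meets the sphere. The vector `α n₁ +
β n₂` is the point of that line nearest to the origin; its norm is at most one, and moving by `γ`
along the common perpendicular `e` reaches the sphere. For `n₁ = ±n₂` the hypothesis forces the
planes to coincide. -/
lemma circles_meet {n₁ n₂ : E3} {h₁ h₂ : ℝ} (hn₁ : ‖n₁‖ = 1) (hn₂ : ‖n₂‖ = 1) (hh₁ : |h₁| < 1)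
    (hle : (inner ℝ n₁ n₂ - h₁ * h₂) ^ 2 ≤ (1 - h₁ ^ 2) * (1 - h₂ ^ 2)) :
    ∃ z ∈ sphereInf, inner ℝ n₁ z = h₁ ∧ inner ℝ n₂ z = h₂ := by
  have hs : 0 < 1 - h₁ ^ 2 := by rw [sub_pos, sq_lt_one_iff_abs_lt_one]; exact hh₁
  obtain ⟨e, he, e1, e2⟩ := exists_unit_orthogonal n₁ n₂
  have hp := circle_point_mem hn₁ he e1 (Real.sq_sqrt hs.le)
  set g : ℝ := inner ℝ n₁ n₂ with hg
  have hg1 : |g| ≤ 1 := by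
    have := abs_real_inner_le_norm n₁ n₂
    rwa [hn₁, hn₂, mul_one] at this
  rcases eq_or_ne (g ^ 2) 1 with hsq | hsq
  · rcases mul_self_eq_one_iff.1 ((sq g).symm.trans hsq) with h | h
    · have hnn : n₁ = n₂ := (inner_eq_one_iff_of_norm_eq_one hn₁ hn₂).1 h
      have hhh : h₁ = h₂ := by
        rw [h] at hle
        have : (h₁ - h₂) ^ 2 ≤ 0 := by nlinarith
        have := pow_eq_zero_iff (two_ne_zero) |>.1 (le_antisymm this (sq_nonneg _))
        linarith
      exact ⟨_, hp.1, hp.2, by rw [← hnn, ← hhh]; exact hp.2⟩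
    · have hnn : n₁ = -n₂ := by
        refine (inner_eq_one_iff_of_norm_eq_one (𝕜 := ℝ) hn₁ (by rwa [norm_neg])).1 ?_
        rw [inner_neg_right, ← hg, h, neg_neg]
      have hhh : h₁ = -h₂ := by
        rw [h] at hle
        have : (h₁ + h₂) ^ 2 ≤ 0 := by nlinarith
        have := pow_eq_zero_iff (two_ne_zero) |>.1 (le_antisymm this (sq_nonneg _))
        linarith
      refine ⟨_, hp.1, hp.2, ?_⟩
      have h2 : n₂ = -n₁ := by rw [hnn, neg_neg]
      rw [h2, inner_neg_left, hp.2, hhh, neg_neg]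
  · have hlt : 0 < 1 - g ^ 2 := by
      have : g ^ 2 ≤ 1 := by rwa [sq_le_one_iff_abs_le_one]
      exact sub_pos.2 (lt_of_le_of_ne this hsq)
    set α := (h₁ - g * h₂) / (1 - g ^ 2) with hα
    set β := (h₂ - g * h₁) / (1 - g ^ 2) with hβ
    have a1 : α + β * g = h₁ := by rw [hα, hβ]; field_simp; ring
    have a2 : α * g + β = h₂ := by rw [hα, hβ]; field_simp; ring
    have a3 : α ^ 2 + 2 * α * β * g + β ^ 2 ≤ 1 := by
      have : α ^ 2 + 2 * α * β * g + β ^ 2 = α * h₁ + β * h₂ := by rw [← a1, ← a2]; ring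
      rw [this, hα, hβ, div_mul_eq_mul_div, div_mul_eq_mul_div, ← add_div, div_le_one hlt]
      nlinarith
    set γ := √(1 - (α ^ 2 + 2 * α * β * g + β ^ 2)) with hγ
    have hγ2 : γ ^ 2 = 1 - (α ^ 2 + 2 * α * β * g + β ^ 2) := Real.sq_sqrt (by linarith)
    have hn11 : inner ℝ n₁ n₁ = (1 : ℝ) := by rw [real_inner_self_eq_norm_sq, hn₁]; norm_num
    have hn22 : inner ℝ n₂ n₂ = (1 : ℝ) := by rw [real_inner_self_eq_norm_sq, hn₂]; norm_num
    have hee : inner ℝ e e = (1 : ℝ) := by rw [real_inner_self_eq_norm_sq, he]; norm_num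
    refine ⟨α • n₁ + β • n₂ + γ • e, ?_, ?_, ?_⟩
    · rw [mem_sphereInf_iff, ← real_inner_self_eq_norm_sq]
      simp only [inner_add_left, inner_add_right, real_inner_smul_left, real_inner_smul_right,
        hn11, hn22, hee, e1, e2, real_inner_comm n₁ n₂, real_inner_comm n₁ e, real_inner_comm n₂ e,
        ← hg]
      linear_combination -hγ2
    · simp only [inner_add_right, real_inner_smul_right, hn11, e1, ← hg]
      linarith
    · simp only [inner_add_right, real_inner_smul_right, hn22, e2, real_inner_comm n₁ n₂, ← hg]
      linarith

/-- `N` is a unit spacelike vector orthogonal to the null directions over the points of `C`. -/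
structure IsUnitNormal (N : E3 × ℝ) (C : Set E3) : Prop where
  unit : mink N N = 1
  circle : C = {z | z ∈ sphereInf ∧ mink N (homLift z) = 0}

lemma IsUnitNormal.neg {N : E3 × ℝ} {C : Set E3} (h : IsUnitNormal N C) : IsUnitNormal (-N) C where
  unit := by rw [mink_neg_left, mink_neg_right, neg_neg, h.unit]
  circle := by simp only [mink_neg_left, neg_eq_zero]; exact h.circle

lemma isUnitNormal_of_circle {n : E3} {h : ℝ} (hn : ‖n‖ = 1) (hh : |h| < 1) :
    IsUnitNormal ((√(1 - h ^ 2))⁻¹ • (n, h)) {x | x ∈ sphereInf ∧ inner ℝ n x = h} := by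
  have hs : 0 < 1 - h ^ 2 := by rw [sub_pos, sq_lt_one_iff_abs_lt_one]; exact hh
  have hp : 0 < √(1 - h ^ 2) := Real.sqrt_pos.2 hs
  refine ⟨?_, ?_⟩
  · rw [mink_smul_left, mink_smul_right, mink_self, hn]
    have := Real.sq_sqrt hs.le
    field_simp
    linarith
  · ext z
    refine and_congr_right fun hz => ?_
    rw [mink_smul_left, mink_homLift_sphere _ hz, mul_eq_zero, mul_eq_zero, sub_eq_zero]
    simp [hp.ne']

/-- Disjoint circles at infinity have unit normals whose product exceeds `1` and whose
difference is future-pointing. -/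
lemma exists_normals {C₁ C₂ : Set E3} (h₁ : IsCircleAtInfinity C₁) (h₂ : IsCircleAtInfinity C₂)
    (hd : Disjoint C₁ C₂) : ∃ N₁ N₂ : E3 × ℝ, IsUnitNormal N₁ C₁ ∧ IsUnitNormal N₂ C₂ ∧
      1 < mink N₁ N₂ ∧ 0 < (N₁ - N₂).2 := by
  obtain ⟨n₁, k₁, hn₁, hk₁, rfl⟩ := h₁
  obtain ⟨n₂, k₂, hn₂, hk₂, rfl⟩ := h₂
  have hs₁ : 0 < 1 - k₁ ^ 2 := by rw [sub_pos, sq_lt_one_iff_abs_lt_one]; exact hk₁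
  have hs₂ : 0 < 1 - k₂ ^ 2 := by rw [sub_pos, sq_lt_one_iff_abs_lt_one]; exact hk₂
  have U₁ := isUnitNormal_of_circle hn₁ hk₁
  have U₂ := isUnitNormal_of_circle hn₂ hk₂
  set M₁ := (√(1 - k₁ ^ 2))⁻¹ • (n₁, k₁) with hM₁
  set M₂ := (√(1 - k₂ ^ 2))⁻¹ • (n₂, k₂) with hM₂
  have hlt : 1 < mink M₁ M₂ ^ 2 := by
    by_contra hcon
    push Not at hcon
    have e : mink M₁ M₂ ^ 2 = (inner ℝ n₁ n₂ - k₁ * k₂) ^ 2 / ((1 - k₁ ^ 2) * (1 - k₂ ^ 2)) := by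
      rw [hM₁, hM₂, mink_smul_left, mink_smul_right, mul_pow, mul_pow, inv_pow, inv_pow,
        Real.sq_sqrt hs₁.le, Real.sq_sqrt hs₂.le]
      simp only [mink]
      field_simp
    rw [e, div_le_one (by positivity)] at hcon
    obtain ⟨z, hz, z1, z2⟩ := circles_meet hn₁ hn₂ hk₁ hcon
    exact Set.disjoint_left.1 hd ⟨hz, z1⟩ ⟨hz, z2⟩
  -- A product above `1` makes `N₁ - N₂` timelike, so its time component is nonzero, and changing
  -- both signs makes it positive.
  have step : ∀ N₁ N₂ : E3 × ℝ, IsUnitNormal N₁ {x | x ∈ sphereInf ∧ inner ℝ n₁ x = k₁} →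
      IsUnitNormal N₂ {x | x ∈ sphereInf ∧ inner ℝ n₂ x = k₂} → 1 < mink N₁ N₂ →
      ∃ N₁ N₂ : E3 × ℝ, IsUnitNormal N₁ {x | x ∈ sphereInf ∧ inner ℝ n₁ x = k₁} ∧
      IsUnitNormal N₂ {x | x ∈ sphereInf ∧ inner ℝ n₂ x = k₂} ∧
      1 < mink N₁ N₂ ∧ 0 < (N₁ - N₂).2 := by
    intro N₁ N₂ u₁ u₂ hm
    have ht : mink (N₁ - N₂) (N₁ - N₂) < 0 := by
      rw [mink_sub_left, mink_sub_right, mink_sub_right, u₁.unit, u₂.unit, mink_comm N₂ N₁]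
      linarith
    rw [mink_self] at ht
    rcases lt_trichotomy 0 (N₁ - N₂).2 with h | h | h
    · exact ⟨N₁, N₂, u₁, u₂, hm, h⟩
    · rw [← h] at ht
      nlinarith [sq_nonneg ‖(N₁ - N₂).1‖]
    · refine ⟨-N₁, -N₂, u₁.neg, u₂.neg, ?_, ?_⟩
      · rwa [mink_neg_left, mink_neg_right, neg_neg]
      · simp only [Prod.snd_sub, Prod.snd_neg] at h ⊢
        linarith
  rcases lt_or_ge 0 (mink M₁ M₂) with h | h
  · exact step M₁ M₂ U₁ U₂ (by nlinarith)
  · refine step M₁ (-M₂) U₁ U₂.neg ?_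
    rw [mink_neg_right]
    nlinarith

/-- Normal form of a pair of unit normals under Lorentz transformations. -/
lemma exists_lorentzIso {N₁ N₂ : E3 × ℝ} (h₁ : mink N₁ N₁ = 1) (h₂ : mink N₂ N₂ = 1) {ρ : ℝ}
    (hρ : 0 < ρ) (h₁₂ : mink N₁ N₂ = Real.cosh (2 * ρ)) (ht : 0 < (N₁ - N₂).2) :
    ∃ L : LorentzIso, L.toEquiv (axisNormal ρ) = N₁ ∧ L.toEquiv (axisNormal (-ρ)) = N₂ := by
  have hS : 0 < Real.sinh ρ := Real.sinh_pos_iff.2 hρ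
  have hC : 0 < Real.cosh ρ := Real.cosh_pos ρ
  have hCS := Real.cosh_sq ρ
  rw [Real.cosh_two_mul] at h₁₂
  set e₀ : E3 × ℝ := (0, 1) with he₀
  set e₁ : E3 × ℝ := (!₂[1, 0, 0], 0) with he₁
  have hax : ∀ r, axisNormal r = Real.cosh r • e₁ + Real.sinh r • e₀ := by
    intro r
    refine Prod.ext (PiLp.ext fun i => ?_) ?_
    · fin_cases i <;> simp [axisNormal, he₀, he₁]
    · simp [axisNormal, he₀, he₁]
  -- Since `axisNormal (±ρ) = cosh ρ e₁ ± sinh ρ e₀`, the images of `e₀` and `e₁` must be `f₀` and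
  -- `f₁`. The map is a product of two reflections: `R₂` fixes `e₀` and carries `e₁` to `R₁ f₁`,
  -- then `R₁` carries `e₀` to `f₀`.
  set f₀ : E3 × ℝ := (2 * Real.sinh ρ)⁻¹ • (N₁ - N₂) with hf₀
  set f₁ : E3 × ℝ := (2 * Real.cosh ρ)⁻¹ • (N₁ + N₂) with hf₁
  have g00 : mink e₀ e₀ = -1 := by simp [he₀, mink]
  have g11 : mink e₁ e₁ = 1 := by rw [he₁, mink_coords]; simp
  have g10 : mink e₁ e₀ = 0 := by simp [he₀, he₁, mink]
  have k00 : mink f₀ f₀ = -1 := by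
    rw [hf₀, mink_smul_left, mink_smul_right]
    simp only [mink_sub_left, mink_sub_right, h₁, h₂, mink_comm N₂ N₁, h₁₂]
    field_simp
    linarith
  have k11 : mink f₁ f₁ = 1 := by
    rw [hf₁, mink_smul_left, mink_smul_right]
    simp only [mink_add_left, mink_add_right, h₁, h₂, mink_comm N₂ N₁, h₁₂]
    field_simp
    linarith
  have k10 : mink f₁ f₀ = 0 := by
    rw [hf₀, hf₁, mink_smul_left, mink_smul_right]
    simp only [mink_add_left, mink_sub_right, h₁, h₂, mink_comm N₂ N₁]
    ring
  have hpos : 0 < f₀.2 := by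
    rw [hf₀, Prod.smul_snd, smul_eq_mul]; positivity
  -- The norm is `2 (f₀.2 - 1)`, and a future unit timelike vector has time component at least `1`,
  -- with equality only for `e₀`.
  have hw₁ : e₀ - f₀ = 0 ∨ 0 < mink (e₀ - f₀) (e₀ - f₀) := by
    have hm : mink (e₀ - f₀) (e₀ - f₀) = 2 * (f₀.2 - 1) := by
      have : mink e₀ f₀ = -f₀.2 := by simp [he₀, mink]
      rw [mink_sub_left, mink_sub_right, mink_sub_right, g00, k00, mink_comm f₀ e₀, this]
      ring
    have hk := k00
    rw [mink_self] at hk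
    rcases lt_or_ge 1 f₀.2 with h | h
    · right; rw [hm]; linarith
    · left
      have h0 : ‖f₀.1‖ ^ 2 = 0 := by nlinarith [sq_nonneg ‖f₀.1‖]
      have h1 : f₀.1 = 0 := by simpa using h0
      have h3 : f₀.2 = 1 := by nlinarith
      rw [sub_eq_zero]
      exact Prod.ext h1.symm h3.symm
  set R₁ := LorentzIso.reflection _ hw₁ with hR₁
  have r1 : R₁.toEquiv e₀ = f₀ := LorentzIso.reflection_sub hw₁ (by rw [g00, k00])
  have inv1 : ∀ v, R₁.toEquiv (R₁.toEquiv v) = v := minkReflection_involutive hw₁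
  set v := R₁.toEquiv f₁ with hv
  have v0 : mink v e₀ = 0 := by
    rw [hv, ← inv1 e₀, R₁.mink_map, r1, k10]
  have v1 : mink v v = 1 := by rw [hv, R₁.mink_map, k11]
  have v2 : v.2 = 0 := by simpa [he₀, mink] using v0
  have hw₂ : e₁ - v = 0 ∨ 0 < mink (e₁ - v) (e₁ - v) := by
    rw [mink_self]
    have h2 : (e₁ - v).2 = 0 := by rw [Prod.snd_sub, v2]; simp [he₁]
    rw [h2]
    rcases eq_or_ne (e₁ - v).1 0 with h | h
    · exact Or.inl (Prod.ext h h2)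
    · right
      have := norm_pos_iff.2 h
      simp only [ne_eq, OfNat.ofNat_ne_zero, not_false_eq_true, zero_pow, sub_zero]
      positivity
  set R₂ := LorentzIso.reflection _ hw₂ with hR₂
  have r2 : R₂.toEquiv e₁ = v := LorentzIso.reflection_sub hw₂ (by rw [g11, v1])
  have r3 : R₂.toEquiv e₀ = e₀ := by
    rw [hR₂, LorentzIso.reflection_apply, mink_sub_right, mink_comm e₀ e₁, g10, mink_comm e₀ v, v0]
    simp
  have l0 : (R₁.comp R₂).toEquiv e₀ = f₀ := by
    change R₁.toEquiv (R₂.toEquiv e₀) = f₀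
    rw [r3, r1]
  have l1 : (R₁.comp R₂).toEquiv e₁ = f₁ := by
    change R₁.toEquiv (R₂.toEquiv e₁) = f₁
    rw [r2, hv, inv1]
  have c1 : Real.cosh ρ * (2 * Real.cosh ρ)⁻¹ = 1 / 2 := by field_simp
  have c2 : Real.sinh ρ * (2 * Real.sinh ρ)⁻¹ = 1 / 2 := by field_simp
  refine ⟨R₁.comp R₂, ?_, ?_⟩
  · rw [hax, map_add, map_smul, map_smul, l0, l1, hf₀, hf₁, smul_smul, smul_smul, c1, c2]
    module
  · rw [hax, map_add, map_smul, map_smul, l0, l1, hf₀, hf₁, Real.cosh_neg, Real.sinh_neg, neg_smul,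
      smul_smul, smul_smul, c1, c2]
    module

/-! ### The distance between geodesic planes -/

/-- A point of the plane at `ρ` has `1 + P = τ cosh ρ`, `2 p₀ = τ sinh ρ`, and its doubled
transverse part has squared length `τ² - (1 - P)²`; likewise with `σ`, `Q` and `-ρ`. By
Cauchy–Schwarz the transverse product is at most `τσ - (1 - P)(1 - Q)`, and `τσ ≥ (1 - P)(1 - Q)`.
-/
lemma two_mul_le_hypDist_axis {ρ : ℝ} (hρ : 0 < ρ) {p q : E3} (hp : p ∈ ball3) (hq : q ∈ ball3)
    (hpN : mink (axisNormal ρ) (homLift p) = 0) (hqN : mink (axisNormal (-ρ)) (homLift q) = 0) :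
    2 * ρ ≤ hypDist p q := by
  have hC : 0 < Real.cosh ρ := Real.cosh_pos ρ
  have hCS := Real.cosh_sq ρ
  rw [hypDist_eq hp hq, ← Real.arcosh_cosh (x := 2 * ρ) (by positivity)]
  have hone := one_le_neg_mink_div hp hq
  refine (Real.arcosh_le_arcosh (Real.cosh_pos _) (by linarith)).2 ?_
  rw [mink_axisNormal_homLift] at hpN hqN
  rw [Real.cosh_neg, Real.sinh_neg] at hqN
  rw [mem_ball3_iff] at hp hq
  rw [le_div_iff₀ (by positivity), Real.cosh_two_mul]
  have e : -mink (homLift p) (homLift q)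
      = (1 + ‖p‖ ^ 2) * (1 + ‖q‖ ^ 2) - 4 * (p 0 * q 0 + p 1 * q 1 + p 2 * q 2) := by
    rw [homLift, homLift, mink_coords]
    simp only [PiLp.smul_apply, smul_eq_mul]
    ring
  rw [e]
  have np := norm_sq_E3 p
  have nq := norm_sq_E3 q
  generalize ‖p‖ ^ 2 = P at *
  generalize ‖q‖ ^ 2 = Q at *
  have hP0 : 0 ≤ P := by rw [np]; positivity
  have hQ0 : 0 ≤ Q := by rw [nq]; positivity
  obtain ⟨τ, hτ⟩ : ∃ τ, 1 + P = τ * Real.cosh ρ := ⟨(1 + P) / Real.cosh ρ, by field_simp⟩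
  obtain ⟨σ, hσ⟩ : ∃ σ, 1 + Q = σ * Real.cosh ρ := ⟨(1 + Q) / Real.cosh ρ, by field_simp⟩
  have p0 : 2 * p 0 = τ * Real.sinh ρ := by
    rw [hτ] at hpN
    have : Real.cosh ρ * (2 * p 0) = Real.cosh ρ * (τ * Real.sinh ρ) := by linarith
    exact mul_left_cancel₀ hC.ne' this
  have q0 : 2 * q 0 = -(σ * Real.sinh ρ) := by
    rw [hσ] at hqN
    have : Real.cosh ρ * (2 * q 0) = Real.cosh ρ * (-(σ * Real.sinh ρ)) := by linarith
    exact mul_left_cancel₀ hC.ne' this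
  have hτ0 : 0 < τ := by
    by_contra h
    push Not at h
    linarith [mul_nonpos_of_nonpos_of_nonneg h hC.le]
  have hσ0 : 0 < σ := by
    by_contra h
    push Not at h
    linarith [mul_nonpos_of_nonpos_of_nonneg h hC.le]
  have ep : 4 * (p 1 ^ 2 + p 2 ^ 2) = τ ^ 2 - (1 - P) ^ 2 := by
    have : (1 + P) ^ 2 - (2 * p 0) ^ 2 = τ ^ 2 := by rw [hτ, p0]; linear_combination τ ^ 2 * hCS
    linear_combination this - 4 * np
  have eq : 4 * (q 1 ^ 2 + q 2 ^ 2) = σ ^ 2 - (1 - Q) ^ 2 := by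
    have : (1 + Q) ^ 2 - (2 * q 0) ^ 2 = σ ^ 2 := by rw [hσ, q0]; linear_combination σ ^ 2 * hCS
    linear_combination this - 4 * nq
  have hτP : 1 - P ≤ τ := by
    apply le_of_sq_le_sq _ hτ0.le
    linarith [sq_nonneg (p 1), sq_nonneg (p 2)]
  have hσQ : 1 - Q ≤ σ := by
    apply le_of_sq_le_sq _ hσ0.le
    linarith [sq_nonneg (q 1), sq_nonneg (q 2)]
  have hprod : (1 - P) * (1 - Q) ≤ τ * σ := mul_le_mul hτP hσQ hq.le hτ0.le
  have hcs : 4 * (p 1 * q 1 + p 2 * q 2) ≤ τ * σ - (1 - P) * (1 - Q) := by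
    apply le_of_sq_le_sq _ (by linarith)
    have c1 : (4 * (p 1 * q 1 + p 2 * q 2)) ^ 2
        ≤ (4 * (p 1 ^ 2 + p 2 ^ 2)) * (4 * (q 1 ^ 2 + q 2 ^ 2)) := by
      linarith [sq_nonneg (p 1 * q 2 - p 2 * q 1)]
    rw [ep, eq] at c1
    refine c1.trans ?_
    linarith [sq_nonneg (τ * (1 - Q) - σ * (1 - P))]
  have e2 : (1 + P) * (1 + Q) - 4 * (p 0 * q 0)
      = τ * σ * (Real.cosh ρ ^ 2 + Real.sinh ρ ^ 2) := by
    rw [hτ, hσ]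
    linear_combination (-2 * q 0) * p0 - τ * Real.sinh ρ * q0
  have h1 : 1 ≤ Real.cosh ρ ^ 2 + Real.sinh ρ ^ 2 := by nlinarith [sq_nonneg (Real.sinh ρ)]
  linarith [mul_nonneg (sub_nonneg.2 hprod) (sub_nonneg.2 h1)]

/-- For a sphere orthogonal to the unit sphere, `‖c‖² = 1 + r²` turns the equation into `2⟨c, x⟩ = 1
+ ‖x‖²`, which is linear in the lift with normal `(c, 1)`. -/
lemma IsGeodesicPlane.exists_eq {P : Set E3} (hP : IsGeodesicPlane P) :
    ∃ M : E3 × ℝ, M ≠ 0 ∧ P = {x | x ∈ ball3 ∧ mink M (homLift x) = 0} := by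
  rcases hP with ⟨n, hn, rfl⟩ | ⟨c, r, hr, hc, rfl⟩
  · refine ⟨(n, 0), fun h => hn (congrArg Prod.fst h), ?_⟩
    ext x
    refine and_congr_right fun _ => ?_
    simp [mink, homLift, real_inner_smul_right]
  · refine ⟨(c, 1), fun h => one_ne_zero (congrArg Prod.snd h), ?_⟩
    ext x
    refine and_congr_right fun _ => ?_
    rw [← sq_eq_sq₀ (norm_nonneg _) hr.le, norm_sub_sq_real, hc]
    simp only [mink, homLift, real_inner_smul_right, real_inner_comm x c]
    constructor <;> intro h <;> linarith

lemma isGeodesicPlane_of_spacelike {N : E3 × ℝ} (hN : 0 < mink N N) :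
    IsGeodesicPlane {x | x ∈ ball3 ∧ mink N (homLift x) = 0} := by
  rw [mink_self] at hN
  rcases eq_or_ne N.2 0 with h | h
  · refine Or.inl ⟨N.1, ?_, ?_⟩
    · intro h0
      rw [h, h0] at hN
      simp at hN
    · ext x
      refine and_congr_right fun _ => ?_
      simp [mink, homLift, real_inner_smul_right, h]
  · have h2 : 0 < N.2 ^ 2 := by positivity
    have hr : 0 < (‖N.1‖ ^ 2 - N.2 ^ 2) / N.2 ^ 2 := by positivity
    refine Or.inr ⟨N.2⁻¹ • N.1, √((‖N.1‖ ^ 2 - N.2 ^ 2) / N.2 ^ 2), Real.sqrt_pos.2 hr, ?_, ?_⟩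
    · rw [norm_smul, mul_pow, norm_inv, Real.norm_eq_abs, inv_pow, sq_abs, Real.sq_sqrt hr.le]
      field_simp
      ring
    · ext x
      refine and_congr_right fun _ => ?_
      rw [← sq_eq_sq₀ (norm_nonneg _) (Real.sqrt_nonneg _), norm_sub_sq_real, Real.sq_sqrt hr.le,
        norm_smul, mul_pow, norm_inv, Real.norm_eq_abs, inv_pow, sq_abs]
      simp only [mink, homLift, real_inner_smul_right, real_inner_comm x N.1]
      field_simp
      constructor <;> intro h'
      · linear_combination (-N.2) * h'
      · refine mul_left_cancel₀ h ?_
        linear_combination -h'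

/-- The normal of the plane and `N` both annihilate the circle, so both are multiples of the same
vector. Hence the infimum in `circleDist` concerns a single pair of planes. -/
lemma IsUnitNormal.geodesicPlane_eq {N : E3 × ℝ} {C P : Set E3} (hN : IsUnitNormal N C)
    (hC : IsCircleAtInfinity C) (hP : IsGeodesicPlane P) (hPC : asymptoticBoundary P = C) :
    P = {x | x ∈ ball3 ∧ mink N (homLift x) = 0} := by
  obtain ⟨n, h, hn, hh, hCeq⟩ := hC
  obtain ⟨M, hM0, rfl⟩ := hP.exists_eq
  have hM : ∀ z ∈ sphereInf, inner ℝ n z = h → mink M (homLift z) = 0 := by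
    intro z hz hzn
    have hzC : z ∈ C := by rw [hCeq]; exact ⟨hz, hzn⟩
    rw [← hPC] at hzC
    exact closure_minimal (fun x hx => hx.2)
      (isClosed_eq (continuous_mink_homLift M) continuous_const) hzC.1
  have hN' : ∀ z ∈ sphereInf, inner ℝ n z = h → mink N (homLift z) = 0 := by
    intro z hz hzn
    have hzC : z ∈ C := by rw [hCeq]; exact ⟨hz, hzn⟩
    rw [hN.circle] at hzC
    exact hzC.2
  have e1 := eq_smul_of_circle_subset hn hh hM
  have e2 := eq_smul_of_circle_subset hn hh hN'
  have c1 : inner ℝ M.1 n ≠ (0 : ℝ) := fun h0 => hM0 (by rw [e1, h0, zero_smul])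
  have c2 : inner ℝ N.1 n ≠ (0 : ℝ) := by
    intro h0
    have hu := hN.unit
    rw [e2, h0, zero_smul] at hu
    simp [mink] at hu
  ext x
  refine and_congr_right fun _ => ?_
  rw [e1, e2, mink_smul_left, mink_smul_left, mul_eq_zero, mul_eq_zero]
  simp [c1, c2]

/-- Disjoint circles at infinity are the boundary of the spherical catenoids whose planes
have the same half distance. -/
theorem exists_catenoid_of_disjoint {C₁ C₂ : Set E3} (h₁ : IsCircleAtInfinity C₁)
    (h₂ : IsCircleAtInfinity C₂) (hd : Disjoint C₁ C₂) :
    ∃ ρ : ℝ, 0 < ρ ∧ 2 * ρ ≤ circleDist C₁ C₂ ∧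
      ∀ a : ℝ, 0 < a → Tendsto (catX a) atTop (𝓝 ρ) →
        ∃ S : Set E3, IsSphericalMinimalCatenoid S ∧ asymptoticBoundary S = C₁ ∪ C₂ := by
  obtain ⟨N₁, N₂, u₁, u₂, hm, ht⟩ := exists_normals h₁ h₂ hd
  have hρ : 0 < Real.arcosh (mink N₁ N₂) / 2 := div_pos (Real.arcosh_pos hm) two_pos
  refine ⟨Real.arcosh (mink N₁ N₂) / 2, hρ, ?_⟩
  set ρ := Real.arcosh (mink N₁ N₂) / 2 with hρdef
  have hcosh : mink N₁ N₂ = Real.cosh (2 * ρ) := by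
    rw [hρdef, mul_div_cancel₀ _ two_ne_zero, Real.cosh_arcosh hm.le]
  obtain ⟨L, hL₁, hL₂⟩ := exists_lorentzIso u₁.unit u₂.unit hρ hcosh ht
  -- These planes make the set in `circleDist` nonempty; the infimum of the empty set would be `0`
  -- and the lower bound `2ρ` would fail.
  have hplane : ∀ (r : ℝ) (N : E3 × ℝ) (C : Set E3), L.toEquiv (axisNormal r) = N →
      IsUnitNormal N C → ∃ P : Set E3, IsGeodesicPlane P ∧ asymptoticBoundary P = C ∧
        P.Nonempty := by
    intro r N C hN hu
    refine ⟨L.ballMap '' {z | z ∈ ball3 ∧ mink (axisNormal r) (homLift z) = 0}, ?_, ?_, ?_⟩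
    · rw [L.ballMap_image_plane, hN]
      exact isGeodesicPlane_of_spacelike (by rw [hu.unit]; exact one_pos)
    · rw [L.asymptoticBoundary_ballMap_image (fun z hz => hz.1), asymptoticBoundary_axis_plane,
        L.ballMap_image_null, hN, ← hu.circle]
    · exact Nonempty.image _ ⟨_, ballPoint_mem_axis_plane r 0 0⟩
  constructor
  · obtain ⟨P₁, g₁, b₁, x₁, hx₁⟩ := hplane ρ N₁ C₁ hL₁ u₁
    obtain ⟨P₂, g₂, b₂, x₂, hx₂⟩ := hplane (-ρ) N₂ C₂ hL₂ u₂
    refine le_csInf ⟨_, P₁, P₂, g₁, b₁, g₂, b₂, x₁, hx₁, x₂, hx₂, rfl⟩ ?_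
    rintro d ⟨Q₁, Q₂, q₁, c₁, q₂, c₂, p, hp, q, hq, rfl⟩
    rw [u₁.geodesicPlane_eq h₁ q₁ c₁, ← hL₁, ← L.ballMap_image_plane] at hp
    rw [u₂.geodesicPlane_eq h₂ q₂ c₂, ← hL₂, ← L.ballMap_image_plane] at hq
    obtain ⟨p', hp', rfl⟩ := hp
    obtain ⟨q', hq', rfl⟩ := hq
    rw [L.isHypIsometry_ballMap.2 p' hp'.1 q' hq'.1]
    exact two_mul_le_hypDist_axis hρ hp'.1 hq'.1 hp'.2 hq'.2
  · intro a ha hlim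
    refine ⟨range fun p => L.ballMap (catenoidParam a p),
      ⟨a, L.ballMap, ha, L.isHypIsometry_ballMap, rfl, isMinimalImmersion_catenoid ha L,
        isSurfaceOfRevolution_catenoid L ha⟩, ?_⟩
    rw [show (range fun p => L.ballMap (catenoidParam a p)) = L.ballMap '' range (catenoidParam a)
      from range_comp L.ballMap (catenoidParam a), L.asymptoticBoundary_ballMap_image
      (range_subset_iff.2 (catenoidParam_mem_ball a)), asymptoticBoundary_catenoid ha hlim,
      image_union, L.ballMap_image_null, L.ballMap_image_null, hL₁, hL₂, ← u₁.circle, ← u₂.circle]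

/-! ### The Gomes function as an integral with a parameter `k = 1 / cosh (2a)` -/

lemma integrableOn_cosh_rpow {p : ℝ} (hp : 0 < p) :
    IntegrableOn (fun u => Real.cosh u ^ (-p)) (Ioi 0) := by
  have hc : Continuous fun u => Real.cosh u ^ (-p) :=
    Real.continuous_cosh.rpow_const fun u => Or.inl (Real.cosh_pos u).ne'
  refine ((exp_neg_integrableOn_Ioi 0 hp).const_mul ((2 : ℝ) ^ p)).mono'
    hc.aestronglyMeasurable (.of_forall fun u => ?_)
  rw [Real.norm_eq_abs, abs_of_pos (Real.rpow_pos_of_pos (Real.cosh_pos u) _)]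
  have h1 : Real.exp u / 2 ≤ Real.cosh u := by
    rw [Real.cosh_eq]; linarith [Real.exp_pos (-u)]
  calc Real.cosh u ^ (-p) ≤ (Real.exp u / 2) ^ (-p) :=
        Real.rpow_le_rpow_of_nonpos (by positivity) h1 (by linarith)
    _ = 2 ^ p * Real.exp (-p * u) := by
        rw [Real.div_rpow (Real.exp_pos u).le zero_le_two, Real.rpow_neg zero_le_two, div_inv_eq_mul,
          ← Real.exp_mul, mul_comm, mul_comm u]

/-- The integrand of the Gomes function in the variable `u` with `cosh (2t) = cosh (2a) cosh u`. -/
def gomesKernel (k u : ℝ) : ℝ := √(k * (1 - k ^ 2)) / ((Real.cosh u + k) * √(Real.cosh u - k))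

/-- The Gomes function in terms of `k = 1 / cosh (2a)`. -/
def gomesOf (k : ℝ) : ℝ := (√2)⁻¹ * ∫ u in Ioi 0, gomesKernel k u

lemma measurable_gomesKernel (k : ℝ) : Measurable (gomesKernel k) := by
  have := Real.measurable_cosh
  unfold gomesKernel
  fun_prop

lemma gomesKernel_nonneg {k : ℝ} (hk : k ∈ Icc (0 : ℝ) 1) (u : ℝ) : 0 ≤ gomesKernel k u := by
  have := Real.cosh_pos u
  have := hk.1
  unfold gomesKernel
  positivity

/-- The bound is uniform up to `k = 1`, because `k (1 - k²) ≤ 2 (1 - k) ≤ 2 (cosh u - k)`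
compensates the singularity at `u = 0`. It gives continuity at both endpoints, hence the limits of
`ϱ` at `0` and `∞`. -/
lemma gomesKernel_le {k : ℝ} (hk : k ∈ Icc (0 : ℝ) 1) (u : ℝ) :
    gomesKernel k u ≤ √2 * Real.cosh u ^ (-1 : ℝ) := by
  have hc := Real.one_le_cosh u
  have hc0 := Real.cosh_pos u
  obtain ⟨hk0, hk1⟩ := hk
  rw [Real.rpow_neg_one, gomesKernel]
  rcases (sub_nonneg.2 (hk1.trans hc)).eq_or_lt with h | h
  · rw [← h, Real.sqrt_zero, mul_zero, div_zero]
    positivity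
  · have h1 : √(k * (1 - k ^ 2)) ≤ √2 * √(Real.cosh u - k) := by
      rw [← Real.sqrt_mul zero_le_two]
      apply Real.sqrt_le_sqrt
      have : k * (1 + k) ≤ 2 := by nlinarith
      nlinarith [mul_le_mul_of_nonneg_right this (sub_nonneg.2 hk1)]
    have h2 := Real.sqrt_pos.2 h
    rw [div_le_iff₀ (by positivity)]
    calc √(k * (1 - k ^ 2)) ≤ √2 * √(Real.cosh u - k) := h1
      _ = √2 * (Real.cosh u)⁻¹ * (Real.cosh u * √(Real.cosh u - k)) := by field_simp
      _ ≤ √2 * (Real.cosh u)⁻¹ * ((Real.cosh u + k) * √(Real.cosh u - k)) := by gcongr; linarith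

lemma integrableOn_gomesKernel {k : ℝ} (hk : k ∈ Icc (0 : ℝ) 1) :
    IntegrableOn (gomesKernel k) (Ioi 0) :=
  ((integrableOn_cosh_rpow one_pos).const_mul √2).mono'
    (measurable_gomesKernel k).aestronglyMeasurable (.of_forall fun u => by
      rw [Real.norm_eq_abs, abs_of_nonneg (gomesKernel_nonneg hk u)]
      exact gomesKernel_le hk u)

lemma continuousOn_gomesOf : ContinuousOn gomesOf (Icc 0 1) := by
  refine continuousOn_const.mul (continuousOn_of_dominated
    (bound := fun u => √2 * Real.cosh u ^ (-1 : ℝ))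
    (fun k _ => (measurable_gomesKernel k).aestronglyMeasurable) (fun k hk => .of_forall fun u => ?_)
    ((integrableOn_cosh_rpow one_pos).const_mul √2) ?_)
  · rw [Real.norm_eq_abs, abs_of_nonneg (gomesKernel_nonneg hk u)]
    exact gomesKernel_le hk u
  · refine (ae_restrict_iff' measurableSet_Ioi).2 (.of_forall fun u hu => ?_)
    have hu' : 1 < Real.cosh u := Real.one_lt_cosh.2 (ne_of_gt hu)
    unfold gomesKernel
    refine ContinuousOn.div (by fun_prop) (by fun_prop) fun k hk => ?_
    have h1 : 0 < Real.cosh u - k := by linarith [hk.2]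
    have h2 := Real.sqrt_pos.2 h1
    have h3 := hk.1
    positivity

lemma gomesOf_zero : gomesOf 0 = 0 := by simp [gomesOf, gomesKernel]

lemma gomesOf_one : gomesOf 1 = 0 := by simp [gomesOf, gomesKernel]

/-! ### The Gomes integral as the total axial displacement of the catenary -/

section Substitution

variable {a : ℝ} (ha : 0 < a)

include ha in
lemma inv_cosh_mem : (Real.cosh (2 * a))⁻¹ ∈ Ioo (0 : ℝ) 1 :=
  ⟨inv_pos.2 (Real.cosh_pos _), inv_lt_one_of_one_lt₀ (one_lt_cosh_two_mul ha)⟩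

-- For `k = 1 / cosh (2a)` and `u = 2s`, `cosh u ± k = (cosh (2y) ± 1) / cosh (2a)`. The result is
-- half of `dx/ds`, and the Jacobian of `u = 2s` restores the factor `2`.
include ha in
lemma gomesKernel_eq (s : ℝ) : (√2)⁻¹ * gomesKernel (Real.cosh (2 * a))⁻¹ (2 * s)
    = 2⁻¹ * (Real.sinh (2 * a) / (2 * Real.sinh (catY a s) * Real.cosh (catY a s) ^ 2)) := by
  have hS : 0 < Real.sinh (catY a s) := Real.sinh_pos_iff.2 (catY_pos ha s)
  have hC : 0 < Real.cosh (catY a s) := Real.cosh_pos _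
  have hA : 0 < Real.cosh (2 * a) := Real.cosh_pos _
  have hs : 0 < Real.sinh (2 * a) := Real.sinh_pos_iff.2 (by positivity)
  have h1 := cosh_two_mul_catY ha s
  rw [Real.cosh_two_mul (catY a s)] at h1
  have h2 := Real.cosh_sq (catY a s)
  have h3 := Real.cosh_sq (2 * a)
  have hq : √(Real.cosh (2 * a)) ^ 2 = Real.cosh (2 * a) := Real.sq_sqrt hA.le
  have hq0 : 0 < √(Real.cosh (2 * a)) := Real.sqrt_pos.2 hA
  have e1 : √((Real.cosh (2 * a))⁻¹ * (1 - (Real.cosh (2 * a))⁻¹ ^ 2))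
      = Real.sinh (2 * a) / (Real.cosh (2 * a) * √(Real.cosh (2 * a))) := by
    rw [Real.sqrt_eq_iff_mul_self_eq_of_pos (by positivity)]
    have : (Real.sinh (2 * a) / (Real.cosh (2 * a) * √(Real.cosh (2 * a)))) ^ 2
      = Real.sinh (2 * a) ^ 2 / (Real.cosh (2 * a) ^ 2 * √(Real.cosh (2 * a)) ^ 2) := by ring
    rw [← sq, this, hq]
    field_simp
    linarith
  have e2 : √(Real.cosh (2 * s) - (Real.cosh (2 * a))⁻¹)
      = √2 * Real.sinh (catY a s) / √(Real.cosh (2 * a)) := by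
    have : Real.cosh (2 * s) - (Real.cosh (2 * a))⁻¹
        = 2 * Real.sinh (catY a s) ^ 2 / Real.cosh (2 * a) := by
      field_simp; linarith
    rw [this, Real.sqrt_div (by positivity), Real.sqrt_mul zero_le_two, Real.sqrt_sq hS.le]
  have e3 : Real.cosh (2 * s) + (Real.cosh (2 * a))⁻¹
      = 2 * Real.cosh (catY a s) ^ 2 / Real.cosh (2 * a) := by
    field_simp; linarith
  rw [gomesKernel, e1, e2, e3]
  have h5 : √2 ^ 2 = (2 : ℝ) := Real.sq_sqrt zero_le_two
  field_simp
  rw [h5]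

lemma catY_image (ha : 0 < a) : catY a '' Ioi 0 = Ioi a := by
  have hA : 0 < Real.cosh (2 * a) := Real.cosh_pos _
  ext t
  constructor
  · rintro ⟨s, hs, rfl⟩
    have h := cosh_two_mul_catY ha s
    have h1 : 1 < Real.cosh (2 * s) := Real.one_lt_cosh.2 (by have : 0 < s := hs; positivity)
    have h2 : Real.cosh (2 * a) < Real.cosh (2 * catY a s) := by rw [h]; nlinarith
    rw [Real.cosh_lt_cosh, abs_of_pos (by positivity), abs_of_pos (by linarith [catY_pos ha s])] at h2
    rw [mem_Ioi]
    linarith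
  · intro ht
    rw [mem_Ioi] at ht
    have h1 : Real.cosh (2 * a) < Real.cosh (2 * t) := by
      rw [Real.cosh_lt_cosh, abs_of_pos (by positivity), abs_of_pos (by linarith)]
      linarith
    have h2 : 1 < Real.cosh (2 * t) / Real.cosh (2 * a) := by rwa [one_lt_div hA]
    refine ⟨Real.arcosh (Real.cosh (2 * t) / Real.cosh (2 * a)) / 2,
      div_pos (Real.arcosh_pos h2) two_pos, ?_⟩
    rw [catY, mul_div_cancel₀ _ two_ne_zero, Real.cosh_arcosh h2.le, mul_div_cancel₀ _ hA.ne',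
      Real.arcosh_cosh (by linarith)]
    ring

lemma catY_injOn (ha : 0 < a) : InjOn (catY a) (Ioi 0) := by
  intro s hs t ht h
  have h1 := cosh_two_mul_catY ha s
  rw [h, cosh_two_mul_catY ha t] at h1
  have h2 := mul_left_cancel₀ (Real.cosh_pos (2 * a)).ne' h1
  have h3 := Real.cosh_strictMonoOn.injOn (x₁ := 2 * t) (x₂ := 2 * s)
    (by have : 0 < t := ht; rw [mem_Ici]; positivity)
    (by have : 0 < s := hs; rw [mem_Ici]; positivity) h2
  linarith

/-- Under `t = y(a, s)` the square root becomes `cosh (2a) sinh (2s)`, the numerator of `dy/ds`; the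
cancellation leaves `dx/ds`. -/
lemma abs_deriv_catY_mul (ha : 0 < a) {s : ℝ} (hs : s ∈ Ioi (0 : ℝ)) :
    |Real.cosh (2 * a) * Real.sinh (2 * s) / Real.sinh (2 * catY a s)| • gomesIntegrand a (catY a s)
      = Real.sinh (2 * a) / (2 * Real.sinh (catY a s) * Real.cosh (catY a s) ^ 2) := by
  have hs' : 0 < Real.sinh (2 * s) := Real.sinh_pos_iff.2 (by have : 0 < s := hs; positivity)
  have hA : 0 < Real.cosh (2 * a) := Real.cosh_pos _
  have hS : 0 < Real.sinh (catY a s) := Real.sinh_pos_iff.2 (catY_pos ha s)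
  have hC : 0 < Real.cosh (catY a s) := Real.cosh_pos _
  have e1 : Real.sinh (2 * catY a s) ^ 2 - Real.sinh (2 * a) ^ 2
      = (Real.cosh (2 * a) * Real.sinh (2 * s)) ^ 2 := by
    rw [Real.sinh_sq, Real.sinh_sq, cosh_two_mul_catY ha, mul_pow, mul_pow, Real.sinh_sq (2 * s)]
    ring
  have hS2 : Real.sinh (2 * catY a s) = 2 * Real.sinh (catY a s) * Real.cosh (catY a s) :=
    Real.sinh_two_mul _
  rw [gomesIntegrand, e1, Real.sqrt_sq (by positivity), hS2, abs_of_pos (by positivity), smul_eq_mul]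
  field_simp

lemma integrableOn_catX_deriv (ha : 0 < a) : IntegrableOn (fun s =>
    Real.sinh (2 * a) / (2 * Real.sinh (catY a s) * Real.cosh (catY a s) ^ 2)) (Ioi 0) := by
  have h1 := (integrableOn_gomesKernel (Ioo_subset_Icc_self (inv_cosh_mem ha))).const_mul (√2)⁻¹
  have h2 := (integrableOn_Ioi_comp_mul_left_iff
    (fun u => (√2)⁻¹ * gomesKernel (Real.cosh (2 * a))⁻¹ u) 0 two_pos).2 (by rwa [mul_zero])
  simp only [gomesKernel_eq ha] at h2
  exact (h2.const_mul 2).congr (.of_forall fun s => by simp only; ring)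

lemma integral_catX_deriv (ha : 0 < a) : ∫ s in Ioi 0,
    Real.sinh (2 * a) / (2 * Real.sinh (catY a s) * Real.cosh (catY a s) ^ 2)
    = gomesOf (Real.cosh (2 * a))⁻¹ := by
  have h := integral_comp_mul_left_Ioi (fun u => (√2)⁻¹ * gomesKernel (Real.cosh (2 * a))⁻¹ u) 0
    two_pos
  simp only [gomesKernel_eq ha, mul_zero, integral_const_mul, smul_eq_mul] at h
  exact mul_left_cancel₀ (by norm_num) h

theorem integrableOn_gomesIntegrand (ha : 0 < a) : IntegrableOn (gomesIntegrand a) (Ioi a) := by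
  rw [← catY_image ha, integrableOn_image_iff_integrableOn_abs_deriv_smul measurableSet_Ioi
    (fun s _ => (hasDerivAt_catY ha s).hasDerivWithinAt) (catY_injOn ha)]
  exact (integrableOn_catX_deriv ha).congr_fun (fun s hs => (abs_deriv_catY_mul ha hs).symm)
    measurableSet_Ioi

theorem gomes_eq (ha : 0 < a) : gomes a = gomesOf (Real.cosh (2 * a))⁻¹ := by
  rw [gomes, ← integral_catX_deriv ha, ← catY_image ha, integral_image_eq_integral_abs_deriv_smul
    measurableSet_Ioi (fun s _ => (hasDerivAt_catY ha s).hasDerivWithinAt) (catY_injOn ha)]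
  exact setIntegral_congr_fun measurableSet_Ioi (fun s hs => abs_deriv_catY_mul ha hs)

theorem tendsto_catX (ha : 0 < a) : Tendsto (catX a) atTop (𝓝 (gomes a)) := by
  rw [gomes_eq ha, ← integral_catX_deriv ha]
  refine (intervalIntegral_tendsto_integral_Ioi 0 (integrableOn_catX_deriv ha) tendsto_id).congr
    fun s => ?_
  simp only [id, ← catX_integrand ha, intervalIntegral.integral_const_mul]
  rfl

end Substitution

lemma gomes_zero : gomes 0 = 0 := by simp [gomes, gomesIntegrand]

lemma gomes_eq_of_nonneg {a : ℝ} (ha : 0 ≤ a) : gomes a = gomesOf (Real.cosh (2 * a))⁻¹ := by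
  rcases ha.eq_or_lt with rfl | ha
  · simp [gomes_zero, gomesOf_one]
  · exact gomes_eq ha

lemma inv_cosh_mem_Icc (a : ℝ) : (Real.cosh (2 * a))⁻¹ ∈ Icc (0 : ℝ) 1 :=
  ⟨(inv_pos.2 (Real.cosh_pos _)).le, inv_le_one_of_one_le₀ (Real.one_le_cosh _)⟩

lemma continuous_inv_cosh : Continuous fun a : ℝ => (Real.cosh (2 * a))⁻¹ :=
  (Real.continuous_cosh.comp (continuous_const.mul continuous_id)).inv₀
    fun _ => (Real.cosh_pos _).ne'

lemma continuousOn_gomes : ContinuousOn gomes (Ici 0) :=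
  (continuousOn_gomesOf.comp continuous_inv_cosh.continuousOn fun _ _ => inv_cosh_mem_Icc _).congr
    fun _ ha => gomes_eq_of_nonneg ha

lemma tendsto_gomes_zero : Tendsto gomes (𝓝[>] 0) (𝓝 0) := by
  have h := (continuousOn_gomes 0 self_mem_Ici).mono Ioi_subset_Ici_self
  rwa [ContinuousWithinAt, gomes_zero] at h

lemma tendsto_gomes_atTop : Tendsto gomes atTop (𝓝 0) := by
  have h1 : Tendsto (fun a : ℝ => (Real.cosh (2 * a))⁻¹) atTop (𝓝[Icc 0 1] 0) :=
    tendsto_nhdsWithin_iff.2 ⟨tendsto_inv_cosh (tendsto_id.const_mul_atTop two_pos),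
      .of_forall inv_cosh_mem_Icc⟩
  have h2 := (continuousOn_gomesOf 0 ⟨le_rfl, zero_le_one⟩).tendsto.comp h1
  rw [gomesOf_zero] at h2
  refine h2.congr' ?_
  filter_upwards [eventually_ge_atTop 0] with a ha
  exact (gomes_eq_of_nonneg ha).symm

/-! ### The derivative of the Gomes function -/

/-- The integrand of the Gomes function without the factor that depends on `k` only. -/
def gomesCore (k u : ℝ) : ℝ := ((Real.cosh u + k) * √(Real.cosh u - k))⁻¹

/-- The `k`-derivative of `gomesCore`. -/
def gomesCoreDeriv (k u : ℝ) : ℝ :=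
  gomesCore k u * (-(Real.cosh u + k)⁻¹ + (2 * (Real.cosh u - k))⁻¹)

/-- The integrand of `gomesSlope`. -/
def slopeKernel (k u : ℝ) : ℝ :=
  Real.cosh u / √(Real.cosh u - k) - √(Real.cosh u) - (Real.cosh u * √(Real.cosh u))⁻¹

/-- The derivative of `gomesOf` is a negative multiple of this function. -/
def gomesSlope (k : ℝ) : ℝ := ∫ u in Ioi 0, slopeKernel k u

lemma measurable_gomesCore (k : ℝ) : Measurable (gomesCore k) := by
  have := Real.measurable_cosh
  unfold gomesCore
  fun_prop

lemma measurable_gomesCoreDeriv (k : ℝ) : Measurable (gomesCoreDeriv k) := by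
  have := Real.measurable_cosh
  have := measurable_gomesCore k
  unfold gomesCoreDeriv
  fun_prop

lemma measurable_slopeKernel (k : ℝ) : Measurable (slopeKernel k) := by
  have := Real.measurable_cosh
  unfold slopeKernel
  fun_prop

lemma hasDerivAt_gomesCore {k u : ℝ} (hk : k ∈ Ioo (0 : ℝ) 1) :
    HasDerivAt (fun k => gomesCore k u) (gomesCoreDeriv k u) k := by
  have hc := Real.one_le_cosh u
  have h1 : 0 < Real.cosh u + k := by linarith [hk.1]
  have h2 : 0 < Real.cosh u - k := by linarith [hk.2]
  have h3 := Real.sqrt_pos.2 h2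
  have h := (((hasDerivAt_id k).const_add (Real.cosh u)).mul
    (((hasDerivAt_id k).const_sub (Real.cosh u)).sqrt h2.ne')).inv
    (by simp only [id, Pi.mul_apply]; positivity)
  refine h.congr_deriv ?_
  have hq := Real.sq_sqrt h2.le
  simp only [id, Pi.mul_apply, gomesCoreDeriv, gomesCore]
  have hk' : k = Real.cosh u - √(Real.cosh u - k) ^ 2 := by linarith
  generalize √(Real.cosh u - k) = q at *
  generalize Real.cosh u = c at *
  subst hk'
  have e1 : c - (c - q ^ 2) = q ^ 2 := by ring
  rw [e1]
  field_simp
  ring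

lemma gomesCore_le {k b u : ℝ} (hk : k ∈ Ioo (0 : ℝ) b) (hb : b < 1) :
    gomesCore k u ≤ (√(1 - b))⁻¹ * Real.cosh u ^ (-1 : ℝ) := by
  have hc := Real.one_le_cosh u
  have hc0 := Real.cosh_pos u
  have h1 : 0 < 1 - b := by linarith
  have h2 := Real.sqrt_pos.2 h1
  have h3 : √(1 - b) ≤ √(Real.cosh u - k) := Real.sqrt_le_sqrt (by linarith [hk.2])
  rw [gomesCore, Real.rpow_neg_one, ← mul_inv, mul_comm]
  gcongr
  linarith [hk.1]

lemma gomesCore_pos {k u : ℝ} (hk : k ∈ Ioo (0 : ℝ) 1) : 0 < gomesCore k u := by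
  have hc := Real.one_le_cosh u
  have h1 : 0 < Real.cosh u + k := by linarith [hk.1]
  have h3 := Real.sqrt_pos.2 (show 0 < Real.cosh u - k by linarith [hk.2])
  unfold gomesCore
  positivity

lemma abs_gomesCoreDeriv_le {k b u : ℝ} (hk : k ∈ Ioo (0 : ℝ) b) (hb : b < 1) :
    |gomesCoreDeriv k u| ≤ (1 + (2 * (1 - b))⁻¹) * ((√(1 - b))⁻¹ * Real.cosh u ^ (-1 : ℝ)) := by
  have hc := Real.one_le_cosh u
  have hp := gomesCore_pos (u := u) ⟨hk.1, hk.2.trans hb⟩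
  have h0 : 0 < 1 - b := by linarith
  have h1 : (Real.cosh u + k)⁻¹ ≤ 1 := inv_le_one_of_one_le₀ (by linarith [hk.1])
  have h2 : (2 * (Real.cosh u - k))⁻¹ ≤ (2 * (1 - b))⁻¹ := by gcongr; linarith [hk.2]
  have h3 : 0 < Real.cosh u + k := by linarith [hk.1]
  have h4 : 0 < Real.cosh u - k := by linarith [hk.2]
  rw [gomesCoreDeriv, abs_mul, abs_of_pos hp, mul_comm]
  refine mul_le_mul ?_ (gomesCore_le hk hb) hp.le (by positivity)
  refine (abs_add_le _ _).trans (add_le_add ?_ ?_)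
  · rw [abs_neg, abs_of_pos (by positivity)]; exact h1
  · rw [abs_of_pos (by positivity)]; exact h2

lemma hasDerivAt_integral_gomesCore {k : ℝ} (hk : k ∈ Ioo (0 : ℝ) 1) :
    IntegrableOn (gomesCore k) (Ioi 0) ∧ IntegrableOn (gomesCoreDeriv k) (Ioi 0) ∧
    HasDerivAt (fun k => ∫ u in Ioi 0, gomesCore k u) (∫ u in Ioi 0, gomesCoreDeriv k u) k := by
  obtain ⟨b, hkb, hb⟩ := exists_between hk.2
  have hkb' : k ∈ Ioo 0 b := ⟨hk.1, hkb⟩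
  have hsub : ∀ x ∈ Ioo 0 b, x ∈ Ioo (0 : ℝ) 1 := fun x hx => ⟨hx.1, hx.2.trans hb⟩
  have hi : IntegrableOn (gomesCore k) (Ioi 0) :=
    ((integrableOn_cosh_rpow one_pos).const_mul _).mono'
      (measurable_gomesCore k).aestronglyMeasurable (.of_forall fun u => by
        rw [Real.norm_eq_abs, abs_of_pos (gomesCore_pos hk)]
        exact gomesCore_le hkb' hb)
  have h := hasDerivAt_integral_of_dominated_loc_of_deriv_le (μ := volume.restrict (Ioi 0))
    (F := gomesCore) (F' := gomesCoreDeriv) (x₀ := k) (Ioo_mem_nhds hk.1 hkb)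
    (.of_forall fun x => (measurable_gomesCore x).aestronglyMeasurable) hi
    (measurable_gomesCoreDeriv k).aestronglyMeasurable
    (.of_forall fun u x hx => abs_gomesCoreDeriv_le hx hb)
    (((integrableOn_cosh_rpow one_pos).const_mul _).const_mul _)
    (.of_forall fun u x hx => hasDerivAt_gomesCore (hsub x hx))
  exact ⟨hi, h.1, h.2⟩

/-- The two terms grow like `√(cosh u)`, but their difference decays: with `r = √(cosh u)` and `q =
√(cosh u - k)` it equals `r (r - q) / q`, and `r (r - q) ≤ r² - q² = k`. -/
lemma slope_bound {k u : ℝ} (hk : k ∈ Ioo (0 : ℝ) 1) :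
    0 ≤ Real.cosh u / √(Real.cosh u - k) - √(Real.cosh u) ∧
    Real.cosh u / √(Real.cosh u - k) - √(Real.cosh u)
      ≤ (√(1 - k))⁻¹ * Real.cosh u ^ (-(1 / 2) : ℝ) := by
  have hc := Real.one_le_cosh u
  have hc0 := Real.cosh_pos u
  obtain ⟨h0, h1⟩ := hk
  have h2 : 0 < Real.cosh u - k := by linarith
  have h3 : 0 < 1 - k := by linarith
  have hq := Real.sqrt_pos.2 h2
  have hr := Real.sqrt_pos.2 hc0
  have hq2 := Real.sq_sqrt h2.le
  have hr2 := Real.sq_sqrt hc0.le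
  have hqr : √(Real.cosh u - k) ≤ √(Real.cosh u) := Real.sqrt_le_sqrt (by linarith)
  have e : Real.cosh u / √(Real.cosh u - k) - √(Real.cosh u)
      = √(Real.cosh u) * (√(Real.cosh u) - √(Real.cosh u - k)) / √(Real.cosh u - k) := by
    field_simp
    linear_combination -hr2
  rw [e]
  refine ⟨div_nonneg (mul_nonneg hr.le (by linarith)) hq.le, ?_⟩
  have h4 : √(1 - k) * √(Real.cosh u) ≤ √(Real.cosh u - k) := by
    rw [← Real.sqrt_mul h3.le]
    apply Real.sqrt_le_sqrt
    nlinarith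
  have h5 : √(Real.cosh u) * (√(Real.cosh u) - √(Real.cosh u - k)) ≤ 1 := by nlinarith
  have h6 := Real.sqrt_pos.2 h3
  rw [Real.rpow_neg hc0.le, ← Real.sqrt_eq_rpow, ← mul_inv]
  calc _ ≤ 1 / √(Real.cosh u - k) := by gcongr
    _ ≤ 1 / (√(1 - k) * √(Real.cosh u)) := by gcongr
    _ = _ := one_div _

lemma inv_cosh_mul_sqrt (u : ℝ) :
    (Real.cosh u * √(Real.cosh u))⁻¹ = Real.cosh u ^ (-(3 / 2) : ℝ) := by
  have hc0 := Real.cosh_pos u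
  rw [Real.rpow_neg hc0.le, Real.sqrt_eq_rpow, ← Real.rpow_one_add' hc0.le (by norm_num)]
  norm_num

lemma integrableOn_slopeKernel {k : ℝ} (hk : k ∈ Ioo (0 : ℝ) 1) :
    IntegrableOn (slopeKernel k) (Ioi 0) := by
  refine (((integrableOn_cosh_rpow (p := 1 / 2) (by norm_num)).const_mul (√(1 - k))⁻¹).add
    (integrableOn_cosh_rpow (p := 3 / 2) (by norm_num))).mono'
    (measurable_slopeKernel k).aestronglyMeasurable (.of_forall fun u => ?_)
  have h := slope_bound (u := u) hk
  have h2 : 0 < Real.cosh u ^ (-(3 / 2) : ℝ) := Real.rpow_pos_of_pos (Real.cosh_pos u) _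
  rw [slopeKernel, inv_cosh_mul_sqrt, Pi.add_apply, Real.norm_eq_abs, abs_le]
  constructor <;> linarith [h.1, h.2]

/-- The exact part of the `k`-derivative. -/
def slopePrimitive (k u : ℝ) : ℝ :=
  2 * (Real.sinh u * Real.cosh u / ((Real.cosh u + k) * √(Real.cosh u - k)))
    - 2 * (Real.sinh u / √(Real.cosh u))

/-- With `P = k (1 - k²)`, the first two terms are `P' core + 2 P core'`, the integrand of the
derivative of `√P ∫ core` up to the factor `2√P`. They differ from `-slopeKernel` by an exact
derivative; the term `-2 sinh u / √(cosh u)` in the primitive removes its growth, so no boundary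
terms survive. -/
lemma hasDerivAt_slopePrimitive {k : ℝ} (hk : k ∈ Ioo (0 : ℝ) 1) (u : ℝ) :
    HasDerivAt (slopePrimitive k) ((1 - 3 * k ^ 2) * gomesCore k u
      + 2 * (k * (1 - k ^ 2)) * gomesCoreDeriv k u + slopeKernel k u) u := by
  have hc := Real.one_le_cosh u
  have hc0 := Real.cosh_pos u
  have h1 : 0 < Real.cosh u + k := by linarith [hk.1]
  have h2 : 0 < Real.cosh u - k := by linarith [hk.2]
  have hq := Real.sqrt_pos.2 h2
  have hr := Real.sqrt_pos.2 hc0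
  have hq2 := Real.sq_sqrt h2.le
  have hr2 := Real.sq_sqrt hc0.le
  have ds := Real.hasDerivAt_sinh u
  have dc := Real.hasDerivAt_cosh u
  have h := (((ds.mul dc).div ((dc.add_const k).mul ((dc.sub_const k).sqrt h2.ne'))
    (by simp only [Pi.mul_apply]; positivity)).const_mul 2).sub
    ((ds.div (dc.sqrt hc0.ne') hr.ne').const_mul 2)
  refine h.congr_deriv ?_
  have hs := Real.sinh_sq u
  simp only [Pi.mul_apply, gomesCoreDeriv, gomesCore, slopeKernel]
  clear h ds dc
  generalize √(Real.cosh u - k) = q at *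
  generalize √(Real.cosh u) = r at *
  generalize Real.sinh u = s at *
  generalize Real.cosh u = c at *
  have hk' : k = r ^ 2 - q ^ 2 := by linarith
  have hcr : c = r ^ 2 := hr2.symm
  subst hcr
  subst hk'
  have e1 : r ^ 2 - (r ^ 2 - q ^ 2) = q ^ 2 := by ring
  have e2 : r ^ 2 + (r ^ 2 - q ^ 2) = 2 * r ^ 2 - q ^ 2 := by ring
  rw [e1, e2]
  rw [e2] at h1
  field_simp
  ring_nf
  rw [hs]
  ring

lemma abs_slopePrimitive_le {k : ℝ} (hk : k ∈ Ioo (0 : ℝ) 1) {u : ℝ} (hu : 0 ≤ u) :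
    |slopePrimitive k u| ≤ 2 / √(Real.cosh u - k) := by
  have hc := Real.one_le_cosh u
  have hc0 := Real.cosh_pos u
  obtain ⟨k0, k1⟩ := hk
  have h1 : 0 < Real.cosh u + k := by linarith
  have h2 : 0 < Real.cosh u - k := by linarith
  have hq := Real.sqrt_pos.2 h2
  have hr := Real.sqrt_pos.2 hc0
  have hq2 := Real.sq_sqrt h2.le
  have hr2 := Real.sq_sqrt hc0.le
  have hqr : √(Real.cosh u - k) ≤ √(Real.cosh u) := Real.sqrt_le_sqrt (by linarith)
  have hs0 : 0 ≤ Real.sinh u := Real.sinh_nonneg_iff.2 hu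
  have hs1 : Real.sinh u ≤ Real.cosh u := (Real.sinh_lt_cosh u).le
  rw [slopePrimitive]
  generalize √(Real.cosh u - k) = q at *
  generalize √(Real.cosh u) = r at *
  generalize Real.sinh u = s at *
  generalize Real.cosh u = c at *
  -- Writing `k = r² - q²` factors the difference; each of the first three factors is at most `1` in
  -- absolute value.
  have e : 2 * (s * c / ((c + k) * q)) - 2 * (s / r)
      = s / (c + k) * ((r ^ 2 - r * q - q ^ 2) / r ^ 2) * ((r - q) * r) * (2 / q) := by
    have hk' : k = r ^ 2 - q ^ 2 := by linarith
    have hcr : c = r ^ 2 := hr2.symm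
    subst hcr
    subst hk'
    field_simp
    ring
  have b1 : |s / (c + k)| ≤ 1 := by
    rw [abs_of_nonneg (by positivity), div_le_one h1]; linarith
  have b2 : |(r ^ 2 - r * q - q ^ 2) / r ^ 2| ≤ 1 := by
    rw [abs_div, abs_of_pos (by positivity : 0 < r ^ 2), div_le_one (by positivity), abs_le]
    constructor <;> nlinarith
  have b3 : |(r - q) * r| ≤ 1 := by
    rw [abs_of_nonneg (mul_nonneg (by linarith) hr.le)]; nlinarith
  rw [e, abs_mul, abs_mul, abs_mul, abs_of_pos (by positivity : 0 < 2 / q)]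
  have b4 := mul_le_one₀ (mul_le_one₀ b1 (abs_nonneg _) b2) (abs_nonneg _) b3
  calc _ ≤ 1 * (2 / q) := by gcongr
    _ = _ := one_mul _

lemma tendsto_slopePrimitive {k : ℝ} (hk : k ∈ Ioo (0 : ℝ) 1) :
    Tendsto (slopePrimitive k) atTop (𝓝 0) := by
  have h1 : Tendsto (fun u => 2 / √(Real.cosh u - k)) atTop (𝓝 0) :=
    (Real.tendsto_sqrt_atTop.comp
      (tendsto_atTop_add_const_right _ (-k) tendsto_cosh_atTop')).const_div_atTop 2
  refine squeeze_zero_norm' ?_ h1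
  filter_upwards [eventually_ge_atTop 0] with u hu
  exact abs_slopePrimitive_le hk hu

lemma integral_slope_identity {k : ℝ} (hk : k ∈ Ioo (0 : ℝ) 1) :
    (1 - 3 * k ^ 2) * (∫ u in Ioi 0, gomesCore k u)
      + 2 * (k * (1 - k ^ 2)) * (∫ u in Ioi 0, gomesCoreDeriv k u) + gomesSlope k = 0 := by
  obtain ⟨i1, i2, -⟩ := hasDerivAt_integral_gomesCore hk
  have i3 := integrableOn_slopeKernel hk
  have j1 : IntegrableOn (fun u => (1 - 3 * k ^ 2) * gomesCore k u) (Ioi 0) := i1.const_mul _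
  have j2 : IntegrableOn (fun u => 2 * (k * (1 - k ^ 2)) * gomesCoreDeriv k u) (Ioi 0) :=
    i2.const_mul _
  have j3 : IntegrableOn (fun u => (1 - 3 * k ^ 2) * gomesCore k u
      + 2 * (k * (1 - k ^ 2)) * gomesCoreDeriv k u) (Ioi 0) := j1.add j2
  have h := integral_Ioi_of_hasDerivAt_of_tendsto' (fun u _ => hasDerivAt_slopePrimitive hk u)
    (j3.add i3) (tendsto_slopePrimitive hk)
  rw [integral_add j3 i3, integral_add j1 j2, integral_const_mul, integral_const_mul] at h
  rw [gomesSlope, h]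
  simp [slopePrimitive]

lemma gomesOf_eq (k : ℝ) :
    gomesOf k = (√2)⁻¹ * (√(k * (1 - k ^ 2)) * ∫ u in Ioi 0, gomesCore k u) := by
  rw [gomesOf, ← integral_const_mul (√(k * (1 - k ^ 2)))]
  simp only [gomesKernel, gomesCore, div_eq_mul_inv]

theorem hasDerivAt_gomesOf {k : ℝ} (hk : k ∈ Ioo (0 : ℝ) 1) :
    HasDerivAt gomesOf (-((√2)⁻¹ * (2 * √(k * (1 - k ^ 2)))⁻¹ * gomesSlope k)) k := by
  have hP : 0 < k * (1 - k ^ 2) := mul_pos hk.1 (by nlinarith [hk.1, hk.2])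
  have hs := Real.sqrt_pos.2 hP
  have d1 : HasDerivAt (fun k : ℝ => k * (1 - k ^ 2)) (1 - 3 * k ^ 2) k := by
    refine ((hasDerivAt_id k).mul ((hasDerivAt_pow 2 k).const_sub 1)).congr_deriv ?_
    simp only [id]
    push_cast
    ring
  have d := ((d1.sqrt hP.ne').mul (hasDerivAt_integral_gomesCore hk).2.2).const_mul (√2)⁻¹
  rw [funext gomesOf_eq]
  refine d.congr_deriv ?_
  have hi := integral_slope_identity hk
  have hsq := Real.sq_sqrt hP.le
  rw [← hsq] at hi
  generalize √(k * (1 - k ^ 2)) = w at *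
  field_simp
  linear_combination hi

lemma strictMonoOn_gomesSlope : StrictMonoOn gomesSlope (Ioo 0 1) := by
  intro k hk l hl hkl
  have hlt : ∀ u, slopeKernel k u < slopeKernel l u := by
    intro u
    have hc := Real.one_le_cosh u
    have hc0 := Real.cosh_pos u
    have h2 : 0 < Real.cosh u - l := by linarith [hl.2]
    have h3 : √(Real.cosh u - l) < √(Real.cosh u - k) := Real.sqrt_lt_sqrt h2.le (by linarith)
    have h4 := Real.sqrt_pos.2 h2
    have h5 : Real.cosh u / √(Real.cosh u - k) < Real.cosh u / √(Real.cosh u - l) := by gcongr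
    simp only [slopeKernel]
    linarith
  have i1 := integrableOn_slopeKernel hk
  have i2 := integrableOn_slopeKernel hl
  have hpos : 0 < ∫ u in Ioi 0, (slopeKernel l u - slopeKernel k u) := by
    rw [setIntegral_pos_iff_support_of_nonneg_ae (.of_forall fun u => (sub_pos.2 (hlt u)).le)
      (i2.sub i1)]
    have : (Function.support fun u => slopeKernel l u - slopeKernel k u) = univ :=
      eq_univ_of_forall fun u => (sub_pos.2 (hlt u)).ne'
    rw [this, univ_inter, Real.volume_Ioi]
    exact ENNReal.zero_lt_top
  rw [integral_sub i2 i1] at hpos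
  exact sub_pos.1 hpos

/-- If `gomesSlope` changes sign between `k₁` and `k₂` then `gomesOf` is unimodal. -/
lemma exists_unimodal {k₁ k₂ : ℝ} (h₁ : k₁ ∈ Ioo (0 : ℝ) 1) (h₂ : k₂ ∈ Ioo (0 : ℝ) 1)
    (s₁ : gomesSlope k₁ < 0) (s₂ : 0 < gomesSlope k₂) :
    ∃ k ∈ Icc k₁ k₂, StrictMonoOn gomesOf (Icc 0 k) ∧ StrictAntiOn gomesOf (Icc k 1) := by
  -- Taking the supremum as the turning point needs only the monotonicity of `gomesSlope`, not its
  -- continuity.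
  set T : Set ℝ := {k | k ∈ Ioo (0 : ℝ) 1 ∧ gomesSlope k < 0} with hT
  have hub : ∀ k ∈ T, k ≤ k₂ := by
    intro k hk
    by_contra h
    push Not at h
    have := strictMonoOn_gomesSlope h₂ hk.1 h
    linarith [hk.2]
  have hbdd : BddAbove T := ⟨k₂, hub⟩
  have hmem : k₁ ∈ T := ⟨h₁, s₁⟩
  have hle1 : k₁ ≤ sSup T := le_csSup hbdd hmem
  have hle2 : sSup T ≤ k₂ := csSup_le ⟨k₁, hmem⟩ hub
  have hlo : 0 < sSup T := h₁.1.trans_le hle1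
  have hhi : sSup T < 1 := hle2.trans_lt h₂.2
  have hcoef : ∀ k ∈ Ioo (0 : ℝ) 1, 0 < (√2)⁻¹ * (2 * √(k * (1 - k ^ 2)))⁻¹ := by
    intro k hk
    have hP : 0 < k * (1 - k ^ 2) := mul_pos hk.1 (by nlinarith [hk.1, hk.2])
    have := Real.sqrt_pos.2 hP
    positivity
  refine ⟨sSup T, ⟨hle1, hle2⟩, ?_, ?_⟩
  · refine strictMonoOn_of_deriv_pos (convex_Icc _ _)
      (continuousOn_gomesOf.mono (Icc_subset_Icc_right hhi.le)) fun k hk => ?_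
    rw [interior_Icc] at hk
    have hk' : k ∈ Ioo (0 : ℝ) 1 := ⟨hk.1, hk.2.trans hhi⟩
    obtain ⟨l, hl, hkl⟩ := exists_lt_of_lt_csSup ⟨k₁, hmem⟩ hk.2
    have hneg : gomesSlope k < 0 := (strictMonoOn_gomesSlope hk' hl.1 hkl).trans hl.2
    rw [(hasDerivAt_gomesOf hk').deriv]
    nlinarith [mul_pos (hcoef k hk') (neg_pos.2 hneg)]
  · refine strictAntiOn_of_deriv_neg (convex_Icc _ _)
      (continuousOn_gomesOf.mono (Icc_subset_Icc_left hlo.le)) fun k hk => ?_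
    rw [interior_Icc] at hk
    have hk' : k ∈ Ioo (0 : ℝ) 1 := ⟨hlo.trans hk.1, hk.2⟩
    obtain ⟨l, hl1, hl2⟩ := exists_between hk.1
    have hl : l ∈ Ioo (0 : ℝ) 1 := ⟨hlo.trans hl1, hl2.trans hk.2⟩
    have hl0 : 0 ≤ gomesSlope l := by
      by_contra h
      push Not at h
      exact absurd (le_csSup hbdd (show l ∈ T from ⟨hl, h⟩)) (not_le.2 hl1)
    have hpos : 0 < gomesSlope k := hl0.trans_lt (strictMonoOn_gomesSlope hl hk' hl2)
    rw [(hasDerivAt_gomesOf hk').deriv, neg_lt_zero]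
    exact mul_pos (hcoef k hk') hpos

/-! ### The moments of `1 / cosh` -/

/-- The integral of `cosh ^ (-p)` over the half-line. -/
def coshMoment (p : ℝ) : ℝ := ∫ u in Ioi 0, Real.cosh u ^ (-p)

lemma coshMoment_pos {p : ℝ} (hp : 0 < p) : 0 < coshMoment p := by
  have h : ∀ u, 0 < Real.cosh u ^ (-p) := fun u => Real.rpow_pos_of_pos (Real.cosh_pos u) _
  rw [coshMoment, setIntegral_pos_iff_support_of_nonneg_ae (.of_forall fun u => (h u).le)
    (integrableOn_cosh_rpow hp)]
  rw [show (Function.support fun u => Real.cosh u ^ (-p)) = univ from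
    eq_univ_of_forall fun u => (h u).ne', univ_inter, Real.volume_Ioi]
  exact ENNReal.zero_lt_top

lemma coshMoment_anti {p q : ℝ} (hp : 0 < p) (hpq : p ≤ q) : coshMoment q ≤ coshMoment p :=
  integral_mono (integrableOn_cosh_rpow (hp.trans_le hpq)) (integrableOn_cosh_rpow hp)
    fun u => Real.rpow_le_rpow_of_exponent_le (Real.one_le_cosh u) (neg_le_neg hpq)

lemma tendsto_cosh_rpow_neg {p : ℝ} (hp : 0 < p) :
    Tendsto (fun u => Real.cosh u ^ (-p)) atTop (𝓝 0) :=
  (tendsto_rpow_neg_atTop hp).comp tendsto_cosh_atTop'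

/-- The derivative of `sinh u cosh^(-(p + 1)) u` integrates to zero over the half-line. -/
lemma coshMoment_add_two {p : ℝ} (hp : 0 < p) :
    (p + 1) * coshMoment (p + 2) = p * coshMoment p := by
  have hd : ∀ u : ℝ, HasDerivAt (fun u => Real.sinh u * Real.cosh u ^ (-(p + 1)))
      ((p + 1) * Real.cosh u ^ (-(p + 2)) - p * Real.cosh u ^ (-p)) u := by
    intro u
    have hc := Real.cosh_pos u
    have h := (Real.hasDerivAt_sinh u).mul
      ((Real.hasDerivAt_cosh u).rpow_const (p := -(p + 1)) (Or.inl hc.ne'))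
    refine h.congr_deriv ?_
    have e1 : Real.cosh u ^ (-(p + 1)) = Real.cosh u ^ (-(p + 2)) * Real.cosh u := by
      rw [← Real.rpow_add_one hc.ne']; ring_nf
    have e2 : Real.cosh u ^ (-p) = Real.cosh u ^ (-(p + 2)) * Real.cosh u ^ 2 := by
      rw [← Real.rpow_natCast, ← Real.rpow_add hc]; push_cast; ring_nf
    have e3 : Real.cosh u ^ (-(p + 1) - 1) = Real.cosh u ^ (-(p + 2)) := by ring_nf
    rw [e1, e2, e3]
    linear_combination (-(p + 1) * Real.cosh u ^ (-(p + 2))) * Real.sinh_sq u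
  have i1 : IntegrableOn (fun u => (p + 1) * Real.cosh u ^ (-(p + 2))) (Ioi 0) :=
    (integrableOn_cosh_rpow (by linarith)).const_mul _
  have i2 : IntegrableOn (fun u => p * Real.cosh u ^ (-p)) (Ioi 0) :=
    (integrableOn_cosh_rpow hp).const_mul _
  have ht : Tendsto (fun u => Real.sinh u * Real.cosh u ^ (-(p + 1))) atTop (𝓝 0) := by
    refine squeeze_zero_norm' ?_ (tendsto_cosh_rpow_neg hp)
    filter_upwards [eventually_ge_atTop 0] with u hu
    have hc := Real.cosh_pos u
    have h0 := Real.rpow_pos_of_pos hc (-(p + 1))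
    rw [Real.norm_eq_abs, abs_of_nonneg (mul_nonneg (Real.sinh_nonneg_iff.2 hu) h0.le)]
    calc _ ≤ Real.cosh u * Real.cosh u ^ (-(p + 1)) := by gcongr; exact (Real.sinh_lt_cosh u).le
      _ = _ := by rw [mul_comm, ← Real.rpow_add_one hc.ne']; ring_nf
  have h := integral_Ioi_of_hasDerivAt_of_tendsto' (fun u _ => hd u) (i1.sub i2) ht
  rw [integral_sub i1 i2, integral_const_mul, integral_const_mul] at h
  simp only [Real.sinh_zero, zero_mul, sub_zero] at h
  simp only [coshMoment]
  linarith

lemma coshMoment_one : coshMoment 1 = Real.pi / 2 := by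
  have hd : ∀ u : ℝ, HasDerivAt (fun u => Real.arctan (Real.sinh u)) (Real.cosh u ^ (-1 : ℝ)) u := by
    intro u
    refine (Real.hasDerivAt_sinh u).arctan.congr_deriv ?_
    have hc := Real.cosh_pos u
    rw [Real.rpow_neg_one, ← Real.cosh_sq']
    field_simp
  have hs : Tendsto Real.sinh atTop atTop :=
    tendsto_atTop_mono' _ ((eventually_ge_atTop 0).mono fun u hu => Real.self_le_sinh_iff.2 hu)
      tendsto_id
  have h := integral_Ioi_of_hasDerivAt_of_tendsto' (fun u _ => hd u)
    (integrableOn_cosh_rpow one_pos)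
    ((tendsto_nhdsWithin_iff.1 Real.tendsto_arctan_atTop).1.comp hs)
  simpa [coshMoment] using h

lemma coshMoment_two : coshMoment 2 = 1 := by
  have hd : ∀ u : ℝ, HasDerivAt (fun u => Real.sinh u / Real.cosh u) (Real.cosh u ^ (-2 : ℝ)) u := by
    intro u
    have hc := Real.cosh_pos u
    refine ((Real.hasDerivAt_sinh u).div (Real.hasDerivAt_cosh u) hc.ne').congr_deriv ?_
    rw [Real.rpow_neg hc.le]
    norm_cast
    have := Real.cosh_sq u
    field_simp
    linarith
  have ht : Tendsto (fun u => Real.sinh u / Real.cosh u) atTop (𝓝 1) := by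
    have h1 : Tendsto (fun u => 1 - Real.exp (-u) / Real.cosh u) atTop (𝓝 (1 - 0)) := by
      refine tendsto_const_nhds.sub (Tendsto.div_atTop (a := 0) ?_ tendsto_cosh_atTop')
      exact Real.tendsto_exp_neg_atTop_nhds_zero
    rw [sub_zero] at h1
    refine h1.congr fun u => ?_
    have hc := Real.cosh_pos u
    rw [← Real.cosh_sub_sinh]
    field_simp
    ring
  have h := integral_Ioi_of_hasDerivAt_of_tendsto' (fun u _ => hd u)
    (integrableOn_cosh_rpow two_pos) ht
  simpa [coshMoment] using h

lemma coshMoment_mul_add_nat {p : ℝ} (hp : 0 < p) (n : ℕ) :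
    (p + n) * (coshMoment (p + n) * coshMoment (p + n + 1))
      = p * (coshMoment p * coshMoment (p + 1)) := by
  induction n with
  | zero => simp
  | succ n ih =>
    rw [← ih]
    have h := coshMoment_add_two (p := p + n) (by positivity)
    push_cast
    rw [show p + (n + 1 : ℝ) + 1 = p + n + 2 by ring, show p + (n + 1 : ℝ) = p + n + 1 by ring]
    linear_combination coshMoment (p + n + 1) * h

lemma coshMoment_mul_nat (n : ℕ) :
    (n + 1 : ℝ) * (coshMoment (n + 1) * coshMoment (n + 2)) = Real.pi / 2 := by
  have h := coshMoment_mul_add_nat one_pos n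
  rw [coshMoment_one, show (1 + 1 : ℝ) = 2 by norm_num, coshMoment_two] at h
  rw [show (n + 1 : ℝ) = 1 + n by ring, show (n + 2 : ℝ) = 1 + n + 1 by ring, h]
  ring

/-- The moments at `p` and `p + 1` determine each other. -/
lemma coshMoment_mul {p : ℝ} (hp : 0 < p) :
    p * (coshMoment p * coshMoment (p + 1)) = Real.pi / 2 := by
  have hpi := Real.pi_pos
  -- The product is invariant under integer shifts of `p`, so `p` may be replaced by a large `x`
  -- between `m + 1` and `m + 2`. Monotone moments then compare it with the integer case, with
  -- prefactors whose ratio tends to `1`.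
  have key : ∀ n : ℕ, (1 - 1 / ((n : ℝ) + 1)) * (Real.pi / 2)
      ≤ p * (coshMoment p * coshMoment (p + 1)) ∧
      p * (coshMoment p * coshMoment (p + 1)) ≤ (1 + 1 / ((n : ℝ) + 1)) * (Real.pi / 2) := by
    intro n
    obtain ⟨x, m, hx, hm0, hm1, hm2⟩ : ∃ (x : ℝ) (m : ℕ), x = p + (n + 1 : ℕ) ∧ n ≤ m ∧
        (m + 1 : ℝ) ≤ x ∧ x ≤ m + 2 := by
      have h0 : 0 ≤ p := hp.le
      refine ⟨_, ⌊p⌋₊ + n, rfl, by omega, ?_, ?_⟩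
      · have := Nat.floor_le h0
        push_cast; linarith
      · have := (Nat.lt_floor_add_one p).le
        push_cast; linarith
    have hn : (n : ℝ) ≤ m := by exact_mod_cast hm0
    have hn0 : (0 : ℝ) ≤ n := by positivity
    have hx0 : 0 < x := by linarith
    rw [← coshMoment_mul_add_nat hp (n + 1), ← hx]
    have u1 := coshMoment_anti (by linarith) hm1
    have u2 := coshMoment_anti (by linarith) (show (m + 2 : ℝ) ≤ x + 1 by linarith)
    have l1 := coshMoment_anti hx0 hm2
    have l2 := coshMoment_anti (by linarith) (show x + 1 ≤ (m + 3 : ℝ) by linarith)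
    have p1 := coshMoment_pos hx0
    have p2 := coshMoment_pos (show 0 < x + 1 by linarith)
    have p3 := coshMoment_pos (show (0 : ℝ) < m + 1 by linarith)
    have p4 := coshMoment_pos (show (0 : ℝ) < m + 2 by linarith)
    have p5 := coshMoment_pos (show (0 : ℝ) < m + 3 by linarith)
    have q1 := coshMoment_mul_nat m
    have q2 := coshMoment_mul_nat (m + 1)
    push_cast at q2
    rw [show (m + 1 + 1 : ℝ) = m + 2 by ring, show (m + 1 + 2 : ℝ) = m + 3 by ring] at q2
    have v1 : coshMoment x * coshMoment (x + 1) ≤ coshMoment (m + 1) * coshMoment (m + 2) := by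
      gcongr
    have v2 : coshMoment (m + 2) * coshMoment (m + 3) ≤ coshMoment x * coshMoment (x + 1) := by
      gcongr
    constructor
    · rw [← q2]
      have : (1 - 1 / ((n : ℝ) + 1)) * (m + 2) ≤ x := by
        have : 1 ≤ 1 / ((n : ℝ) + 1) * (m + 2) := by
          rw [one_div, inv_mul_eq_div, one_le_div (by positivity)]; linarith
        linarith
      calc _ = ((1 - 1 / ((n : ℝ) + 1)) * (m + 2)) * (coshMoment (m + 2) * coshMoment (m + 3)) := by
            ring
        _ ≤ x * (coshMoment (m + 2) * coshMoment (m + 3)) := by gcongr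
        _ ≤ _ := by gcongr
    · rw [← q1]
      have : x ≤ (1 + 1 / ((n : ℝ) + 1)) * (m + 1) := by
        have : 1 ≤ 1 / ((n : ℝ) + 1) * (m + 1) := by
          rw [one_div, inv_mul_eq_div, one_le_div (by positivity)]; linarith
        linarith
      calc _ ≤ x * (coshMoment (m + 1) * coshMoment (m + 2)) := by gcongr
        _ ≤ ((1 + 1 / ((n : ℝ) + 1)) * (m + 1)) * (coshMoment (m + 1) * coshMoment (m + 2)) := by
            gcongr
        _ = _ := by ring
  have t0 : Tendsto (fun n : ℕ => 1 / ((n : ℝ) + 1)) atTop (𝓝 0) :=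
    tendsto_one_div_add_atTop_nhds_zero_nat
  have t1 := (t0.const_sub 1).mul_const (Real.pi / 2)
  have t2 := (t0.const_add 1).mul_const (Real.pi / 2)
  refine le_antisymm ?_ ?_
  · have := ge_of_tendsto' t2 fun n => (key n).2
    linarith
  · have := le_of_tendsto' t1 fun n => (key n).1
    linarith

lemma coshMoment_add_two_mul {p : ℝ} (hp : 0 < p) (n : ℕ) :
    coshMoment (p + 2 * n) =
      (∏ i ∈ Finset.range n, (p + 2 * i) / (p + 2 * i + 1)) * coshMoment p := by
  induction n with
  | zero => simp
  | succ n ih =>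
    have h := coshMoment_add_two (p := p + 2 * n) (by positivity)
    rw [Finset.prod_range_succ, mul_right_comm, ← ih]
    push_cast
    rw [show p + 2 * ((n : ℝ) + 1) = p + 2 * n + 2 by ring]
    have : 0 < p + 2 * n + 1 := by positivity
    field_simp
    linarith

lemma coshMoment_sq_bounds {p : ℝ} (hp : 1 < p) :
    Real.pi / 2 ≤ p * coshMoment p ^ 2 ∧ (p - 1) * coshMoment p ^ 2 ≤ Real.pi / 2 := by
  have p0 := coshMoment_pos (show 0 < p by linarith)
  have h1 := coshMoment_mul (show 0 < p by linarith)
  have h2 := coshMoment_mul (show 0 < p - 1 by linarith)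
  have a1 := coshMoment_anti (show 0 < p by linarith) (show p ≤ p + 1 by linarith)
  have a2 := coshMoment_anti (show 0 < p - 1 by linarith) (show p - 1 ≤ p by linarith)
  rw [sub_add_cancel] at h2
  constructor
  · rw [← h1, sq]; gcongr
  · rw [← h2, sq]; gcongr

/-- A weight `H` that is asymptotic to `q` makes `H q * M (q + 1/2) ^ 2` tend to `π / 2`. -/
lemma tendsto_weight_mul_coshMoment_sq {H : ℝ → ℝ} {q : ℝ} (hq : 1 ≤ q)
    (hH : ∀ x, 1 ≤ x → |H x - x| ≤ 1) :
    Tendsto (fun n : ℕ => H (q + 2 * n) * coshMoment (q + 1 / 2 + 2 * n) ^ 2) atTop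
      (𝓝 (Real.pi / 2)) := by
  have hpi := Real.pi_pos
  have b : ∀ n : ℕ, (1 - 3 / (q + 2 * n)) * (Real.pi / 2)
      ≤ H (q + 2 * n) * coshMoment (q + 1 / 2 + 2 * n) ^ 2 ∧
      H (q + 2 * n) * coshMoment (q + 1 / 2 + 2 * n) ^ 2
        ≤ (1 + 2 / (q + 2 * n - 1 / 2)) * (Real.pi / 2) := by
    intro n
    have hn : (0 : ℝ) ≤ n := by positivity
    obtain ⟨x, hx⟩ : ∃ x, x = q + 2 * (n : ℝ) := ⟨_, rfl⟩
    have hx1 : 1 ≤ x := by linarith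
    obtain ⟨c1, c2⟩ := coshMoment_sq_bounds (p := q + 1 / 2 + 2 * n) (by linarith)
    obtain ⟨d1, d2⟩ := abs_le.1 (hH x hx1)
    have e : q + 1 / 2 + 2 * (n : ℝ) = x + 1 / 2 := by linarith
    rw [e] at c1 c2
    rw [← hx, e]
    clear hx e
    have m0 := pow_pos (coshMoment_pos (show 0 < x + 1 / 2 by linarith)) 2
    generalize coshMoment (x + 1 / 2) ^ 2 = m at *
    have x0 : 0 < x := by linarith
    have x1 : 0 < x - 1 / 2 := by linarith
    constructor
    · calc (1 - 3 / x) * (Real.pi / 2) = Real.pi / 2 - 3 * (1 / x * (Real.pi / 2)) := by ring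
        _ ≤ (x - 1) * m := ?_
        _ ≤ _ := by gcongr; linarith
      have h4 : 1 / 2 * m ≤ 1 / x * (Real.pi / 2) := by
        rw [one_div_mul_eq_div x, le_div_iff₀ x0]
        nlinarith
      linarith
    · calc H x * m ≤ (x + 1) * m := by gcongr; linarith
        _ ≤ _ := ?_
      have h4 : m ≤ 1 / (x - 1 / 2) * (Real.pi / 2) := by
        rw [one_div_mul_eq_div (x - 1 / 2), le_div_iff₀ x1]
        nlinarith
      have : 2 / (x - 1 / 2) * (Real.pi / 2) = 2 * (1 / (x - 1 / 2) * (Real.pi / 2)) := by ring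
      nlinarith
  have hinf : ∀ c : ℝ, Tendsto (fun n : ℕ => q + 2 * (n : ℝ) - c) atTop atTop := fun c =>
    tendsto_atTop_add_const_right _ _ (tendsto_atTop_add_const_left _ _
      (tendsto_natCast_atTop_atTop.const_mul_atTop two_pos))
  have t1 := (((hinf 0).const_div_atTop 3).const_sub 1).mul_const (Real.pi / 2)
  have t2 := (((hinf (1 / 2)).const_div_atTop 2).const_add 1).mul_const (Real.pi / 2)
  simp only [sub_zero, add_zero, one_mul] at t1 t2
  exact tendsto_of_tendsto_of_tendsto_of_le_of_le t1 t2 (fun n => (b n).1) fun n => (b n).2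

lemma coshMoment_sq_step {p : ℝ} (hp : 0 < p) :
    coshMoment (p + 2) ^ 2 = p ^ 2 / (p + 1) ^ 2 * coshMoment p ^ 2 := by
  have h := coshMoment_add_two hp
  rw [div_mul_eq_mul_div, eq_div_iff (by positivity), ← mul_pow, ← mul_pow, ← h, mul_comm]

/-- The weights in this bound and in the upper one truncate the asymptotic expansion of `(π / 2) /
M(q + 1/2)²`. Along `q, q + 2, q + 4, …` the weighted squares converge monotonically to `π / 2`,
decreasing here and increasing for the other weight, so the first term gives the bound. -/
lemma coshMoment_sq_lower {q : ℝ} (hq : 1 ≤ q) :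
    Real.pi / 2 ≤ (q + 1 / (8 * q)) * coshMoment (q + 1 / 2) ^ 2 := by
  have ht := tendsto_weight_mul_coshMoment_sq (H := fun x => x + 1 / (8 * x)) hq (by
    intro x hx
    rw [add_sub_cancel_left, abs_of_nonneg (by positivity), div_le_one (by positivity)]
    linarith)
  have ha : Antitone fun n : ℕ => (fun x : ℝ => x + 1 / (8 * x)) (q + 2 * n) *
      coshMoment (q + 1 / 2 + 2 * n) ^ 2 := by
    refine antitone_nat_of_succ_le fun n => ?_
    have hn : (0 : ℝ) ≤ n := by positivity
    obtain ⟨x, hx⟩ : ∃ x, x = q + 2 * (n : ℝ) := ⟨_, rfl⟩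
    have hx1 : 1 ≤ x := by linarith
    push_cast
    rw [← hx, show q + 2 * ((n : ℝ) + 1) = x + 2 by linarith,
      show q + 1 / 2 + 2 * ((n : ℝ) + 1) = x + 1 / 2 + 2 by linarith,
      show q + 1 / 2 + 2 * (n : ℝ) = x + 1 / 2 by linarith,
      coshMoment_sq_step (by linarith), ← mul_assoc]
    gcongr ?_ * _
    rw [← mul_div_assoc, div_le_iff₀ (by positivity), ← sub_nonneg]
    have : (x + 1 / (8 * x)) * (x + 1 / 2 + 1) ^ 2 - (x + 2 + 1 / (8 * (x + 2))) * (x + 1 / 2) ^ 2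
        = 9 / (16 * (x * (x + 2))) := by
      field_simp
      ring
    rw [this]
    positivity
  have := ha.le_of_tendsto ht 0
  simpa using this

lemma coshMoment_sq_upper {q : ℝ} (hq : 1 ≤ q) :
    (q + 1 / (8 * q) - 9 / (128 * q ^ 3)) * coshMoment (q + 1 / 2) ^ 2 ≤ Real.pi / 2 := by
  have ht := tendsto_weight_mul_coshMoment_sq
    (H := fun x => x + 1 / (8 * x) - 9 / (128 * x ^ 3)) hq (by
    intro x hx
    have h1 : 1 / (8 * x) ≤ 1 / 8 := by gcongr; linarith
    have h2 : 9 / (128 * x ^ 3) ≤ 9 / 128 := by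
      gcongr; nlinarith [one_le_pow₀ hx (n := 3)]
    have h3 : 0 ≤ 1 / (8 * x) := by positivity
    have h4 : 0 ≤ 9 / (128 * x ^ 3) := by positivity
    rw [abs_le]
    constructor <;> linarith)
  have ha : Monotone fun n : ℕ => (fun x : ℝ => x + 1 / (8 * x) - 9 / (128 * x ^ 3)) (q + 2 * n) *
      coshMoment (q + 1 / 2 + 2 * n) ^ 2 := by
    refine monotone_nat_of_le_succ fun n => ?_
    have hn : (0 : ℝ) ≤ n := by positivity
    obtain ⟨x, hx⟩ : ∃ x, x = q + 2 * (n : ℝ) := ⟨_, rfl⟩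
    have hx1 : 1 ≤ x := by linarith
    push_cast
    rw [← hx, show q + 2 * ((n : ℝ) + 1) = x + 2 by linarith,
      show q + 1 / 2 + 2 * ((n : ℝ) + 1) = x + 1 / 2 + 2 by linarith,
      show q + 1 / 2 + 2 * (n : ℝ) = x + 1 / 2 by linarith,
      coshMoment_sq_step (by linarith), ← mul_assoc]
    gcongr ?_ * _
    rw [← mul_div_assoc, le_div_iff₀ (by positivity), ← sub_nonneg]
    have : (x + 2 + 1 / (8 * (x + 2)) - 9 / (128 * (x + 2) ^ 3)) * (x + 1 / 2) ^ 2
        - (x + 1 / (8 * x) - 9 / (128 * x ^ 3)) * (x + 1 / 2 + 1) ^ 2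
        = (918 * x ^ 2 + 1836 * x + 648) / (512 * (x * (x + 2)) ^ 3) := by
      field_simp
      ring
    rw [this]
    positivity
  have := ha.ge_of_tendsto ht 0
  simpa using this

/-! ### Numerical values of the moments -/

/-- Twenty steps of the recurrence carry `1/2` to `40 + 1/2`, where the two weights differ
relatively by only about `3·10⁻⁸`. -/
lemma coshMoment_half_bounds :
    2.62205749 < coshMoment (1 / 2) ∧ coshMoment (1 / 2) < 2.62205762 := by
  have hp := coshMoment_pos (show (0 : ℝ) < 1 / 2 by norm_num)
  have h1 := coshMoment_sq_lower (q := 40) (by norm_num)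
  have h2 := coshMoment_sq_upper (q := 40) (by norm_num)
  have e := coshMoment_add_two_mul (p := 1 / 2) (by norm_num) 20
  rw [show (1 / 2 + 2 * (20 : ℕ) : ℝ) = 40 + 1 / 2 by norm_num] at e
  rw [e] at h1 h2
  simp only [Finset.prod_range_succ, Finset.prod_range_zero] at h1 h2
  generalize coshMoment (1 / 2) = m at *
  norm_num at h1 h2
  have p1 := Real.pi_gt_d20
  have p2 := Real.pi_lt_d20
  constructor
  · by_contra hm
    push Not at hm
    have := mul_self_le_mul_self hp.le hm
    norm_num at this
    nlinarith
  · by_contra hm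
    push Not at hm
    have := mul_self_le_mul_self (by norm_num) hm
    norm_num at this
    nlinarith

lemma coshMoment_three_halves_bounds :
    1.19814018 < coshMoment (3 / 2) ∧ coshMoment (3 / 2) < 1.19814029 := by
  have hp := coshMoment_pos (show (0 : ℝ) < 3 / 2 by norm_num)
  have h1 := coshMoment_sq_lower (q := 41) (by norm_num)
  have h2 := coshMoment_sq_upper (q := 41) (by norm_num)
  have e := coshMoment_add_two_mul (p := 3 / 2) (by norm_num) 20
  rw [show (3 / 2 + 2 * (20 : ℕ) : ℝ) = 41 + 1 / 2 by norm_num] at e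
  rw [e] at h1 h2
  simp only [Finset.prod_range_succ, Finset.prod_range_zero] at h1 h2
  generalize coshMoment (3 / 2) = m at *
  norm_num at h1 h2
  have p1 := Real.pi_gt_d20
  have p2 := Real.pi_lt_d20
  constructor
  · by_contra hm
    push Not at hm
    have := mul_self_le_mul_self hp.le hm
    norm_num at this
    nlinarith
  · by_contra hm
    push Not at hm
    have := mul_self_le_mul_self (by norm_num) hm
    norm_num at this
    nlinarith

/-! ### Power series of the integrands -/

/-- The coefficients of the power series of `1 / √(1 - s)`. -/
def invSqrtCoeff : ℕ → ℝ
  | 0 => 1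
  | n + 1 => invSqrtCoeff n * ((2 * n + 1) / (2 * n + 2))

lemma invSqrtCoeff_pos (n : ℕ) : 0 < invSqrtCoeff n := by
  induction n with
  | zero => simp [invSqrtCoeff]
  | succ n ih => rw [invSqrtCoeff]; positivity

/-- The partial sums of the power series of `1 / √(1 - s)`. -/
def invSqrtSum (N : ℕ) (s : ℝ) : ℝ := ∑ n ∈ Finset.range N, invSqrtCoeff n * s ^ n

lemma hasDerivAt_invSqrtSum (N : ℕ) (s : ℝ) :
    HasDerivAt (invSqrtSum N) (∑ n ∈ Finset.range N, invSqrtCoeff n * (n * s ^ (n - 1))) s := by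
  unfold invSqrtSum
  exact HasDerivAt.fun_sum fun n _ => (hasDerivAt_pow n s).const_mul _

/-- The function `f = (1 - s)^(-1/2)` solves `(1 - s) f' = f / 2`. A partial sum fails to do so by a
single monomial of known sign. -/
lemma invSqrtSum_deriv_identity (N : ℕ) (s : ℝ) :
    (∑ n ∈ Finset.range N, invSqrtCoeff n * (n * s ^ (n - 1))) * (1 - s) - invSqrtSum N s / 2
      = -(N * invSqrtCoeff N * s ^ (N - 1)) := by
  induction N with
  | zero => simp [invSqrtSum]
  | succ N ih =>
    rw [invSqrtSum, Finset.sum_range_succ, Finset.sum_range_succ, ← invSqrtSum]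
    have h : invSqrtCoeff (N + 1) * (N + 1) = invSqrtCoeff N * (N + 1 / 2) := by
      rw [invSqrtCoeff]
      field_simp
    have hp : (N : ℝ) * s ^ (N - 1) * s = N * s ^ N := by
      rcases N with _ | N
      · simp
      · rw [Nat.add_sub_cancel, pow_succ]; ring
    push_cast
    linear_combination ih + s ^ N * h - invSqrtCoeff N * hp

lemma hasDerivAt_invSqrtSum_mul_sqrt (N : ℕ) {s : ℝ} (hs : s < 1) :
    HasDerivAt (fun s => invSqrtSum N s * √(1 - s))
      (-(N * invSqrtCoeff N * s ^ (N - 1)) / √(1 - s)) s := by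
  have h1 : 0 < 1 - s := by linarith
  have hq := Real.sqrt_pos.2 h1
  refine ((hasDerivAt_invSqrtSum N s).mul
    (((hasDerivAt_id s).const_sub 1).sqrt h1.ne')).congr_deriv ?_
  rw [← invSqrtSum_deriv_identity]
  have := Real.sq_sqrt h1.le
  simp only [id]
  generalize (∑ n ∈ Finset.range N, invSqrtCoeff n * (n * s ^ (n - 1))) = A
  field_simp
  linear_combination A * 2 * this

lemma invSqrtSum_zero (N : ℕ) : invSqrtSum (N + 1) 0 = 1 := by
  rw [invSqrtSum, Finset.sum_range_succ']
  simp [invSqrtCoeff]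

/-- The partial sum times `√(1 - s)` starts at `1` and decreases. The index `N + 1` ensures that the
constant term is present. -/
lemma invSqrtSum_le {s : ℝ} (hs : s ∈ Ico (0 : ℝ) 1) (N : ℕ) :
    invSqrtSum (N + 1) s ≤ (√(1 - s))⁻¹ := by
  have ha : AntitoneOn (fun s => invSqrtSum (N + 1) s * √(1 - s)) (Ico 0 1) := by
    refine antitoneOn_of_deriv_nonpos (convex_Ico 0 1)
      (fun x hx => (hasDerivAt_invSqrtSum_mul_sqrt _ hx.2).continuousAt.continuousWithinAt)
      (fun x hx => ?_) fun x hx => ?_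
    · rw [interior_Ico] at hx
      exact (hasDerivAt_invSqrtSum_mul_sqrt _ hx.2).differentiableAt.differentiableWithinAt
    · rw [interior_Ico] at hx
      rw [(hasDerivAt_invSqrtSum_mul_sqrt _ hx.2).deriv, neg_div, neg_nonpos]
      have := invSqrtCoeff_pos (N + 1)
      have := hx.1
      positivity
  have h := ha (left_mem_Ico.2 one_pos) hs hs.1
  simp only [invSqrtSum_zero, sub_zero, Real.sqrt_one, mul_one] at h
  have hq : 0 < √(1 - s) := Real.sqrt_pos.2 (by linarith [hs.2])
  rwa [← one_div, le_div_iff₀ hq]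

/-- Once the first omitted term divided by `1 - s` is added, the product with `√(1 - s)` increases
from `1` instead. -/
lemma le_invSqrtSum {s : ℝ} (hs : s ∈ Ico (0 : ℝ) 1) (N : ℕ) :
    (√(1 - s))⁻¹ ≤ invSqrtSum (N + 1) s + invSqrtCoeff (N + 1) * s ^ (N + 1) / (1 - s) := by
  have hd : ∀ x ∈ Ico (0 : ℝ) 1, HasDerivAt
      (fun s => invSqrtSum (N + 1) s * √(1 - s) + invSqrtCoeff (N + 1) * s ^ (N + 1) / √(1 - s))
      (invSqrtCoeff (N + 1) * x ^ (N + 1) / (2 * (1 - x) * √(1 - x))) x := by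
    intro x hx
    have h1 : 0 < 1 - x := by linarith [hx.2]
    have hq := Real.sqrt_pos.2 h1
    refine ((hasDerivAt_invSqrtSum_mul_sqrt (N + 1) hx.2).add
      (((hasDerivAt_pow (N + 1) x).const_mul (invSqrtCoeff (N + 1))).div
      (((hasDerivAt_id x).const_sub 1).sqrt h1.ne') hq.ne')).congr_deriv ?_
    have := Real.sq_sqrt h1.le
    simp only [id]
    rw [this, Nat.add_sub_cancel]
    field_simp
    rw [this]
    ring
  have hm : MonotoneOn (fun s => invSqrtSum (N + 1) s * √(1 - s)
      + invSqrtCoeff (N + 1) * s ^ (N + 1) / √(1 - s)) (Ico 0 1) := by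
    refine monotoneOn_of_deriv_nonneg (convex_Ico 0 1)
      (fun x hx => (hd x hx).continuousAt.continuousWithinAt)
      (fun x hx => ?_) fun x hx => ?_
    · exact (hd x (interior_subset hx)).differentiableAt.differentiableWithinAt
    · rw [(hd x (interior_subset hx)).deriv]
      have := invSqrtCoeff_pos (N + 1)
      rw [interior_Ico] at hx
      have := hx.1
      have : 0 < 1 - x := by linarith [hx.2]
      positivity
  have h := hm (left_mem_Ico.2 one_pos) hs hs.1
  have h1 : 0 < 1 - s := by linarith [hs.2]
  have hq := Real.sqrt_pos.2 h1
  have h2 := Real.sq_sqrt h1.le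
  simp only [invSqrtSum_zero, sub_zero, Real.sqrt_one, mul_one, ne_eq, Nat.succ_ne_zero,
    not_false_eq_true, zero_pow, mul_zero, zero_div, add_zero] at h
  rw [inv_le_iff_one_le_mul₀ hq]
  refine h.trans_eq ?_
  rw [add_mul]
  congr 1
  field_simp
  linear_combination (-(invSqrtCoeff (N + 1) * s ^ (N + 1))) * h2

/-- The coefficients of the power series of `1 / ((1 + w) √(1 - w))`. -/
def coreCoeff : ℕ → ℝ
  | 0 => 1
  | n + 1 => invSqrtCoeff (n + 1) - coreCoeff n

lemma one_add_mul_sum_coreCoeff (N : ℕ) (w : ℝ) :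
    (1 + w) * ∑ n ∈ Finset.range (N + 1), coreCoeff n * w ^ n
      = invSqrtSum (N + 1) w + coreCoeff N * w ^ (N + 1) := by
  induction N with
  | zero => simp [invSqrtSum, coreCoeff, invSqrtCoeff]
  | succ N ih =>
    rw [Finset.sum_range_succ, mul_add, ih, invSqrtSum, invSqrtSum,
      Finset.sum_range_succ _ (N + 1), coreCoeff]
    ring

/-- Multiplying by `1 + w` reduces to the series of `1 / √(1 - w)`, up to the end term `coreCoeff N
* w ^ (N + 1)` of the recursion. Replacing `1 - w` by `1 - k` makes the constant independent of `w`.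
-/
lemma abs_sub_sum_coreCoeff_le {w k : ℝ} (hw : 0 ≤ w) (hwk : w ≤ k) (hk : k < 1) (N : ℕ) :
    |((1 + w) * √(1 - w))⁻¹ - ∑ n ∈ Finset.range (N + 1), coreCoeff n * w ^ n|
      ≤ (invSqrtCoeff (N + 1) / (1 - k) + |coreCoeff N|) * w ^ (N + 1) := by
  have hs : w ∈ Ico (0 : ℝ) 1 := ⟨hw, hwk.trans_lt hk⟩
  have h1 := invSqrtSum_le hs N
  have h2 := le_invSqrtSum hs N
  have h3 := one_add_mul_sum_coreCoeff N w
  have h4 : invSqrtCoeff (N + 1) * w ^ (N + 1) / (1 - w)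
      ≤ invSqrtCoeff (N + 1) / (1 - k) * w ^ (N + 1) := by
    have := (invSqrtCoeff_pos (N + 1)).le
    rw [mul_div_right_comm]
    have : 0 < 1 - k := by linarith
    gcongr
  have h5 : 0 < 1 + w := by linarith
  have h6 : ((1 + w) * √(1 - w))⁻¹ - ∑ n ∈ Finset.range (N + 1), coreCoeff n * w ^ n
      = ((√(1 - w))⁻¹ - invSqrtSum (N + 1) w - coreCoeff N * w ^ (N + 1)) / (1 + w) := by
    rw [eq_div_iff h5.ne', sub_mul, mul_inv]
    field_simp
    linear_combination -h3
  rw [h6, abs_div, abs_of_pos h5, div_le_iff₀ h5]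
  have h7 : 0 ≤ (invSqrtCoeff (N + 1) / (1 - k) + |coreCoeff N|) * w ^ (N + 1) := by
    have := (invSqrtCoeff_pos (N + 1)).le
    have : 0 < 1 - k := by linarith
    positivity
  have h8 : |coreCoeff N * w ^ (N + 1)| = |coreCoeff N| * w ^ (N + 1) := by
    rw [abs_mul, abs_of_nonneg (pow_nonneg hw _)]
  calc _ ≤ |(√(1 - w))⁻¹ - invSqrtSum (N + 1) w| + |coreCoeff N * w ^ (N + 1)| := abs_sub _ _
    _ ≤ (invSqrtCoeff (N + 1) / (1 - k) + |coreCoeff N|) * w ^ (N + 1) := by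
        rw [h8, abs_of_nonneg (by linarith)]
        linarith
    _ ≤ _ := le_mul_of_one_le_right h7 (by linarith)

/-! ### Termwise integration of the series against half-integral moments -/

/-- The moments with half-integral exponents. -/
def halfMoment (n : ℕ) : ℝ := coshMoment (n + 1 / 2)

lemma halfMoment_add_two (n : ℕ) :
    halfMoment (n + 2) = (2 * n + 1) / (2 * n + 3) * halfMoment n := by
  have h := coshMoment_add_two (p := n + 1 / 2) (by positivity)
  rw [halfMoment, halfMoment]
  push_cast
  rw [show (n + 2 + 1 / 2 : ℝ) = n + 1 / 2 + 2 by ring]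
  generalize coshMoment (n + 1 / 2 + 2) = A at *
  generalize coshMoment (n + 1 / 2) = B at *
  field_simp
  linear_combination 2 * h

lemma integrableOn_cosh_rpow_half (n : ℕ) :
    IntegrableOn (fun u => Real.cosh u ^ (-(n + 1 / 2) : ℝ)) (Ioi 0) :=
  integrableOn_cosh_rpow (by positivity)

lemma integrableOn_sum_cosh (N m : ℕ) (a : ℕ → ℝ) :
    IntegrableOn (fun u => ∑ n ∈ Finset.range N, a n * Real.cosh u ^ (-((n + m : ℕ) + 1 / 2) : ℝ))
      (Ioi 0) :=
  integrable_finsetSum _ fun n _ => (integrableOn_cosh_rpow_half (n + m)).const_mul _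

lemma integral_sum_cosh (N m : ℕ) (a : ℕ → ℝ) :
    ∫ u in Ioi 0, ∑ n ∈ Finset.range N, a n * Real.cosh u ^ (-((n + m : ℕ) + 1 / 2) : ℝ)
      = ∑ n ∈ Finset.range N, a n * halfMoment (n + m) := by
  rw [integral_finsetSum _ fun n _ => (integrableOn_cosh_rpow_half (n + m)).const_mul _]
  exact Finset.sum_congr rfl fun n _ => integral_const_mul _ _

lemma cosh_rpow_half (n : ℕ) (u : ℝ) :
    Real.cosh u ^ (-(n + 1 / 2) : ℝ) = (Real.cosh u ^ n * √(Real.cosh u))⁻¹ := by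
  have hc := Real.cosh_pos u
  rw [Real.rpow_neg hc.le, Real.rpow_add hc, Real.rpow_natCast, Real.sqrt_eq_rpow]

lemma sqrt_cosh_sub {k : ℝ} (u : ℝ) :
    √(Real.cosh u - k) = √(Real.cosh u) * √(1 - k / Real.cosh u) := by
  have hc := Real.cosh_pos u
  rw [← Real.sqrt_mul hc.le]
  congr 1
  field_simp

lemma abs_gomesCore_sub_le {k : ℝ} (hk : k ∈ Ioo (0 : ℝ) 1) (N : ℕ) (u : ℝ) :
    |gomesCore k u - ∑ n ∈ Finset.range (N + 1),
        coreCoeff n * k ^ n * Real.cosh u ^ (-((n + 1 : ℕ) + 1 / 2) : ℝ)|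
      ≤ (invSqrtCoeff (N + 1) / (1 - k) + |coreCoeff N|) * k ^ (N + 1)
        * Real.cosh u ^ (-((N + 2 : ℕ) + 1 / 2) : ℝ) := by
  have hc := Real.cosh_pos u
  have hc1 := Real.one_le_cosh u
  have hw0 : 0 ≤ k / Real.cosh u := div_nonneg hk.1.le hc.le
  have hwk : k / Real.cosh u ≤ k := div_le_self hk.1.le hc1
  have h := abs_sub_sum_coreCoeff_le hw0 hwk hk.2 N
  have hr := Real.sqrt_pos.2 hc
  have hq : 0 < √(1 - k / Real.cosh u) := Real.sqrt_pos.2 (by linarith [hk.2])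
  have hp : 0 < (Real.cosh u * √(Real.cosh u))⁻¹ := by positivity
  have e1 : gomesCore k u = ((1 + k / Real.cosh u) * √(1 - k / Real.cosh u))⁻¹
      * (Real.cosh u * √(Real.cosh u))⁻¹ := by
    rw [gomesCore, sqrt_cosh_sub, ← mul_inv]
    field_simp
  have e2 : ∑ n ∈ Finset.range (N + 1),
        coreCoeff n * k ^ n * Real.cosh u ^ (-((n + 1 : ℕ) + 1 / 2) : ℝ)
      = (∑ n ∈ Finset.range (N + 1), coreCoeff n * (k / Real.cosh u) ^ n)
        * (Real.cosh u * √(Real.cosh u))⁻¹ := by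
    rw [Finset.sum_mul]
    refine Finset.sum_congr rfl fun n _ => ?_
    rw [cosh_rpow_half, div_pow, pow_succ]
    field_simp
  rw [e1, e2, ← sub_mul, abs_mul, abs_of_pos hp]
  refine (mul_le_mul_of_nonneg_right h hp.le).trans_eq ?_
  rw [cosh_rpow_half, div_pow, show N + 2 = (N + 1) + 1 by ring, pow_succ (Real.cosh u) (N + 1)]
  field_simp

/-- Power series evaluation of the integral in the Gomes function. -/
lemma abs_integral_gomesCore_sub_le {k : ℝ} (hk : k ∈ Ioo (0 : ℝ) 1) (N : ℕ) :
    |(∫ u in Ioi 0, gomesCore k u)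
        - ∑ n ∈ Finset.range (N + 1), coreCoeff n * k ^ n * halfMoment (n + 1)|
      ≤ (invSqrtCoeff (N + 1) / (1 - k) + |coreCoeff N|) * k ^ (N + 1) * halfMoment (N + 2) := by
  have hi := (hasDerivAt_integral_gomesCore hk).1
  have hs := integrableOn_sum_cosh (N + 1) 1 fun n => coreCoeff n * k ^ n
  rw [← integral_sum_cosh (N + 1) 1 fun n => coreCoeff n * k ^ n, ← integral_sub hi hs, halfMoment,
    coshMoment, ← integral_const_mul]
  exact (abs_integral_le_integral_abs).trans (integral_mono (hi.sub hs).abs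
    ((integrableOn_cosh_rpow_half (N + 2)).const_mul _) fun u => abs_gomesCore_sub_le hk N u)

/-- With `w = k / cosh u` the kernel is `√(cosh u) ((1 - w)^(-1/2) - 1) - cosh^(-3/2) u`. The
constant term of the series cancels, which shifts its indices by one. -/
lemma slopeKernel_bounds {k : ℝ} (hk : k ∈ Ioo (0 : ℝ) 1) (N : ℕ) (u : ℝ) :
    ∑ n ∈ Finset.range N,
        invSqrtCoeff (n + 1) * k ^ (n + 1) * Real.cosh u ^ (-((n + 0 : ℕ) + 1 / 2) : ℝ)
      - Real.cosh u ^ (-((1 : ℕ) + 1 / 2) : ℝ) ≤ slopeKernel k u ∧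
    slopeKernel k u ≤ ∑ n ∈ Finset.range N,
        invSqrtCoeff (n + 1) * k ^ (n + 1) * Real.cosh u ^ (-((n + 0 : ℕ) + 1 / 2) : ℝ)
      - Real.cosh u ^ (-((1 : ℕ) + 1 / 2) : ℝ)
      + invSqrtCoeff (N + 1) * k ^ (N + 1) / (1 - k) * Real.cosh u ^ (-(N + 1 / 2) : ℝ) := by
  have hc := Real.cosh_pos u
  have hc1 := Real.one_le_cosh u
  have hw0 : 0 ≤ k / Real.cosh u := div_nonneg hk.1.le hc.le
  have hwk : k / Real.cosh u ≤ k := div_le_self hk.1.le hc1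
  have hw : k / Real.cosh u ∈ Ico (0 : ℝ) 1 := ⟨hw0, hwk.trans_lt hk.2⟩
  have h1 := invSqrtSum_le hw N
  have h2 := le_invSqrtSum hw N
  have hr := Real.sqrt_pos.2 hc
  have hr2 := Real.sq_sqrt hc.le
  have hq : 0 < √(1 - k / Real.cosh u) := Real.sqrt_pos.2 (by linarith [hk.2])
  have e1 : slopeKernel k u = √(Real.cosh u) * ((√(1 - k / Real.cosh u))⁻¹ - 1)
      - Real.cosh u ^ (-((1 : ℕ) + 1 / 2) : ℝ) := by
    rw [slopeKernel, sqrt_cosh_sub, cosh_rpow_half, pow_one]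
    congr 1
    generalize √(1 - k / Real.cosh u) = q at *
    generalize √(Real.cosh u) = r at *
    rw [← hr2]
    field_simp
  have e2 : ∑ n ∈ Finset.range N,
        invSqrtCoeff (n + 1) * k ^ (n + 1) * Real.cosh u ^ (-((n + 0 : ℕ) + 1 / 2) : ℝ)
      = √(Real.cosh u) * (invSqrtSum (N + 1) (k / Real.cosh u) - 1) := by
    rw [invSqrtSum, Finset.sum_range_succ', pow_zero, invSqrtCoeff, mul_one, add_sub_cancel_right,
      Finset.mul_sum]
    refine Finset.sum_congr rfl fun n _ => ?_
    rw [cosh_rpow_half, div_pow, pow_succ (Real.cosh u), add_zero]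
    generalize √(Real.cosh u) = r at *
    field_simp
    rw [hr2]
  have e3 : √(Real.cosh u) * (invSqrtCoeff (N + 1) * (k / Real.cosh u) ^ (N + 1) / (1 - k))
      = invSqrtCoeff (N + 1) * k ^ (N + 1) / (1 - k) * Real.cosh u ^ (-(N + 1 / 2) : ℝ) := by
    rw [cosh_rpow_half, div_pow, pow_succ (Real.cosh u)]
    have : 0 < 1 - k := by linarith [hk.2]
    generalize √(Real.cosh u) = r at *
    field_simp
    linear_combination (invSqrtCoeff (N + 1) * k ^ (N + 1)) * hr2
  have h4 : invSqrtCoeff (N + 1) * (k / Real.cosh u) ^ (N + 1) / (1 - k / Real.cosh u)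
      ≤ invSqrtCoeff (N + 1) * (k / Real.cosh u) ^ (N + 1) / (1 - k) := by
    have := (invSqrtCoeff_pos (N + 1)).le
    have : 0 < 1 - k := by linarith [hk.2]
    gcongr
  rw [e1, e2, ← e3]
  constructor
  · gcongr
  · have := mul_le_mul_of_nonneg_left (h2.trans (add_le_add_right h4 _)) hr.le
    linarith

/-- Power series evaluation of `gomesSlope`. -/
lemma gomesSlope_bounds {k : ℝ} (hk : k ∈ Ioo (0 : ℝ) 1) (N : ℕ) :
    ∑ n ∈ Finset.range N, invSqrtCoeff (n + 1) * k ^ (n + 1) * halfMoment n - halfMoment 1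
      ≤ gomesSlope k ∧
    gomesSlope k ≤
      ∑ n ∈ Finset.range N, invSqrtCoeff (n + 1) * k ^ (n + 1) * halfMoment n - halfMoment 1
        + invSqrtCoeff (N + 1) * k ^ (N + 1) / (1 - k) * halfMoment N := by
  have hi := integrableOn_slopeKernel hk
  have hs := integrableOn_sum_cosh N 0 fun n => invSqrtCoeff (n + 1) * k ^ (n + 1)
  have h1 := integrableOn_cosh_rpow_half 1
  have hN := (integrableOn_cosh_rpow_half N).const_mul
    (invSqrtCoeff (N + 1) * k ^ (N + 1) / (1 - k))
  have e := integral_sum_cosh N 0 fun n => invSqrtCoeff (n + 1) * k ^ (n + 1)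
  simp only [add_zero] at e hs
  rw [← e, halfMoment, coshMoment, halfMoment, coshMoment, ← integral_const_mul,
    ← integral_sub hs h1]
  constructor
  · exact integral_mono (hs.sub h1) hi fun u => by simpa using (slopeKernel_bounds hk N u).1
  · have hs1 : IntegrableOn (fun u => ∑ n ∈ Finset.range N, invSqrtCoeff (n + 1) * k ^ (n + 1) *
        Real.cosh u ^ (-(n + 1 / 2) : ℝ) - Real.cosh u ^ (-((1 : ℕ) + 1 / 2) : ℝ)) (Ioi 0) :=
      hs.sub h1
    rw [← integral_add hs1 hN]
    exact integral_mono hi (hs1.add hN) fun u => by simpa using (slopeKernel_bounds hk N u).2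

/-! ### Numerical bounds -/

lemma halfMoment_zero_bounds : 2.62205749 < halfMoment 0 ∧ halfMoment 0 < 2.62205762 := by
  rw [halfMoment, show ((0 : ℕ) + 1 / 2 : ℝ) = 1 / 2 by norm_num]
  exact coshMoment_half_bounds

lemma halfMoment_one_bounds : 1.19814018 < halfMoment 1 ∧ halfMoment 1 < 1.19814029 := by
  rw [halfMoment, show ((1 : ℕ) + 1 / 2 : ℝ) = 3 / 2 by norm_num]
  exact coshMoment_three_halves_bounds

-- The moment recurrence makes the truncated series a linear form in `halfMoment 0` and `halfMoment
-- 1`, whose bounds decide the sign. The remainder after 34 terms is of order `10⁻⁸`.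
set_option maxRecDepth 10000 in
lemma gomesSlope_neg : gomesSlope 0.652229 < 0 := by
  have h := (gomesSlope_bounds (k := 0.652229) (by norm_num) 34).2
  refine h.trans_lt ?_
  obtain ⟨a1, a2⟩ := halfMoment_zero_bounds
  obtain ⟨b1, b2⟩ := halfMoment_one_bounds
  simp only [Finset.sum_range_succ, Finset.sum_range_zero, halfMoment_add_two, invSqrtCoeff]
  generalize halfMoment 0 = x at *
  generalize halfMoment 1 = y at *
  norm_num
  linarith

set_option maxRecDepth 10000 in
lemma gomesSlope_pos : 0 < gomesSlope 0.652230 := by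
  have h := (gomesSlope_bounds (k := 0.652230) (by norm_num) 34).1
  refine lt_of_lt_of_le ?_ h
  obtain ⟨a1, a2⟩ := halfMoment_zero_bounds
  obtain ⟨b1, b2⟩ := halfMoment_one_bounds
  simp only [Finset.sum_range_succ, Finset.sum_range_zero, halfMoment_add_two, invSqrtCoeff]
  generalize halfMoment 0 = x at *
  generalize halfMoment 1 = y at *
  norm_num
  linarith

set_option maxRecDepth 10000 in
lemma integral_gomesCore_bounds :
    1.1576961 < (∫ u in Ioi 0, gomesCore 0.652229 u) ∧
      (∫ u in Ioi 0, gomesCore 0.652229 u) < 1.1576972 := by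
  have h := abs_integral_gomesCore_sub_le (k := 0.652229) (by norm_num) 38
  obtain ⟨a1, a2⟩ := halfMoment_zero_bounds
  obtain ⟨b1, b2⟩ := halfMoment_one_bounds
  obtain ⟨s, hs⟩ : ∃ s, s = ∑ n ∈ Finset.range (38 + 1),
    coreCoeff n * 0.652229 ^ n * halfMoment (n + 1) := ⟨_, rfl⟩
  rw [← hs] at h
  norm_num [Finset.sum_range_succ, halfMoment_add_two, invSqrtCoeff, coreCoeff] at hs
  obtain ⟨h1, h2⟩ := abs_le.1 (h.trans (b := _) (c := 0.00000003) (by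
    norm_num [halfMoment_add_two, invSqrtCoeff, coreCoeff]
    linarith))
  constructor <;> linarith

/-! ### The maximum of the Gomes function -/

lemma two_mul_gomesOf_eq (k : ℝ) :
    2 * gomesOf k = √(2 * (k * (1 - k ^ 2))) * ∫ u in Ioi 0, gomesCore k u := by
  have h : 2 * (√2)⁻¹ = √2 := by
    have := Real.sq_sqrt (zero_le_two (α := ℝ))
    field_simp
    linarith
  rw [gomesOf_eq, ← mul_assoc, h, ← mul_assoc, ← Real.sqrt_mul zero_le_two]

/-- This carries the numerical value at the left end to the whole bracket. There `cosh u - k` stays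
above `0.347`, so its square root changes by a relative amount below `2·10⁻⁶`, while `cosh u + k`
only grows. -/
lemma integral_gomesCore_le {k : ℝ} (hk : k ∈ Icc (0.652229 : ℝ) 0.652230) :
    ∫ u in Ioi 0, gomesCore k u ≤ 1.000002 * ∫ u in Ioi 0, gomesCore 0.652229 u := by
  have hk' : k ∈ Ioo (0 : ℝ) 1 := ⟨by linarith [hk.1], by linarith [hk.2]⟩
  rw [← integral_const_mul]
  refine integral_mono (hasDerivAt_integral_gomesCore hk').1
    ((hasDerivAt_integral_gomesCore (by norm_num)).1.const_mul _) fun u => ?_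
  have hc := Real.one_le_cosh u
  have h1 : 0 < Real.cosh u + 0.652229 := by linarith
  have h2 : 0 < Real.cosh u - 0.652229 := by linarith
  have h3 : 0 < Real.cosh u - k := by linarith [hk.2]
  have q3 := Real.sqrt_pos.2 h3
  have q2 := Real.sqrt_pos.2 h2
  have hq : √(Real.cosh u - 0.652229) ≤ 1.000002 * √(Real.cosh u - k) := by
    rw [Real.sqrt_le_left (by positivity), mul_pow, Real.sq_sqrt h3.le]
    nlinarith [hk.2]
  simp only [gomesCore]
  rw [← div_eq_mul_inv, inv_eq_one_div, div_le_div_iff₀ (mul_pos (by linarith [hk.1]) q3)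
    (mul_pos h1 q2), one_mul]
  calc _ ≤ (Real.cosh u + k) * (1.000002 * √(Real.cosh u - k)) := by
        have : 0 ≤ Real.cosh u + k := by linarith [hk.1]
        gcongr
        exact hk.1
    _ = _ := by ring

lemma lt_two_mul_gomesOf : 1.002285 < 2 * gomesOf 0.652229 := by
  rw [two_mul_gomesOf_eq]
  have h1 := integral_gomesCore_bounds.1
  have h2 : 0.8657585 < √(2 * (0.652229 * (1 - 0.652229 ^ 2))) := by
    rw [Real.lt_sqrt (by norm_num)]
    norm_num
  nlinarith

/-- The maximiser is known only up to the bracket, so the upper bound must hold throughout it; for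
the lower bound a single point suffices. -/
lemma two_mul_gomesOf_lt {k : ℝ} (hk : k ∈ Icc (0.652229 : ℝ) 0.652230) :
    2 * gomesOf k < 1.002295 := by
  have hk0 : 0 < k := by linarith [hk.1]
  have h1 : √(2 * (k * (1 - k ^ 2))) ≤ 0.865761 := by
    rw [Real.sqrt_le_left (by norm_num)]
    have h2 : (0.652229 : ℝ) ^ 2 ≤ k ^ 2 := by gcongr; exact hk.1
    have h3 : k * (1 - k ^ 2) ≤ 0.652230 * (1 - 0.652229 ^ 2) := by
      apply mul_le_mul hk.2 (by linarith) _ (by norm_num)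
      nlinarith [hk.2]
    norm_num at h3 ⊢
    linarith
  have h4 := (integral_gomesCore_le hk).trans
    (mul_le_mul_of_nonneg_left integral_gomesCore_bounds.2.le (by norm_num))
  rw [two_mul_gomesOf_eq]
  calc _ ≤ 0.865761 * (1.000002 * 1.1576972) := mul_le_mul h1 h4
        (integral_nonneg fun u => (gomesCore_pos ⟨hk0, by linarith [hk.2]⟩).le) (by norm_num)
    _ < _ := by norm_num

/-- The maximum of `gomesOf`, with the numerical values that go with it. -/
lemma exists_max_gomesOf : ∃ k ∈ Icc (0.652229 : ℝ) 0.652230,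
    StrictMonoOn gomesOf (Icc 0 k) ∧ StrictAntiOn gomesOf (Icc k 1) ∧
    1.002285 ≤ 2 * gomesOf k := by
  obtain ⟨k, hk, h1, h2⟩ := exists_unimodal (by norm_num) (by norm_num) gomesSlope_neg
    gomesSlope_pos
  refine ⟨k, hk, h1, h2, ?_⟩
  have := h1.monotoneOn ⟨by norm_num, hk.1⟩ ⟨by linarith [hk.1], le_rfl⟩ hk.1
  linarith [lt_two_mul_gomesOf]

/-- Together with `lt_cosh`, this converts the bracket for `k = 1 / cosh (2a)` into `0.99153 < 2a <
0.99155`, the required tolerance for `a_c`. -/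
lemma cosh_lt : Real.cosh 0.99153 < (0.652230 : ℝ)⁻¹ := by
  have h1 := Real.exp_bound' (x := 0.99153) (by norm_num) (by norm_num) (n := 12) (by norm_num)
  have h2 := Real.sum_le_exp_of_nonneg (x := 0.99153) (by norm_num) 12
  rw [Real.cosh_eq, Real.exp_neg]
  simp only [Finset.sum_range_succ, Finset.sum_range_zero, Nat.factorial] at h1 h2
  norm_num at h1 h2
  have h0 := Real.exp_pos 0.99153
  have h3 : (Real.exp 0.99153)⁻¹ ≤ 0.371009 := by
    rw [inv_le_comm₀ h0 (by norm_num)]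
    norm_num at h2 ⊢
    linarith
  norm_num at h3 ⊢
  linarith

lemma lt_cosh : (0.652229 : ℝ)⁻¹ < Real.cosh 0.99155 := by
  have h1 := Real.exp_bound' (x := 0.99155) (by norm_num) (by norm_num) (n := 14) (by norm_num)
  have h2 := Real.sum_le_exp_of_nonneg (x := 0.99155) (by norm_num) 14
  rw [Real.cosh_eq, Real.exp_neg]
  simp only [Finset.sum_range_succ, Finset.sum_range_zero, Nat.factorial] at h1 h2
  norm_num at h1 h2
  have h0 := Real.exp_pos 0.99155
  have h3 : 0.3710011 ≤ (Real.exp 0.99155)⁻¹ := by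
    rw [le_inv_comm₀ (by norm_num) h0]
    norm_num at h1 ⊢
    linarith
  norm_num at h3 ⊢
  linarith

lemma strictAntiOn_inv_cosh : StrictAntiOn (fun a : ℝ => (Real.cosh (2 * a))⁻¹) (Ici 0) := by
  intro a ha b hb hab
  have ha' : 0 ≤ a := ha
  have : Real.cosh (2 * a) < Real.cosh (2 * b) :=
    Real.cosh_strictMonoOn (by simpa using ha') (by simpa using ha'.trans hab.le) (by linarith)
  exact inv_strictAnti₀ (Real.cosh_pos _) this

lemma exists_max_gomes : ∃ a : ℝ, 0 < a ∧ |a - 0.49577| ≤ 0.000005 ∧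
    |2 * gomes a - 1.00229| ≤ 0.000005 ∧
    StrictMonoOn gomes (Icc 0 a) ∧ StrictAntiOn gomes (Ici a) := by
  obtain ⟨k, hk, h1, h2, h3⟩ := exists_max_gomesOf
  have k0 : 0 < k := by linarith [hk.1]
  have k1 : k < 1 := by linarith [hk.2]
  have hk1 : 1 < k⁻¹ := (one_lt_inv₀ k0).2 k1
  obtain ⟨a, ha⟩ : ∃ a, a = Real.arcosh k⁻¹ / 2 := ⟨_, rfl⟩
  have ha0 : 0 < a := by
    have := Real.arcosh_pos hk1
    linarith
  have hc : Real.cosh (2 * a) = k⁻¹ := by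
    rw [ha, mul_div_cancel₀ _ two_ne_zero, Real.cosh_arcosh hk1.le]
  have hinv : (Real.cosh (2 * a))⁻¹ = k := by rw [hc, inv_inv]
  have hlo : 0.99153 < 2 * a := by
    by_contra h
    push Not at h
    have := Real.cosh_strictMonoOn.monotoneOn (a := 2 * a) (b := 0.99153)
      (by simpa using ha0.le) (by norm_num) h
    have h4 : (0.652230 : ℝ)⁻¹ ≤ k⁻¹ := inv_anti₀ k0 hk.2
    linarith [cosh_lt]
  have hhi : 2 * a < 0.99155 := by
    by_contra h
    push Not at h
    have := Real.cosh_strictMonoOn.monotoneOn (b := 2 * a) (a := 0.99155)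
      (by norm_num) (by simpa using ha0.le) h
    have h4 : k⁻¹ ≤ (0.652229 : ℝ)⁻¹ := inv_anti₀ (by norm_num) hk.1
    linarith [lt_cosh]
  refine ⟨a, ha0, ?_, ?_, ?_, ?_⟩
  · rw [abs_le]
    constructor <;> linarith
  · rw [gomes_eq ha0, hinv, abs_le]
    have := two_mul_gomesOf_lt hk
    constructor <;> linarith
  -- The map `a ↦ 1 / cosh (2a)` reverses order, so the decreasing branch on `[k, 1]` becomes the
  -- increasing branch on `[0, a]`.
  · intro x hx y hy hxy
    have hlt := strictAntiOn_inv_cosh hx.1 hy.1 hxy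
    rw [gomes_eq_of_nonneg hx.1, gomes_eq_of_nonneg hy.1]
    refine h2 ⟨?_, (inv_cosh_mem_Icc y).2⟩ ⟨?_, (inv_cosh_mem_Icc x).2⟩ hlt
    · rw [← hinv]
      exact strictAntiOn_inv_cosh.antitoneOn hy.1 ha0.le hy.2
    · rw [← hinv]
      exact strictAntiOn_inv_cosh.antitoneOn hx.1 ha0.le hx.2
  · intro x hx y hy hxy
    have hx0 : 0 ≤ x := ha0.le.trans hx
    have hy0 : 0 ≤ y := ha0.le.trans hy
    have hlt := strictAntiOn_inv_cosh hx0 hy0 hxy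
    rw [gomes_eq_of_nonneg hx0, gomes_eq_of_nonneg hy0]
    refine h1 ⟨(inv_cosh_mem_Icc y).1, ?_⟩ ⟨(inv_cosh_mem_Icc x).1, ?_⟩ hlt
    · rw [← hinv]
      exact strictAntiOn_inv_cosh.antitoneOn ha0.le hy0 hy
    · rw [← hinv]
      exact strictAntiOn_inv_cosh.antitoneOn ha0.le hx0 hx

/-- Every positive value up to the maximum is attained. -/
lemma exists_gomes_eq {a ρ : ℝ} (ha : 0 < a) (hρ : 0 < ρ) (hle : ρ ≤ gomes a) :
    ∃ b, 0 < b ∧ gomes b = ρ := by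
  obtain ⟨b, hb, hbρ⟩ := intermediate_value_Icc ha.le (continuousOn_gomes.mono Icc_subset_Ici_self)
    (show ρ ∈ Icc (gomes 0) (gomes a) from ⟨by rw [gomes_zero]; exact hρ.le, hle⟩)
  refine ⟨b, hb.1.lt_of_ne ?_, hbρ⟩
  rintro rfl
  rw [gomes_zero] at hbρ
  exact hρ.ne hbρ

end HypCatenoid

end

theorem theorem3p1 :
    (∀ a : ℝ, 0 < a → IntegrableOn (HypCatenoid.gomesIntegrand a) (Ioi a)) ∧
    ∃ a_c : ℝ, 0 < a_c ∧
      |a_c - 0.49577| ≤ 0.000005 ∧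
      |2 * HypCatenoid.gomes a_c - 1.00229| ≤ 0.000005 ∧
      HypCatenoid.gomes 0 = 0 ∧
      Tendsto HypCatenoid.gomes (𝓝[>] 0) (𝓝 0) ∧
      StrictMonoOn HypCatenoid.gomes (Icc 0 a_c) ∧
      StrictAntiOn HypCatenoid.gomes (Ici a_c) ∧
      (∀ a : ℝ, 0 ≤ a → a ≠ a_c → HypCatenoid.gomes a < HypCatenoid.gomes a_c) ∧
      Tendsto HypCatenoid.gomes atTop (𝓝 0) ∧
      ∀ C₁ C₂ : Set HypCatenoid.E3,
        HypCatenoid.IsCircleAtInfinity C₁ → HypCatenoid.IsCircleAtInfinity C₂ →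
        Disjoint C₁ C₂ →
        HypCatenoid.circleDist C₁ C₂ ≤ 2 * HypCatenoid.gomes a_c →
        ∃ S : Set HypCatenoid.E3, HypCatenoid.IsSphericalMinimalCatenoid S ∧
          HypCatenoid.asymptoticBoundary S = C₁ ∪ C₂ := by
  refine ⟨fun a ha => HypCatenoid.integrableOn_gomesIntegrand ha, ?_⟩
  obtain ⟨a_c, hpos, hac, hval, hmono, hanti⟩ := HypCatenoid.exists_max_gomes
  refine ⟨a_c, hpos, hac, hval, HypCatenoid.gomes_zero, HypCatenoid.tendsto_gomes_zero, hmono,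
    hanti, fun a ha hne => ?_, HypCatenoid.tendsto_gomes_atTop, fun C₁ C₂ h₁ h₂ hd hle => ?_⟩
  · rcases hne.lt_or_gt with h | h
    · exact hmono ⟨ha, h.le⟩ ⟨hpos.le, le_rfl⟩ h
    · exact hanti self_mem_Ici h.le h
  -- From `2ρ ≤ d_L ≤ 2ϱ(a_c)`, `ρ` is a value of `ϱ`, and the catenoid with that parameter has its
  -- ends at axial positions `±ρ`.
  · obtain ⟨ρ, hρ, hρd, hex⟩ := HypCatenoid.exists_catenoid_of_disjoint h₁ h₂ hd
    obtain ⟨b, hb, rfl⟩ := HypCatenoid.exists_gomes_eq hpos hρ (by linarith)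
    exact hex b hb (HypCatenoid.tendsto_catX hb)
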